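/- Let $(W,S)$ be a finite Coxeter system with longest element $w_\circ$ and $m_{st}$ the order of $st$, acting on a Euclidean space $V$ so that the simple roots $(\alpha_s)_{s\in S}$ form a basis of $V$, each $s\in S$ acts as the orthogonal reflection exchanging $\alpha_s$ and $-\alpha_s$, and the numbers $a_{st}=2\langle\alpha_s,\alpha_t\rangle/\langle\alpha_s,\alpha_s\rangle$ satisfy $a_{st}\le 0$ for $s\ne t$ and $a_{st}a_{ts}=4\cos^2(\pi/m_{st})$. Let $(\omega_s)_{s\in S}$ be the fundamental weights, $\langle\alpha_s,\omega_t\rangle=\delta_{s=t}\langle\alpha_s,\alpha_s\rangle/2$, and put $q=\sum_{s\in S}\omega_s$. Let $\mathrm{c}$ be a word in which each letter of $S$ occurs exactly once, i.e. a reduced expression of a Coxeter element $c$. The $\mathrm{c}$-sorting word of $w\in W$ is the lexicographically first (as a sequence of positions) reduced subword of $\mathrm{c}\mathrm{c}\mathrm{c}\cdots$ for $w$. If $K_j$ denotes the set of letters that it uses in the $j$-th copy of $\mathrm{c}$, then $w$ is $c$-sortable when $K_1\supseteq K_2\supseteq\cdots$. An element $w\in W$ is a $c$-singleton if $w$ is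 the only element $u\in W$ such that $w$ is the maximal $c$-sortable element below $u$ in the right weak order. The Hohlweg–Lange–Thomas $c$-associahedron $\mathsf{Asso}_c^q(W)$ is the intersection of the half-spaces that define the facets of the permutahedron $\operatorname{conv}\{w(q) : w\in W\}$ containing a point $x(q)$ for some $c$-singleton $x$, that is, $$\mathsf{Asso}_c^q(W)=\bigcap_{x\ c\text{-singleton}}\ \bigcap_{s\in S}\{v\in V : \langle x(\omega_s),v\rangle\le\langle\omega_s,q\rangle\}.$$ Let $w_1\cdots w_N$ be the $\mathrm{c}$-sorting word $\mathrm{w}_\circ(\mathrm{c})$ of $w_\circ$, let $\Omega=\sum_{p=1}^N w_1\cdots w_{p-1}(\omega_{w_p})$, and let $\mathrm{Q}=q_1\cdots q_m$ be the concatenation $\mathrm{c}\,\mathrm{w}_\circ(\mathrm{c})$. The subword complex $\mathcal{S}(\mathrm{Q})$ is the simplicial complex of all sets of positions in $\mathrm{Q}$ whose complement contains a reduced expression of $w_\circ$. For a facet $I$ of $\mathcal{S}(\mathrm{Q})$, the brick vector is $\mathsf{B}(I)=\sum_{k=1}^m \mathsf{w}(I,k)$, where $\mathsf{w}(I,k)=\sigma(\omega_{q_k})$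 and $\sigma$ is the product, in order, of the letters $q_z$ with $z<k$ and $z\notin I$. The brick polytope $\mathcal{B}(\mathrm{Q})$ is the convex hull of the brick vectors of all facets of $\mathcal{S}(\mathrm{Q})$. Then $$\mathcal{B}(\mathrm{c}\,\mathrm{w}_\circ(\mathrm{c}))=\Omega+\mathsf{Asso}_c^q(W),$$ and the vertices of $\mathsf{Asso}_c^q(W)$ are exactly the points $\mathsf{B}(I)-\Omega$ for $I$ a facet of $\mathcal{S}(\mathrm{c}\,\mathrm{w}_\circ(\mathrm{c}))$. -/

import Mathlib

open scoped RealInnerProductSpace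

namespace BrickPolytope

/-- A word for a Coxeter element: every simple generator occurs exactly once. -/
structure CoxeterWord (B : Type*) where
  letters : List B
  nodup : letters.Nodup
  complete : ∀ s, s ∈ letters

section Words

variable {B W : Type*} [Group W] {M : CoxeterMatrix B} (cs : CoxeterSystem M W)

/-- The (right) weak order: `u ≤ w` iff `w = u v` with `ℓ(u) + ℓ(v) = ℓ(w)`. -/
def WeakLE (u w : W) : Prop :=
  ∃ v : W, u * v = w ∧ cs.length u + cs.length v = cs.length w

/-- The longest element of a finite Coxeter group. -/
noncomputable def longestElement [Finite W] : W :=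
  (Finite.exists_max cs.length).choose

theorem length_le_length_longestElement [Finite W] (w : W) :
    cs.length w ≤ cs.length (longestElement cs) :=
  (Finite.exists_max cs.length).choose_spec w

variable (c : CoxeterWord B)

/-- `p` is an increasing sequence of positions in the infinite word `c c c ⋯` (whose `k`-th letter,
`k = 0, 1, 2, …`, is the letter of `c` at position `k` modulo the length of `c`), and the letters
`u` at these positions form a reduced expression of `w`. -/
def IsReducedSubwordAt (w : W) (u : List B) (p : List ℕ) : Prop :=
  p.Pairwise (· < ·) ∧
    p.map (fun k => c.letters[k % c.letters.length]?) = u.map some ∧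
    cs.IsReduced u ∧ cs.wordProd u = w

theorem exists_positions (c : CoxeterWord B) (u : List B) :
    ∀ j : ℕ, ∃ p : List ℕ, p.Pairwise (· < ·) ∧ (∀ k ∈ p, j * c.letters.length ≤ k) ∧
      p.map (fun k => c.letters[k % c.letters.length]?) = u.map some := by
  induction u with
  | nil => exact fun j => ⟨[], by simp⟩
  | cons b u ih =>
    intro j
    obtain ⟨p, hp, hj, he⟩ := ih (j + 1)
    obtain ⟨i, hi, hb⟩ := List.getElem_of_mem (c.complete b)
    refine ⟨(j * c.letters.length + i) :: p, ?_, ?_, ?_⟩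
    · refine List.pairwise_cons.2 ⟨fun k hk => ?_, hp⟩
      have := hj k hk
      rw [Nat.add_mul] at this
      omega
    · intro k hk
      rcases List.mem_cons.1 hk with rfl | hk
      · omega
      · have := hj k hk
        rw [Nat.add_mul] at this
        omega
    · have hm : (j * c.letters.length + i) % c.letters.length = i := by
        rw [Nat.add_comm, Nat.add_mul_mod_self_right, Nat.mod_eq_of_lt hi]
      simp only [List.map_cons, he, hm, List.getElem?_eq_getElem hi, hb]

theorem exists_isLeast_positions (w : W) :
    ∃ up : List B × List ℕ, IsReducedSubwordAt cs c w up.1 up.2 ∧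
      ∀ u' p', IsReducedSubwordAt cs c w u' p' → up.2 ≤ p' := by
  obtain ⟨u₀, hu₀, hw⟩ := cs.exists_isReduced w
  obtain ⟨p₀, hp₀, -, he₀⟩ := exists_positions c u₀ 0
  have wf : WellFounded (List.Shortlex ((· < ·) : ℕ → ℕ → Prop)) :=
    List.Shortlex.wf wellFounded_lt
  have hlen : ∀ u p, IsReducedSubwordAt cs c w u p → p.length = cs.length w := by
    rintro u p ⟨-, h, hr, rfl⟩
    have := congrArg List.length h
    simp only [List.length_map] at this
    rw [this, hr.eq]
  let A : Set (List ℕ) := {p | ∃ u, IsReducedSubwordAt cs c w u p}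
  have hA : A.Nonempty := ⟨p₀, u₀, hp₀, he₀, hu₀, hw.symm⟩
  obtain ⟨u, hu⟩ := wf.min_mem A hA
  refine ⟨(u, wf.min A hA), hu, fun u' p' h' => ?_⟩
  refine not_lt.1 fun hlt => wf.not_lt_min A (x := p') ⟨u', h'⟩ ?_
  exact List.Shortlex.of_lex ((hlen _ _ h').trans (hlen _ _ hu).symm) hlt

/-- The `c`-sorting word of `w`: the lexicographically first, as a sequence of positions, reduced
subword of `c c c ⋯` for `w`. -/
noncomputable def sortingWord (w : W) : List B :=
  (exists_isLeast_positions cs c w).choose.1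

/-- The positions in `c c c ⋯` of the letters of the `c`-sorting word of `w`. -/
noncomputable def sortingPositions (w : W) : List ℕ :=
  (exists_isLeast_positions cs c w).choose.2

theorem sortingWord_spec (w : W) :
    IsReducedSubwordAt cs c w (sortingWord cs c w) (sortingPositions cs c w) ∧
      ∀ u' p', IsReducedSubwordAt cs c w u' p' → sortingPositions cs c w ≤ p' :=
  (exists_isLeast_positions cs c w).choose_spec

/-- The set of letters that the `c`-sorting word of `w` uses in the `j`-th copy of `c`
(`j = 0, 1, 2, …`). -/
def sortingBlock (w : W) (j : ℕ) : Set B :=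
  {s | ∃ k ∈ sortingPositions cs c w,
    k / c.letters.length = j ∧ c.letters[k % c.letters.length]? = some s}

/-- `w` is `c`-sortable: the blocks of its `c`-sorting word are nested. -/
def IsSortable (w : W) : Prop :=
  ∀ j, sortingBlock cs c w (j + 1) ⊆ sortingBlock cs c w j

/-- `v` is the maximal `c`-sortable element below `u` in weak order. -/
def IsMaxSortableBelow (u v : W) : Prop :=
  IsSortable cs c v ∧ WeakLE cs v u ∧
    ∀ v', IsSortable cs c v' → WeakLE cs v' u → WeakLE cs v' v

/-- `w` is a `c`-singleton: the fiber over `w` of the projection, which sends an element of `W` to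
the maximal `c`-sortable element below it, is `{w}`. -/
def IsSingleton (w : W) : Prop :=
  {u : W | IsMaxSortableBelow cs c u w} = {w}

/-- The subword of `Q` formed by the letters at the positions in `J`. -/
def subword (Q : List B) (J : Finset (Fin Q.length)) : List B :=
  ((List.finRange Q.length).filter (· ∈ J)).map Q.get

/-- The faces of the subword complex of `Q` for the longest element: the sets of positions whose
complement contains a reduced expression of the longest element. -/
def IsFace [Finite W] (Q : List B) (I : Finset (Fin Q.length)) : Prop :=
  ∃ J : Finset (Fin Q.length), J ⊆ Iᶜ ∧
    cs.IsReduced (subword Q J) ∧ cs.wordProd (subword Q J) = longestElement cs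

/-- The facets of the subword complex: the maximal faces. -/
def IsFacet [Finite W] (Q : List B) (I : Finset (Fin Q.length)) : Prop :=
  Maximal (IsFace cs Q) I

end Words

/-- The simple roots of the Coxeter system `(W, S)`, acting as an essential reflection group on the
euclidean space `V`. The simple roots form a basis of `V`, the simple reflection `s` acts as the
orthogonal reflection exchanging `α_s` and `-α_s`, and the numbers `a_{st} = 2⟨α_s, α_t⟩/⟨α_s, α_s⟩`
form a generalized Cartan matrix of `(W, S)`. (The lengths of the simple roots are arbitrary; the
conditions `a_{ss} = 2` and `a_{st} = 0 ↔ a_{ts} = 0` hold automatically.) -/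
structure SimpleRoots {B W : Type*} [Group W] {M : CoxeterMatrix B} (cs : CoxeterSystem M W)
    (V : Type*) [NormedAddCommGroup V] [InnerProductSpace ℝ V] where
  root : Module.Basis B ℝ V
  act : W →* (V ≃ₗᵢ[ℝ] V)
  act_simple : ∀ s, act (cs.simple s) = (ℝ ∙ root s)ᗮ.reflection
  cartan_nonpos : ∀ s t, s ≠ t → 2 * ⟪root s, root t⟫ / ⟪root s, root s⟫ ≤ 0
  cartan_mul : ∀ s t, (2 * ⟪root s, root t⟫ / ⟪root s, root s⟫) *
    (2 * ⟪root t, root s⟫ / ⟪root t, root t⟫) = 4 * Real.cos (Real.pi / M s t) ^ 2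

section Geometry

variable {B W V : Type*} [Fintype B] [Group W] {M : CoxeterMatrix B} {cs : CoxeterSystem M W}
  [NormedAddCommGroup V] [InnerProductSpace ℝ V] (R : SimpleRoots cs V)

/-- The fundamental weight `ω_t`, the vector with `⟨α_s, ω_t⟩ = δ_{s = t} ⟨α_s, α_s⟩ / 2` for all
simple roots `α_s` (see `inner_root_weight`): it represents the linear functional
`(⟨α_t, α_t⟩ / 2) • α_t^*`, where `α^*` is the dual basis of the simple roots. -/
noncomputable def weight (t : B) : V :=
  haveI : FiniteDimensional ℝ V := Module.Finite.of_basis R.root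
  haveI : CompleteSpace V := FiniteDimensional.complete ℝ V
  (InnerProductSpace.toDual ℝ V).symm
    (LinearMap.toContinuousLinearMap ((⟪R.root t, R.root t⟫ / 2) • R.root.coord t))

theorem inner_root_weight [DecidableEq B] (s t : B) :
    ⟪R.root s, weight R t⟫ = if s = t then ⟪R.root s, R.root s⟫ / 2 else 0 := by
  have : FiniteDimensional ℝ V := Module.Finite.of_basis R.root
  have : CompleteSpace V := FiniteDimensional.complete ℝ V
  rw [real_inner_comm, weight, InnerProductSpace.toDual_symm_apply]
  by_cases h : s = t
  · subst h
    simp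
  · simp [h]

/-- The weight function: `w(I, k)` is `σ (ω_{q_k})`, where `q_k` is the `k`-th letter of `Q` and `σ`
is the product, in order, of the letters at the positions before `k` that are not in `I`. -/
noncomputable def weightFunction (Q : List B) (I : Finset (Fin Q.length)) (k : Fin Q.length) : V :=
  R.act (cs.wordProd (subword Q (Finset.univ.filter fun z => z < k ∧ z ∉ I))) (weight R (Q.get k))

/-- The brick vector of `I`. -/
noncomputable def brickVector (Q : List B) (I : Finset (Fin Q.length)) : V :=
  ∑ k, weightFunction R Q I k

/-- The brick polytope of `Q`. -/
noncomputable def brickPolytope [Finite W] (Q : List B) : Set V :=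
  convexHull ℝ {v | ∃ I, IsFacet cs Q I ∧ brickVector R Q I = v}

/-- The sum `q` of all fundamental weights. -/
noncomputable def weightSum : V :=
  ∑ s, weight R s

/-- The half-space bounded by the hyperplane that supports the facet orthogonal to `x(ω_s)` of the
permutahedron `conv (W a)`, and containing this permutahedron. -/
def halfSpace (a : V) (x : W) (s : B) : Set V :=
  {v | ⟪R.act x (weight R s), v⟫ ≤ ⟪weight R s, a⟫}

/-- The `c`-associahedron `Asso_c^a(W)`: the intersection of the half-spaces that define the facets
of the permutahedron `conv (W a)` containing a point `x(a)` for some `c`-singleton `x`. The facets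
of the permutahedron that contain `x(a)` are those orthogonal to the vectors `x(ω_s)`. -/
def associahedron (c : CoxeterWord B) (a : V) : Set V :=
  ⋂ (x : W) (_ : IsSingleton cs c x) (s : B), halfSpace R a x s

/-- The word `c w₀(c)`: the word `c` followed by the `c`-sorting word of the longest element. -/
noncomputable def cw₀ (cs : CoxeterSystem M W) [Finite W] (c : CoxeterWord B) : List B :=
  c.letters ++ sortingWord cs c (longestElement cs)

/-- The vector `Ω = ∑_p w₁ ⋯ w_{p-1} (ω_{w_p})`, where `w₁ ⋯ w_N` is the `c`-sorting word of the
longest element. -/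
noncomputable def translationVector [Finite W] (c : CoxeterWord B) : V :=
  ∑ p : Fin (sortingWord cs c (longestElement cs)).length,
    R.act (cs.wordProd ((sortingWord cs c (longestElement cs)).take p))
      (weight R ((sortingWord cs c (longestElement cs)).get p))

end Geometry

end BrickPolytope

namespace BrickPolytope

/-! ### Roots, descents and faithfulness of the action -/

section RootSystem

variable {B W V : Type*} [Group W] {M : CoxeterMatrix B} {cs : CoxeterSystem M W}
  [NormedAddCommGroup V] [InnerProductSpace ℝ V] (R : SimpleRoots cs V)

/-! Treat `c` as a queue. Its first letter is taken and returns to the end of the queue if it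
increases the length of the element built so far; otherwise it is deleted. The taken letters spell
`w₀(c)`. Since exactly the taken letters return, the letters read spell `Q = c w₀(c)`
(`Steps.append_eq`). So `Q` carries a distinguished marking, the `Skeleton`, in which every skipped
letter is orthogonal to all letters taken later.

For a position `k` of `Q` with letter `s`, let `x` be the product of the skeleton letters taken
before `k`, and let `ρ_k = x(ω_s)`. Every facet `I` satisfies `⟨ρ_k, B(I) - Ω⟩ ≤ ⟨ω_s, q⟩`; if `k ∈
I`, then equality holds and `w(I, k) = ρ_k` (`Skeleton.inner_brickSum_le`, `Skeleton.tight`). The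
weights are compared one at a time. For dominant `v` and `v'`, the pairing `⟨v, g v'⟩` decreases as
`g` grows in Bruhat order (`BruhatLE.inner_le`), and after multiplication by `x⁻¹` the prefix
products of any subword for `w₀` are bounded below by explicit elements.

The vectors `x(ω_s)`, for singletons `x`, are exactly the `ρ_k` (`IsSingleton.exists_position`,
`Greedy.isSingleton_of_append`). This rests on the skew form of the Coxeter element, which is
invariant under reading the queue. It forces skipped letters to be orthogonal to later ones, both in
the greedy word and in the sorting word of a singleton. Hence `B(I) - Ω` lies in the associahedron,
and the inequalities of the `dim V` positions in `I` are tight there.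

Finally, flipping `i ∈ I` moves `B(I)` by a negative multiple of a root `r_i`, and the `r_i` are
biorthogonal to the `ρ_i` (`exists_flip`, `exists_biorthogonal`). The tight inequalities thus cut
out a simplicial cone spanned by the flip directions, so `B(I) - Ω` is a vertex. A functional that
is maximal at `B(I)` among brick vectors is maximal on this cone, which contains the translated
associahedron; separating a point from the brick polytope gives the equality. -/

theorem inner_root_self_pos (s : B) : 0 < ⟪R.root s, R.root s⟫ :=
  real_inner_self_pos.2 (R.root.ne_zero s)

theorem act_simple_apply (s : B) (v : V) :
    R.act (cs.simple s) v = v - (2 * ⟪R.root s, v⟫ / ⟪R.root s, R.root s⟫) • R.root s := by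
  rw [R.act_simple, Submodule.reflection_orthogonal_apply, Submodule.reflection_singleton_apply,
    real_inner_self_eq_norm_sq]
  simp only [RCLike.ofReal_real_eq_id, id]
  rw [neg_sub, ← Nat.cast_smul_eq_nsmul ℝ, smul_smul]
  congr 2
  push_cast
  ring

theorem act_simple_root_self (s : B) : R.act (cs.simple s) (R.root s) = -R.root s := by
  rw [act_simple_apply, mul_div_assoc, div_self (inner_root_self_pos R s).ne']
  module

theorem act_mul_apply (w w' : W) (v : V) : R.act (w * w') v = R.act w (R.act w' v) := by
  rw [map_mul]; rfl

theorem act_inv_apply_apply (w : W) (v : V) : R.act w⁻¹ (R.act w v) = v := by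
  rw [← act_mul_apply, inv_mul_cancel, map_one]; rfl

theorem act_apply_inv_apply (w : W) (v : V) : R.act w (R.act w⁻¹ v) = v := by
  rw [← act_mul_apply, mul_inv_cancel, map_one]; rfl

theorem act_one_apply (v : V) : R.act 1 v = v := by rw [map_one]; rfl

theorem inner_act_left (w : W) (v v' : V) : ⟪R.act w v, v'⟫ = ⟪v, R.act w⁻¹ v'⟫ := by
  conv_lhs => rw [← act_apply_inv_apply R w v']
  exact (R.act w).inner_map_map _ _

theorem inner_act_right (w : W) (v v' : V) : ⟪v, R.act w v'⟫ = ⟪R.act w⁻¹ v, v'⟫ := by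
  rw [inner_act_left, inv_inv]

theorem act_simple_of_inner_eq_zero {s : B} {v : V} (h : ⟪R.root s, v⟫ = 0) :
    R.act (cs.simple s) v = v := by
  rw [act_simple_apply, h]; simp

theorem inner_eq_zero_of_act_simple {s : B} {v : V} (h : R.act (cs.simple s) v = v) :
    ⟪R.root s, v⟫ = 0 := by
  rw [act_simple_apply, sub_eq_self] at h
  have h0 := (smul_eq_zero.1 h).resolve_right (R.root.ne_zero s)
  have := (inner_root_self_pos R s).ne'
  rw [div_eq_zero_iff] at h0
  rcases h0 with h0 | h0
  · linarith
  · exact absurd h0 this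

theorem inner_root_nonpos {s t : B} (h : s ≠ t) : ⟪R.root s, R.root t⟫ ≤ 0 := by
  have h1 := R.cartan_nonpos s t h
  have h2 := inner_root_self_pos R s
  rw [div_le_iff₀ h2] at h1
  linarith

theorem repr_act_simple_of_ne {s t : B} (h : t ≠ s) (v : V) :
    R.root.repr (R.act (cs.simple s) v) t = R.root.repr v t := by
  rw [act_simple_apply]
  simp [h.symm]

/-- All coordinates of the vector in the basis of simple roots are nonnegative. -/
def IsNonneg (v : V) : Prop := ∀ s, 0 ≤ R.root.repr v s

/-- The vector is a positive multiple of a root. -/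
def IsRootRay (v : V) : Prop :=
  ∃ (w : W) (s : B) (a : ℝ), 0 < a ∧ v = a • R.act w (R.root s)

theorem isNonneg_root (s : B) : IsNonneg R (R.root s) := fun t => by
  classical
  rw [R.root.repr_self, Finsupp.single_apply]
  split_ifs <;> norm_num

variable {R}

theorem IsNonneg.add {v v' : V} (h : IsNonneg R v) (h' : IsNonneg R v') : IsNonneg R (v + v') :=
  fun s => by simpa using add_nonneg (h s) (h' s)

theorem IsNonneg.smul {v : V} (h : IsNonneg R v) {a : ℝ} (ha : 0 ≤ a) : IsNonneg R (a • v) :=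
  fun s => by simpa using mul_nonneg ha (h s)

theorem IsNonneg.eq_zero {v : V} (h : IsNonneg R v) (h' : IsNonneg R (-v)) : v = 0 := by
  apply R.root.repr.injective
  ext s
  have h1 := h s
  have h2 := h' s
  simp only [map_neg, Finsupp.coe_neg, Pi.neg_apply, map_zero, Finsupp.coe_zero,
    Pi.zero_apply] at *
  linarith

variable (R)

/-! ### Positivity of roots -/

/-- The value `0` encodes infinite order. Since `π / 0 = 0`, the cosine is then `1`, `cartan_mul`
becomes the equality case of Cauchy–Schwarz, and the two simple roots would be proportional. -/
theorem two_le_coxeterMatrix (R : SimpleRoots cs V) {s t : B} (h : s ≠ t) : 2 ≤ M s t := by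
  have h1 := M.off_diagonal s t h
  rcases Nat.lt_or_ge (M s t) 2 with h2 | h2
  swap
  · exact h2
  have h0 : M s t = 0 := by omega
  exfalso
  have hm := R.cartan_mul s t
  rw [h0] at hm
  have hs := inner_root_self_pos R s
  have ht := inner_root_self_pos R t
  have hst := inner_root_nonpos R h
  rw [real_inner_comm (R.root s) (R.root t)] at hm
  simp only [Nat.cast_zero, div_zero, Real.cos_zero, one_pow, mul_one] at hm
  have hm' : ⟪R.root s, R.root t⟫ * ⟪R.root s, R.root t⟫ =
      ⟪R.root s, R.root s⟫ * ⟪R.root t, R.root t⟫ := by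
    field_simp at hm
    nlinarith
  have hz : ⟪R.root t, R.root t⟫ • R.root s - ⟪R.root s, R.root t⟫ • R.root t = 0 := by
    rw [← inner_self_eq_zero (𝕜 := ℝ)]
    simp only [inner_sub_left, inner_sub_right, inner_smul_left, inner_smul_right,
      RCLike.conj_to_real, real_inner_comm (R.root s) (R.root t)]
    linear_combination (-⟪R.root t, R.root t⟫) * hm'
  have := congrArg (fun v => R.root.repr v s) hz
  simp only [map_sub, map_smul, R.root.repr_self, Finsupp.smul_single, Finsupp.coe_sub,
    Pi.sub_apply, Finsupp.single_eq_same, map_zero, Finsupp.coe_zero, Pi.zero_apply,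
    Finsupp.single_eq_of_ne h, smul_eq_mul, mul_one, sub_zero] at this
  exact ht.ne' this

theorem inner_root_root {s t : B} (h : s ≠ t) :
    ⟪R.root s, R.root t⟫ = -(‖R.root s‖ * ‖R.root t‖ * Real.cos (Real.pi / M s t)) := by
  have hM : (2 : ℝ) ≤ M s t := by exact_mod_cast two_le_coxeterMatrix R h
  have hcos : 0 ≤ Real.cos (Real.pi / M s t) := by
    apply Real.cos_nonneg_of_mem_Icc
    constructor
    · have : 0 ≤ Real.pi / M s t := by positivity
      linarith [Real.pi_pos]
    · exact div_le_div_of_nonneg_left Real.pi_pos.le (by norm_num) hM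
  have hs := norm_pos_iff.2 (R.root.ne_zero s)
  have ht := norm_pos_iff.2 (R.root.ne_zero t)
  have hst := inner_root_nonpos R h
  have hm := R.cartan_mul s t
  rw [real_inner_comm (R.root s) (R.root t), real_inner_self_eq_norm_sq,
    real_inner_self_eq_norm_sq] at hm
  have hsq : (-⟪R.root s, R.root t⟫) ^ 2 =
      (‖R.root s‖ * ‖R.root t‖ * Real.cos (Real.pi / M s t)) ^ 2 := by
    field_simp at hm
    nlinarith
  have := (sq_eq_sq₀ (by linarith) (by positivity)).1 hsq
  linarith

/-- The simple root scaled to length one. -/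
noncomputable def unitRoot (s : B) : V := ‖R.root s‖⁻¹ • R.root s

theorem root_eq_smul_unitRoot (s : B) : R.root s = ‖R.root s‖ • unitRoot R s := by
  rw [unitRoot, smul_smul, mul_inv_cancel₀ (norm_pos_iff.2 (R.root.ne_zero s)).ne', one_smul]

theorem act_simple_unitRoot_self (s : B) :
    R.act (cs.simple s) (unitRoot R s) = -unitRoot R s := by
  rw [unitRoot, map_smul, act_simple_root_self, smul_neg]

theorem act_simple_unitRoot {s t : B} (h : s ≠ t) :
    R.act (cs.simple s) (unitRoot R t) =
      unitRoot R t + (2 * Real.cos (Real.pi / M s t)) • unitRoot R s := by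
  have hs := (norm_pos_iff.2 (R.root.ne_zero s)).ne'
  have ht := (norm_pos_iff.2 (R.root.ne_zero t)).ne'
  rw [act_simple_apply, unitRoot, unitRoot, inner_smul_right, inner_root_root R h,
    real_inner_self_eq_norm_sq, smul_smul, sub_eq_add_neg, ← neg_smul]
  congr 2
  field_simp

/-- The dihedral picture: the coefficients are quotients of sines of multiples of `π / m`, and the
factor on the left clears the denominator. The induction is the three-term recurrence of these
sines. -/
theorem act_alternatingWord_unitRoot {s t : B} (h : s ≠ t) (k : ℕ) :
    Real.sin (Real.pi / M s t) •
      R.act (cs.wordProd (CoxeterSystem.alternatingWord s t k)) (unitRoot R s) =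
    if Even k then Real.sin ((k + 1) * (Real.pi / M s t)) • unitRoot R s +
        Real.sin (k * (Real.pi / M s t)) • unitRoot R t
      else Real.sin (k * (Real.pi / M s t)) • unitRoot R s +
        Real.sin ((k + 1) * (Real.pi / M s t)) • unitRoot R t := by
  induction k with
  | zero => simp [CoxeterSystem.alternatingWord]
  | succ k ih =>
    have hM : M t s = M s t := M.symmetric t s
    set θ := Real.pi / M s t with hθ
    have key : Real.sin ((k + 1 + 1) * θ) =
        2 * Real.cos θ * Real.sin ((k + 1) * θ) - Real.sin (k * θ) := by
      have e1 : ((k : ℝ) + 1 + 1) * θ = (k + 1) * θ + θ := by ring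
      have e2 : (k : ℝ) * θ = (k + 1) * θ - θ := by ring
      rw [e1, e2, Real.sin_add, Real.sin_sub]
      ring
    rw [CoxeterSystem.alternatingWord_succ', cs.wordProd_cons, act_mul_apply, ← map_smul, ih]
    by_cases hk : Even k
    · have hk' : ¬ Even (k + 1) := by simp [hk, parity_simps]
      rw [if_pos hk, if_pos hk, if_neg hk', map_add, map_smul, map_smul, act_simple_unitRoot_self,
        act_simple_unitRoot R h.symm, hM, ← hθ]
      push_cast
      rw [key]
      module
    · have hk' : Even (k + 1) := by simp [hk, parity_simps]
      rw [if_neg hk, if_neg hk, if_pos hk', map_add, map_smul, map_smul, act_simple_unitRoot_self,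
        act_simple_unitRoot R h, ← hθ]
      push_cast
      rw [key]
      module

/-- The bound on `k` keeps both angles of the sine formula in `[0, π]`. -/
theorem exists_act_alternatingWord_root {s t : B} (h : s ≠ t) {k : ℕ} (hk : k + 1 ≤ M s t) :
    ∃ a b : ℝ, 0 ≤ a ∧ 0 ≤ b ∧
      R.act (cs.wordProd (CoxeterSystem.alternatingWord s t k)) (R.root s) =
        a • R.root s + b • R.root t := by
  have hM : (2 : ℝ) ≤ M s t := by exact_mod_cast two_le_coxeterMatrix R h
  have hθ0 : 0 < Real.pi / M s t := by positivity
  have hsin : 0 < Real.sin (Real.pi / M s t) := by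
    apply Real.sin_pos_of_pos_of_lt_pi hθ0
    rw [div_lt_iff₀ (by linarith)]
    nlinarith [Real.pi_pos]
  have hs : ∀ j : ℕ, j ≤ M s t → 0 ≤ Real.sin (j * (Real.pi / M s t)) := by
    intro j hj
    apply Real.sin_nonneg_of_nonneg_of_le_pi (by positivity)
    have hj' : (j : ℝ) ≤ M s t := by exact_mod_cast hj
    calc (j : ℝ) * (Real.pi / M s t) ≤ M s t * (Real.pi / M s t) := by gcongr
      _ = Real.pi := by field_simp
  have h1 := hs (k + 1) hk
  have h2 := hs k (by omega)
  have h3 := act_alternatingWord_unitRoot R h k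
  push_cast at h1
  have hns := norm_pos_iff.2 (R.root.ne_zero s)
  have hnt := norm_pos_iff.2 (R.root.ne_zero t)
  have key : ∀ x y : ℝ, 0 ≤ x → 0 ≤ y → Real.sin (Real.pi / M s t) •
      R.act (cs.wordProd (CoxeterSystem.alternatingWord s t k)) (unitRoot R s) =
        x • unitRoot R s + y • unitRoot R t → ∃ a b : ℝ, 0 ≤ a ∧ 0 ≤ b ∧
      R.act (cs.wordProd (CoxeterSystem.alternatingWord s t k)) (R.root s) =
        a • R.root s + b • R.root t := by
    intro x y hx hy hxy
    refine ⟨(Real.sin (Real.pi / M s t))⁻¹ * x,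
      (Real.sin (Real.pi / M s t))⁻¹ * y * (‖R.root s‖ * ‖R.root t‖⁻¹), by positivity,
      by positivity, ?_⟩
    have hxy' := congrArg (fun v => ((Real.sin (Real.pi / M s t))⁻¹ * ‖R.root s‖) • v) hxy
    simp only [smul_smul] at hxy'
    conv_lhs => rw [root_eq_smul_unitRoot R s]
    rw [map_smul]
    calc _ = ((Real.sin (Real.pi / M s t))⁻¹ * ‖R.root s‖ * Real.sin (Real.pi / M s t)) •
          R.act (cs.wordProd (CoxeterSystem.alternatingWord s t k)) (unitRoot R s) := by
            congr 1; field_simp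
      _ = _ := by
        rw [hxy', unitRoot, unitRoot, smul_add, smul_smul, smul_smul, smul_smul, smul_smul]
        congr 2
        · field_simp
        · field_simp
  split_ifs at h3
  · exact key _ _ h1 h2 h3
  · exact key _ _ h2 h1 h3

-- Reduction to rank two. Split off from `w` the longest alternating tail in `s` and `t`, where `t`
-- is a descent. The tail sends `α_s` to a nonnegative combination of `α_s` and `α_t`, and the rest
-- is shorter with neither letter as a descent, so induction applies to it.
open CoxeterSystem in
theorem isNonneg_act_root_aux (n : ℕ) : ∀ (w : W) (s : B), cs.length w = n →
    ¬ cs.IsRightDescent w s → IsNonneg R (R.act w (R.root s)) := by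
  induction n using Nat.strong_induction_on with
  | _ n ih =>
  intro w s hn hws
  by_cases hw : w = 1
  · subst hw
    rw [act_one_apply]
    exact isNonneg_root R s
  obtain ⟨t, ht⟩ := cs.exists_rightDescent_of_ne_one hw
  have hst : s ≠ t := by rintro rfl; exact hws ht
  let P : ℕ → Prop := fun k =>
    ∃ v, w = v * cs.wordProd (alternatingWord s t k) ∧ cs.length v + k = cs.length w
  have hP1 : P 1 := by
    refine ⟨w * cs.simple t, ?_, (cs.isRightDescent_iff).1 ht⟩
    simp [alternatingWord]
  have hPd : ∀ k, P (k + 1) → P k := by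
    rintro k ⟨v, hv, hl⟩
    rw [alternatingWord_succ', cs.wordProd_cons, ← mul_assoc] at hv
    refine ⟨_, hv, ?_⟩
    have h1 := cs.length_mul_simple v (if Even k then t else s)
    have h2 := cs.length_mul_le (v * cs.simple (if Even k then t else s))
      (cs.wordProd (alternatingWord s t k))
    have h3 := cs.length_wordProd_le (alternatingWord s t k)
    rw [length_alternatingWord] at h3
    rw [← hv] at h2
    omega
  have hPle : ∀ j k, j ≤ k → P k → P j := by
    intro j k hjk
    induction hjk with
    | refl => exact id
    | step _ ih => exact fun h => ih (hPd _ h)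
  classical
  have hM2 := two_le_coxeterMatrix R hst
  -- The tails end in `t`. By the braid relation, a tail of full length could be rewritten to end in
  -- `s`, making `s` a descent of `w`.
  have hPM : ¬ P (M s t) := by
    rintro ⟨v, hv, hl⟩
    rw [show alternatingWord s t (M s t) = braidWord M s t from rfl, wordProd_braidWord_eq,
      braidWord, M.symmetric t s] at hv
    obtain ⟨m, hm⟩ : ∃ m, M s t = m + 1 := ⟨M s t - 1, by omega⟩
    rw [hm, alternatingWord_succ, wordProd_concat, ← mul_assoc] at hv
    apply hws
    rw [IsRightDescent, hv, mul_assoc, cs.simple_mul_simple_self, mul_one, ← hv]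
    have h2 := cs.length_mul_le v (cs.wordProd (alternatingWord s t m))
    have h3 := cs.length_wordProd_le (alternatingWord s t m)
    rw [length_alternatingWord] at h3
    omega
  have hex : ∃ k, ¬ P k := ⟨_, hPM⟩
  have hfind := Nat.find_spec hex
  have hmin := fun {j} => Nat.find_min hex (m := j)
  have hfM : Nat.find hex ≤ M s t := Nat.find_min' hex hPM
  obtain ⟨k, hk⟩ : ∃ k, Nat.find hex = k + 1 := by
    refine ⟨Nat.find hex - 1, ?_⟩
    rcases Nat.eq_zero_or_pos (Nat.find hex) with h0 | h0
    · rw [h0] at hfind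
      exact absurd (hPle 0 1 (by omega) hP1) hfind
    · omega
  rw [hk] at hfind hfM
  have hPk : P k := not_not.1 (hmin (j := k) (by omega))
  have hk1 : k ≠ 0 := by rintro rfl; exact hfind hP1
  obtain ⟨v, hv, hl⟩ := hPk
  -- A descent of `v` at this letter would prolong the maximal tail. The other letter, treated next,
  -- is the first letter of the tail, so a descent there would contradict additivity of lengths.
  have hx : ¬ cs.IsRightDescent v (if Even k then t else s) := by
    intro hd
    refine hfind ⟨v * cs.simple (if Even k then t else s), ?_, ?_⟩
    · rw [alternatingWord_succ', cs.wordProd_cons, ← mul_assoc,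
        cs.simple_mul_simple_cancel_right, hv]
    · have := (cs.isRightDescent_iff).1 hd
      omega
  have hy : ¬ cs.IsRightDescent v (if Even k then s else t) := by
    intro hd
    obtain ⟨j, rfl⟩ : ∃ j, k = j + 1 := ⟨k - 1, by omega⟩
    have hj : (if Even (j + 1) then s else t) = if Even j then t else s := by
      by_cases hj : Even j <;> simp [hj, parity_simps]
    rw [hj] at hd
    rw [alternatingWord_succ', cs.wordProd_cons, ← mul_assoc] at hv
    have h1 := (cs.isRightDescent_iff).1 hd
    have h2 := cs.length_mul_le (v * cs.simple (if Even j then t else s))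
      (cs.wordProd (alternatingWord s t j))
    have h3 := cs.length_wordProd_le (alternatingWord s t j)
    rw [length_alternatingWord] at h3
    rw [← hv] at h2
    omega
  have hvs : ¬ cs.IsRightDescent v s ∧ ¬ cs.IsRightDescent v t := by
    split_ifs at hx hy
    · exact ⟨hy, hx⟩
    · exact ⟨hx, hy⟩
  obtain ⟨a, b, ha, hb, hab⟩ := exists_act_alternatingWord_root R hst (k := k) hfM
  rw [hv, act_mul_apply, hab, map_add, map_smul, map_smul]
  exact ((ih _ (by omega) v s rfl hvs.1).smul ha).add ((ih _ (by omega) v t rfl hvs.2).smul hb)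

theorem isNonneg_act_root {w : W} {s : B} (h : ¬ cs.IsRightDescent w s) :
    IsNonneg R (R.act w (R.root s)) :=
  isNonneg_act_root_aux R _ w s rfl h

theorem isNonneg_neg_act_root {w : W} {s : B} (h : cs.IsRightDescent w s) :
    IsNonneg R (-R.act w (R.root s)) := by
  have h' := isNonneg_act_root R ((cs.isRightDescent_iff_not_isRightDescent_mul).1 h)
  rwa [act_mul_apply, act_simple_root_self, map_neg] at h'

theorem act_root_ne_zero (w : W) (s : B) : R.act w (R.root s) ≠ 0 := by
  simpa using R.root.ne_zero s

theorem isNonneg_act_root_iff {w : W} {s : B} :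
    IsNonneg R (R.act w (R.root s)) ↔ ¬ cs.IsRightDescent w s :=
  ⟨fun h h' => act_root_ne_zero R w s (h.eq_zero (isNonneg_neg_act_root R h')),
    isNonneg_act_root R⟩

theorem isNonneg_neg_act_root_iff {w : W} {s : B} :
    IsNonneg R (-R.act w (R.root s)) ↔ cs.IsRightDescent w s :=
  ⟨fun h' => by_contra fun h => act_root_ne_zero R w s ((isNonneg_act_root R h).eq_zero h'),
    isNonneg_neg_act_root R⟩

/-! ### Rays spanned by roots -/

variable {R}

theorem IsRootRay.ne_zero {v : V} (h : IsRootRay R v) : v ≠ 0 := by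
  obtain ⟨w, s, a, ha, rfl⟩ := h
  exact smul_ne_zero ha.ne' (act_root_ne_zero R w s)

theorem IsRootRay.act {v : V} (h : IsRootRay R v) (w : W) : IsRootRay R (R.act w v) := by
  obtain ⟨w', s, a, ha, rfl⟩ := h
  exact ⟨w * w', s, a, ha, by rw [act_mul_apply, map_smul]⟩

theorem IsRootRay.neg {v : V} (h : IsRootRay R v) : IsRootRay R (-v) := by
  obtain ⟨w, s, a, ha, rfl⟩ := h
  exact ⟨w * cs.simple s, s, a, ha, by
    rw [act_mul_apply, act_simple_root_self, map_neg, smul_neg]⟩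

theorem IsRootRay.smul {v : V} (h : IsRootRay R v) {a : ℝ} (ha : 0 < a) :
    IsRootRay R (a • v) := by
  obtain ⟨w, s, b, hb, rfl⟩ := h
  exact ⟨w, s, a * b, mul_pos ha hb, by rw [smul_smul]⟩

variable (R) in
theorem isRootRay_act_root (w : W) (s : B) : IsRootRay R (R.act w (R.root s)) :=
  ⟨w, s, 1, one_pos, by rw [one_smul]⟩

variable (R) in
theorem isRootRay_root (s : B) : IsRootRay R (R.root s) := by
  simpa [act_one_apply] using isRootRay_act_root R 1 s

theorem IsRootRay.isNonneg_or {v : V} (h : IsRootRay R v) : IsNonneg R v ∨ IsNonneg R (-v) := by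
  obtain ⟨w, s, a, ha, rfl⟩ := h
  by_cases hd : cs.IsRightDescent w s
  · right
    rw [← smul_neg]
    exact (isNonneg_neg_act_root R hd).smul ha.le
  · exact .inl ((isNonneg_act_root R hd).smul ha.le)

theorem IsRootRay.not_isNonneg_neg {v : V} (h : IsRootRay R v) (h' : IsNonneg R v) :
    ¬ IsNonneg R (-v) := fun h'' => h.ne_zero (h'.eq_zero h'')

theorem IsRootRay.isNonneg_neg_iff {v : V} (h : IsRootRay R v) :
    IsNonneg R (-v) ↔ ¬ IsNonneg R v :=
  ⟨fun h' h'' => h.not_isNonneg_neg h'' h', h.isNonneg_or.resolve_left⟩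

theorem IsRootRay.isNonneg_iff {v : V} (h : IsRootRay R v) :
    IsNonneg R v ↔ ¬ IsNonneg R (-v) := by
  rw [h.isNonneg_neg_iff, not_not]

/-- A simple reflection preserves the positivity of a root that is not a multiple of the simple
root. -/
theorem IsRootRay.isNonneg_act_simple {v : V} (h : IsRootRay R v) (hv : IsNonneg R v) {s : B}
    (hs : ¬ ∃ a : ℝ, 0 < a ∧ v = a • R.root s) : IsNonneg R (R.act (cs.simple s) v) := by
  classical
  rw [(h.act _).isNonneg_iff]
  intro hn
  -- The reflection changes only the coordinate at `s`; a negative image forces all other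
  -- coordinates to vanish.
  have hz : ∀ t, t ≠ s → R.root.repr v t = 0 := by
    intro t ht
    have h1 := hn t
    have h2 := hv t
    rw [map_neg, Finsupp.neg_apply, repr_act_simple_of_ne R ht] at h1
    linarith
  have he : v = R.root.repr v s • R.root s := by
    apply R.root.repr.injective
    ext t
    rw [map_smul, R.root.repr_self, Finsupp.smul_single, Finsupp.single_apply]
    split_ifs with hst
    · simp [hst]
    · exact hz t (Ne.symm hst)
  refine hs ⟨_, lt_of_le_of_ne (hv s) fun h0 => h.ne_zero ?_, he⟩
  rw [he, ← h0, zero_smul]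

variable (R)

/-- A nontrivial element has a descent and so makes some simple root negative. Identities in `W` can
therefore be checked on vectors. -/
theorem act_injective {w w' : W} (h : ∀ v, R.act w v = R.act w' v) : w = w' := by
  have key : ∀ w : W, (∀ v, R.act w v = v) → w = 1 := by
    intro w hw
    by_contra hne
    obtain ⟨s, hs⟩ := cs.exists_rightDescent_of_ne_one hne
    have := isNonneg_neg_act_root R hs
    rw [hw] at this
    exact R.root.ne_zero s ((isNonneg_root R s).eq_zero this)
  have := key (w'⁻¹ * w) fun v => by rw [act_mul_apply, h, act_inv_apply_apply]
  rw [inv_mul_eq_one] at this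
  exact this.symm

theorem act_conj_simple (w : W) (s : B) (v : V) :
    R.act (w * cs.simple s * w⁻¹) v = v - (2 * ⟪R.act w (R.root s), v⟫ /
      ⟪R.root s, R.root s⟫) • R.act w (R.root s) := by
  rw [act_mul_apply, act_mul_apply, act_simple_apply, map_sub, act_apply_inv_apply, map_smul,
    inner_act_left]

theorem conj_simple_eq {w w' : W} {s t : B} {a : ℝ}
    (h : R.act w (R.root s) = a • R.act w' (R.root t)) :
    w * cs.simple s * w⁻¹ = w' * cs.simple t * w'⁻¹ := by
  have ha : a ≠ 0 := by
    rintro rfl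
    rw [zero_smul] at h
    exact act_root_ne_zero R w s h
  apply act_injective R
  intro v
  have hn : ⟪R.root s, R.root s⟫ = a ^ 2 * ⟪R.root t, R.root t⟫ := by
    rw [← (R.act w).inner_map_map, h, inner_smul_left, inner_smul_right,
      (R.act w').inner_map_map]
    simp only [RCLike.conj_to_real]
    ring
  rw [act_conj_simple, act_conj_simple, h, hn, inner_smul_left, smul_smul]
  have := (inner_root_self_pos R t).ne'
  simp only [RCLike.conj_to_real]
  congr 2
  field_simp

end RootSystem


/-! ### Reduced words, Bruhat order, fundamental weights -/

section Words

variable {B W V : Type*} [Group W] {M : CoxeterMatrix B} {cs : CoxeterSystem M W}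
  [NormedAddCommGroup V] [InnerProductSpace ℝ V] (R : SimpleRoots cs V)

/-! ### Reduced words -/

theorem isReduced_append_left {u v : List B} (h : cs.IsReduced (u ++ v)) : cs.IsReduced u := by
  simpa using h.take u.length

theorem isReduced_append_right {u v : List B} (h : cs.IsReduced (u ++ v)) : cs.IsReduced v := by
  simpa using h.drop u.length

theorem isReduced_concat_iff {u : List B} {s : B} (h : cs.IsReduced u) :
    cs.IsReduced (u ++ [s]) ↔ IsNonneg R (R.act (cs.wordProd u) (R.root s)) := by
  rw [isNonneg_act_root_iff, cs.not_isRightDescent_iff, CoxeterSystem.IsReduced,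
    cs.wordProd_append, cs.wordProd_singleton, h.eq]
  simp

theorem isNonneg_of_isReduced_concat {u : List B} {s : B} (h : cs.IsReduced (u ++ [s])) :
    IsNonneg R (R.act (cs.wordProd u) (R.root s)) :=
  (isReduced_concat_iff R (isReduced_append_left h)).1 h

theorem isNonneg_of_isReduced_cons {u : List B} {s : B} (h : cs.IsReduced (s :: u)) :
    IsNonneg R (R.act (cs.wordProd u)⁻¹ (R.root s)) := by
  rw [← cs.wordProd_reverse]
  apply isNonneg_of_isReduced_concat
  rw [← List.reverse_cons]
  exact h.reverse

/-- Once a positive root has become negative along a reduced word, it stays negative. -/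
theorem isNonneg_neg_act_wordProd_inv {v : V} (hv : IsRootRay R v) (hp : IsNonneg R v)
    {u₁ u₂ : List B} (hr : cs.IsReduced (u₁ ++ u₂))
    (hn : IsNonneg R (-R.act (cs.wordProd u₁)⁻¹ v)) :
    IsNonneg R (-R.act (cs.wordProd (u₁ ++ u₂))⁻¹ v) := by
  induction u₂ generalizing u₁ with
  | nil => simpa using hn
  | cons s u₂ ih =>
    rw [List.append_cons] at hr ⊢
    refine ih hr ?_
    have h1 : R.act (cs.wordProd (u₁ ++ [s]))⁻¹ v =
        R.act (cs.simple s) (R.act (cs.wordProd u₁)⁻¹ v) := by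
      rw [← act_mul_apply, cs.wordProd_append, cs.wordProd_singleton, mul_inv_rev, cs.inv_simple]
    rw [h1, ← map_neg]
    refine (hv.act _).neg.isNonneg_act_simple hn ?_
    rintro ⟨a, ha, h⟩
    have h2 : -v = a • R.act (cs.wordProd u₁) (R.root s) := by
      rw [← map_smul, ← h, map_neg, act_apply_inv_apply]
    refine hv.not_isNonneg_neg hp ?_
    rw [h2]
    exact (isNonneg_of_isReduced_concat R (isReduced_append_left hr)).smul ha.le

/-- Inversion sets grow in weak order, because a reduced word of `x` extends to one of `y`. -/
theorem WeakLE.isNonneg_neg {x y : W} (h : WeakLE cs x y) {v : V} (hv : IsRootRay R v)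
    (hp : IsNonneg R v) (hn : IsNonneg R (-R.act x⁻¹ v)) : IsNonneg R (-R.act y⁻¹ v) := by
  obtain ⟨z, rfl, hl⟩ := h
  obtain ⟨u₁, h1, rfl⟩ := cs.exists_isReduced x
  obtain ⟨u₂, h2, rfl⟩ := cs.exists_isReduced z
  rw [← cs.wordProd_append]
  refine isNonneg_neg_act_wordProd_inv R hv hp ?_ hn
  rw [CoxeterSystem.IsReduced, cs.wordProd_append, ← hl, h1.eq, h2.eq, List.length_append]

theorem act_wordProd_of_forall_inner_eq_zero {u : List B} {v : V}
    (h : ∀ t ∈ u, ⟪R.root t, v⟫ = 0) : R.act (cs.wordProd u) v = v := by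
  induction u with
  | nil => rw [cs.wordProd_nil, act_one_apply]
  | cons s u ih =>
    rw [cs.wordProd_cons, act_mul_apply, ih fun t ht => h t (List.mem_cons_of_mem _ ht),
      act_simple_of_inner_eq_zero R (h s List.mem_cons_self)]

theorem act_wordProd_inv_of_forall_inner_eq_zero {u : List B} {v : V}
    (h : ∀ t ∈ u, ⟪R.root t, v⟫ = 0) : R.act (cs.wordProd u)⁻¹ v = v := by
  conv_lhs => rw [← act_wordProd_of_forall_inner_eq_zero R h]
  rw [act_inv_apply_apply]

theorem simple_mul_simple_comm {s t : B} (h : ⟪R.root s, R.root t⟫ = 0) :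
    cs.simple s * cs.simple t = cs.simple t * cs.simple s := by
  apply act_injective R
  intro v
  simp only [act_mul_apply, act_simple_apply, inner_sub_right, inner_smul_right, h,
    real_inner_comm (R.root s) (R.root t), mul_zero, sub_zero]
  abel

theorem simple_mul_wordProd_comm {s : B} {u : List B} (h : ∀ t ∈ u, ⟪R.root s, R.root t⟫ = 0) :
    cs.simple s * cs.wordProd u = cs.wordProd u * cs.simple s := by
  induction u with
  | nil => simp
  | cons t u ih =>
    rw [cs.wordProd_cons, ← mul_assoc, simple_mul_simple_comm R (h t List.mem_cons_self),
      mul_assoc, ih fun t ht => h t (List.mem_cons_of_mem _ ht), mul_assoc]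

theorem ne_of_inner_root_eq_zero {s t : B} (h : ⟪R.root s, R.root t⟫ = 0) : s ≠ t := by
  rintro rfl
  exact (inner_root_self_pos R s).ne' h

/-- The coordinate at `s` is unchanged by a word without the letter `s`. -/
theorem repr_act_wordProd_of_notMem {s : B} {u : List B} (h : s ∉ u) (v : V) :
    R.root.repr (R.act (cs.wordProd u) v) s = R.root.repr v s := by
  induction u with
  | nil => rw [cs.wordProd_nil, act_one_apply]
  | cons t u ih =>
    rw [List.mem_cons, not_or] at h
    rw [cs.wordProd_cons, act_mul_apply, repr_act_simple_of_ne R h.1, ih h.2]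

theorem repr_act_wordProd_inv_of_notMem {s : B} {u : List B} (h : s ∉ u) (v : V) :
    R.root.repr (R.act (cs.wordProd u)⁻¹ v) s = R.root.repr v s := by
  rw [← cs.wordProd_reverse]
  exact repr_act_wordProd_of_notMem R (by simpa using h) v

/-! ### Bruhat order -/

/-- Multiplication by a reflection that increases the element in Bruhat order. -/
def BruhatStep (x y : W) : Prop :=
  ∃ w s, IsNonneg R (R.act w (R.root s)) ∧ IsNonneg R (R.act (x * w) (R.root s)) ∧
    y = x * (w * cs.simple s * w⁻¹)

/-- The Bruhat order. -/
def BruhatLE : W → W → Prop := Relation.ReflTransGen (BruhatStep R)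

variable {R}

theorem bruhatLE_mul_simple {x : W} {s : B} (h : IsNonneg R (R.act x (R.root s))) :
    BruhatLE R x (x * cs.simple s) :=
  Relation.ReflTransGen.single
    ⟨1, s, by rw [act_one_apply]; exact isNonneg_root R s, by simpa using h, by simp⟩

/-- Right multiplication by `s` conjugates the reflection. Its root stays positive unless it is a
multiple of `α_s`, in which case the step itself is multiplication by `s`. -/
theorem BruhatStep.mul_simple {x y : W} (h : BruhatStep R x y) (s : B) :
    y = x * cs.simple s ∨ BruhatStep R (x * cs.simple s) (y * cs.simple s) := by
  obtain ⟨w, t, h1, h2, rfl⟩ := h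
  by_cases he : ∃ a : ℝ, 0 < a ∧ R.act w (R.root t) = a • R.root s
  · left
    obtain ⟨a, -, ha⟩ := he
    have := conj_simple_eq R (w := w) (w' := 1) (s := t) (t := s) (a := a)
      (by rw [act_one_apply, ha])
    rw [this]
    simp
  · right
    refine ⟨cs.simple s * w, t, ?_, ?_, ?_⟩
    · rw [act_mul_apply]
      exact (isRootRay_act_root R w t).isNonneg_act_simple h1 he
    · rwa [← mul_assoc, cs.simple_mul_simple_cancel_right]
    · simp [mul_assoc]

/-- A lifting property without assumptions on descents: going down a chain from `y` to `x`, the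
current element and its product with `s` both stay below `z`. -/
theorem BruhatLE.mul_simple_le {x y z : W} (h : BruhatLE R x y) {s : B} (h1 : BruhatLE R y z)
    (h2 : BruhatLE R (y * cs.simple s) z) : BruhatLE R (x * cs.simple s) z := by
  induction h with
  | refl => exact h2
  | tail _ hs ih =>
    refine ih (.head hs h1) ?_
    rcases hs.mul_simple s with rfl | h3
    · exact h1
    · exact .head h3 h2

theorem BruhatLE.le_mul_simple {x y z : W} (h : BruhatLE R y x) {s : B} (h1 : BruhatLE R z y)
    (h2 : BruhatLE R z (y * cs.simple s)) : BruhatLE R z (x * cs.simple s) := by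
  induction h using Relation.ReflTransGen.head_induction_on with
  | refl => exact h2
  | head hs _ ih =>
    refine ih (.tail h1 hs) ?_
    rcases hs.mul_simple s with rfl | h3
    · rwa [cs.simple_mul_simple_cancel_right]
    · exact .tail h2 h3

/-! ### Dominant vectors -/

variable (R) in
/-- The vector lies in the closed fundamental chamber. -/
def IsDominant (v : V) : Prop := ∀ s, 0 ≤ ⟪R.root s, v⟫

theorem IsDominant.inner_nonneg [Fintype B] {v v' : V} (h : IsDominant R v)
    (h' : IsNonneg R v') : 0 ≤ ⟪v, v'⟫ := by
  rw [← R.root.sum_repr v', inner_sum]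
  refine Finset.sum_nonneg fun s _ => ?_
  rw [inner_smul_right, real_inner_comm]
  exact mul_nonneg (h' s) (h s)

/-- A Bruhat step at a positive root `β` subtracts from `x v'` a nonnegative multiple of the
positive root `x β`. All estimates of brick vectors come from this monotonicity. -/
theorem BruhatLE.inner_le [Fintype B] {x y : W} (h : BruhatLE R x y) {v v' : V}
    (hv : IsDominant R v) (hv' : IsDominant R v') : ⟪v, R.act y v'⟫ ≤ ⟪v, R.act x v'⟫ := by
  induction h with
  | refl => exact le_rfl
  | tail _ hs ih =>
    refine le_trans ?_ ih
    obtain ⟨w, t, h1, h2, rfl⟩ := hs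
    rw [act_mul_apply, act_conj_simple, map_sub, map_smul, inner_sub_right, inner_smul_right,
      ← act_mul_apply, sub_le_self_iff]
    refine mul_nonneg (div_nonneg (mul_nonneg two_pos.le ?_) (inner_root_self_pos R t).le)
      (hv.inner_nonneg h2)
    rw [real_inner_comm]
    exact hv'.inner_nonneg h1

variable (R)

theorem bruhatLE_one_left (x : W) : BruhatLE R 1 x := by
  obtain ⟨u, hu, rfl⟩ := cs.exists_isReduced x
  induction u using List.reverseRecOn with
  | nil => rw [cs.wordProd_nil]; exact .refl
  | append_singleton u s ih =>
    rw [cs.wordProd_append, cs.wordProd_singleton]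
    exact (ih (isReduced_append_left hu)).trans
      (bruhatLE_mul_simple (isNonneg_of_isReduced_concat R hu))

section Weights

variable [Fintype B]

theorem isDominant_weight (t : B) : IsDominant R (weight R t) := fun s => by
  classical
  rw [inner_root_weight]
  split_ifs
  · exact div_nonneg (inner_root_self_pos R s).le two_pos.le
  · exact le_rfl

theorem inner_root_weight_self_pos (s : B) : 0 < ⟪R.root s, weight R s⟫ := by
  classical
  rw [inner_root_weight, if_pos rfl]
  exact half_pos (inner_root_self_pos R s)

theorem inner_root_weight_of_ne {s t : B} (h : s ≠ t) : ⟪R.root s, weight R t⟫ = 0 := by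
  classical
  rw [inner_root_weight, if_neg h]

theorem act_wordProd_weight_of_notMem {u : List B} {s : B} (h : s ∉ u) :
    R.act (cs.wordProd u) (weight R s) = weight R s :=
  act_wordProd_of_forall_inner_eq_zero R fun _ ht =>
    inner_root_weight_of_ne R fun hts => h (hts ▸ ht)

theorem act_wordProd_inv_weight_of_notMem {u : List B} {s : B} (h : s ∉ u) :
    R.act (cs.wordProd u)⁻¹ (weight R s) = weight R s :=
  act_wordProd_inv_of_forall_inner_eq_zero R fun _ ht =>
    inner_root_weight_of_ne R fun hts => h (hts ▸ ht)

theorem act_simple_weight_of_ne {s t : B} (h : s ≠ t) :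
    R.act (cs.simple s) (weight R t) = weight R t :=
  act_simple_of_inner_eq_zero R (inner_root_weight_of_ne R h)

theorem act_simple_weight_self (s : B) :
    R.act (cs.simple s) (weight R s) = weight R s - R.root s := by
  classical
  rw [act_simple_apply, inner_root_weight, if_pos rfl, mul_div_cancel₀ _ two_ne_zero,
    div_self (inner_root_self_pos R s).ne', one_smul]

/-- Dominant vectors separate points. -/
theorem eq_of_forall_inner_isDominant {v v' : V}
    (h : ∀ d, IsDominant R d → ⟪v, d⟫ = ⟪v', d⟫) : v = v' := by
  rw [← sub_eq_zero]
  apply R.root.repr.injective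
  ext s
  have h1 : ⟪v - v', weight R s⟫ = 0 := by
    rw [inner_sub_left, h _ (isDominant_weight R s), sub_self]
  rw [← R.root.sum_repr (v - v'), sum_inner, Finset.sum_eq_single s] at h1
  · rw [inner_smul_left] at h1
    simpa [(inner_root_weight_self_pos R s).ne'] using h1
  · intro t _ ht
    rw [inner_smul_left, inner_root_weight_of_ne R ht, mul_zero]
  · exact fun hs => absurd (Finset.mem_univ s) hs

/-- The element represented by a reduced word moves the weights of its letters. -/
theorem act_wordProd_weight_ne_of_mem {u : List B} (hu : cs.IsReduced u) {s : B} (h : s ∈ u) :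
    R.act (cs.wordProd u) (weight R s) ≠ weight R s := by
  -- Each occurrence of `s` in a reduced word lowers the image of `ω_s` by a positive root, and
  -- positive roots cannot cancel.
  have key : ∀ u : List B, cs.IsReduced u →
      IsNonneg R (weight R s - R.act (cs.wordProd u) (weight R s)) ∧
      (s ∈ u → weight R s - R.act (cs.wordProd u) (weight R s) ≠ 0) := by
    intro u
    induction u using List.reverseRecOn with
    | nil =>
      intro _
      refine ⟨fun t => ?_, by simp⟩
      rw [cs.wordProd_nil, act_one_apply, sub_self]
      simp
    | append_singleton u t ih =>
      intro hu
      obtain ⟨h1, h2⟩ := ih (isReduced_append_left hu)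
      rw [cs.wordProd_append, cs.wordProd_singleton, act_mul_apply]
      by_cases hts : t = s
      · subst hts
        have h3 := isNonneg_of_isReduced_concat R hu
        rw [act_simple_weight_self, map_sub, ← sub_add]
        refine ⟨h1.add h3, fun _ h0 => act_root_ne_zero R (cs.wordProd u) t (h3.eq_zero ?_)⟩
        rw [← eq_neg_iff_add_eq_zero.2 h0]
        exact h1
      · rw [act_simple_weight_of_ne R hts]
        refine ⟨h1, fun hs => h2 ?_⟩
        simpa [Ne.symm hts] using hs
  intro h0
  exact (key u hu).2 h (by rw [h0, sub_self])

/-- A word without `s` fixes `ω_s`, while a reduced word containing `s` moves it. -/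
theorem mem_of_wordProd_eq (R : SimpleRoots cs V) {u u' : List B} (hu' : cs.IsReduced u')
    (h : cs.wordProd u = cs.wordProd u') {s : B} (hs : s ∈ u') : s ∈ u := by
  by_contra hn
  apply act_wordProd_weight_ne_of_mem R hu' hs
  rw [← h, act_wordProd_weight_of_notMem R hn]

end Weights

/-! ### The longest element -/

theorem isNonneg_neg_act_of_forall [Fintype B] {w : W}
    (h : ∀ s, IsNonneg R (-R.act w (R.root s))) {v : V} (hv : IsNonneg R v) :
    IsNonneg R (-R.act w v) := by
  intro t
  rw [← R.root.sum_repr v, map_sum, ← Finset.sum_neg_distrib, map_sum, Finsupp.finsetSum_apply]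
  refine Finset.sum_nonneg fun s _ => ?_
  rw [map_smul, ← smul_neg, map_smul, Finsupp.smul_apply]
  exact mul_nonneg (hv s) (h s t)

theorem isNonneg_neg_act_longestElement_root [Finite W] (s : B) :
    IsNonneg R (-R.act (longestElement cs) (R.root s)) := by
  rw [isNonneg_neg_act_root_iff, CoxeterSystem.IsRightDescent]
  exact lt_of_le_of_ne (length_le_length_longestElement cs _) (cs.length_mul_simple_ne _ _)

/-- Otherwise `w⁻¹ w₀` has a descent `s` and makes `α_s` negative; applying `w` makes it positive
again, whereas `w₀ α_s` is negative. -/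
theorem eq_longestElement [Fintype B] [Finite W] {w : W}
    (h : ∀ s, IsNonneg R (-R.act w (R.root s))) : w = longestElement cs := by
  have key : w⁻¹ * longestElement cs = 1 := by
    by_contra hne
    obtain ⟨s, hs⟩ := cs.exists_rightDescent_of_ne_one hne
    have h1 := isNonneg_neg_act_of_forall R h (isNonneg_neg_act_root R hs)
    rw [map_neg, neg_neg, act_mul_apply, act_apply_inv_apply] at h1
    exact (isRootRay_act_root R _ s).not_isNonneg_neg h1
      (isNonneg_neg_act_longestElement_root R s)
  exact inv_mul_eq_one.1 key

theorem isDominant_neg_act_longestElement [Fintype B] [Finite W] {v : V} (hv : IsDominant R v) :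
    IsDominant R (-R.act (longestElement cs) v) := by
  intro s
  have h : (longestElement cs)⁻¹ = longestElement cs := by
    apply eq_longestElement R
    intro s
    rw [isNonneg_neg_act_root_iff, CoxeterSystem.IsRightDescent]
    refine lt_of_le_of_ne ?_ (cs.length_mul_simple_ne _ _)
    rw [cs.length_inv]
    exact length_le_length_longestElement cs _
  rw [inner_neg_right, inner_act_right, h, ← inner_neg_left, real_inner_comm]
  exact hv.inner_nonneg (isNonneg_neg_act_longestElement_root R s)

end Words


/-! ### Reading words from a queue -/

/-- `Steps a q u b`: reading the letters `q` cyclically off the list `a` of active letters, where a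
letter that is taken moves to the end of the list and a letter that is skipped is deleted, takes the
word `u` and leaves the list `b` of active letters. -/
inductive Steps {B : Type*} : List B → List B → List B → List B → Prop
  | refl (a : List B) : Steps a [] [] a
  | take {s : B} {a q u b : List B} : Steps (a ++ [s]) q u b → Steps (s :: a) (s :: q) (s :: u) b
  | skip {s : B} {a q u b : List B} : Steps a q u b → Steps (s :: a) (s :: q) u b

namespace Steps

variable {B : Type*}

theorem trans {a q u b q' u' d : List B} (h : Steps a q u b) (h' : Steps b q' u' d) :
    Steps a (q ++ q') (u ++ u') d := by
  induction h with
  | refl => exact h'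
  | take _ ih => exact .take (ih h')
  | skip _ ih => exact .skip (ih h')

/-- Whatever was in the queue or was put back is either read or still there. With an empty final
queue, the letters read are the initial queue followed by the word taken; this produces `c w₀(c)`.
-/
theorem append_eq {a q u b : List B} (h : Steps a q u b) : q ++ b = a ++ u := by
  induction h with
  | refl => simp
  | take _ ih => simp [ih]
  | skip _ ih => simp [ih]

theorem subset {a q u b : List B} (h : Steps a q u b) : b ⊆ a := by
  induction h with
  | refl => simp
  | take _ ih => exact fun x hx => by simpa [or_comm] using ih hx
  | skip _ ih => exact fun x hx => List.mem_cons_of_mem _ (ih hx)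

theorem word_subset {a q u b : List B} (h : Steps a q u b) : u ⊆ a := by
  induction h with
  | refl => simp
  | take _ ih =>
    intro x hx
    rcases List.mem_cons.1 hx with rfl | hx
    · simp
    · simpa [or_comm] using ih hx
  | skip _ ih => exact fun x hx => List.mem_cons_of_mem _ (ih hx)

theorem nodup {a q u b : List B} (h : Steps a q u b) (ha : a.Nodup) : b.Nodup := by
  induction h with
  | refl => exact ha
  | take _ ih => exact ih ((List.perm_append_singleton _ _).nodup_iff.2 ha)
  | skip _ ih => exact ih (List.nodup_cons.1 ha).2

theorem skip_append (a b : List B) : Steps (a ++ b) a [] b := by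
  induction a with
  | nil => exact .refl b
  | cons s a ih => exact .skip ih

theorem exists_of_append {a q u₁ u₂ b : List B} (h : Steps a q (u₁ ++ u₂) b) :
    ∃ q₁ q₂ d, Steps a q₁ u₁ d ∧ Steps d q₂ u₂ b := by
  generalize hu : u₁ ++ u₂ = u at h
  induction h generalizing u₁ with
  | refl a =>
    obtain ⟨rfl, rfl⟩ := List.append_eq_nil_iff.1 hu
    exact ⟨[], [], a, .refl _, .refl _⟩
  | take h ih =>
    cases u₁ with
    | nil => rw [List.nil_append] at hu; subst hu; exact ⟨_, _, _, .refl _, .take h⟩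
    | cons x u₁ =>
      rw [List.cons_append, List.cons.injEq] at hu
      obtain ⟨rfl, hu⟩ := hu
      obtain ⟨q₁, q₂, d, h1, h2⟩ := ih hu
      exact ⟨_, _, _, .take h1, h2⟩
  | skip h ih =>
    obtain ⟨q₁, q₂, d, h1, h2⟩ := ih hu
    exact ⟨_, _, _, .skip h1, h2⟩

theorem exists_of_append_cons {a q u₁ u₂ b : List B} {s : B} (h : Steps a q (u₁ ++ s :: u₂) b) :
    ∃ q₁ q₂ d, Steps a q₁ u₁ (s :: d) ∧ Steps (d ++ [s]) q₂ u₂ b := by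
  have key : ∀ {a q u b : List B}, Steps a q u b → ∀ {s u₂}, u = s :: u₂ →
      ∃ q₁ q₂ d, Steps a q₁ [] (s :: d) ∧ Steps (d ++ [s]) q₂ u₂ b := by
    intro a q u b h
    induction h with
    | refl => intro s u₂ h; simp at h
    | take h _ =>
      intro s u₂ he
      obtain ⟨rfl, rfl⟩ := List.cons.inj he
      exact ⟨_, _, _, .refl _, h⟩
    | skip h ih =>
      intro s u₂ he
      obtain ⟨q₁, q₂, d, h1, h2⟩ := ih he
      exact ⟨_, _, _, .skip h1, h2⟩
  obtain ⟨q₁, q₂, d, h1, h2⟩ := h.exists_of_append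
  obtain ⟨q₃, q₄, e, h3, h4⟩ := key h2 rfl
  exact ⟨_, _, _, by simpa using h1.trans h3, h4⟩

end Steps

/-! ### The skew form of a Coxeter element and the greedy word -/

section Form

variable {B W V : Type*} [Group W] {M : CoxeterMatrix B} {cs : CoxeterSystem M W}
  [NormedAddCommGroup V] [InnerProductSpace ℝ V] (R : SimpleRoots cs V)

/-- The vector is a linear combination of the simple roots in the list. -/
def IsSupportedOn (a : List B) (v : V) : Prop := ∀ s, s ∉ a → R.root.repr v s = 0

/-- The inner product with the simple root `s` of the components of `v` on the letters of `a`. -/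
noncomputable def componentInner (s : B) (a : List B) (v : V) : ℝ :=
  (a.map fun j => R.root.repr v j * ⟪R.root s, R.root j⟫).sum

/-- The skew-symmetric form of a Coxeter element, given by a list of simple generators. -/
noncomputable def skewForm : List B → V → V → ℝ
  | [], _, _ => 0
  | s :: a, v, v' => R.root.repr v' s * componentInner R s a v -
      R.root.repr v s * componentInner R s a v' + skewForm a v v'

variable {R}

theorem componentInner_congr {s : B} {a : List B} {v v' : V}
    (h : ∀ j ∈ a, R.root.repr v j = R.root.repr v' j) :
    componentInner R s a v = componentInner R s a v' := by
  unfold componentInner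
  congr 1
  exact List.map_congr_left fun j hj => by rw [h j hj]

theorem componentInner_eq_zero {s : B} {a : List B} {v : V}
    (h : ∀ j ∈ a, R.root.repr v j = 0) : componentInner R s a v = 0 := by
  rw [componentInner_congr (v' := 0) (by simpa using h)]
  simp [componentInner]

theorem componentInner_eq_inner {a : List B} (ha : a.Nodup) {v : V} (hv : IsSupportedOn R a v)
    (s : B) : componentInner R s a v = ⟪R.root s, v⟫ := by
  classical
  conv_rhs => rw [← R.root.linearCombination_repr v, Finsupp.linearCombination_apply,
    Finsupp.sum_of_support_subset _ (s := a.toFinset) (fun t ht => by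
      by_contra hn
      exact (Finsupp.mem_support_iff.1 ht) (hv t (by simpa using hn))) _ (by simp), inner_sum]
  rw [List.sum_toFinset _ ha, componentInner]
  simp only [inner_smul_right]

theorem componentInner_nonpos {a : List B} {s : B} (hs : s ∉ a) {v : V} (hv : IsNonneg R v) :
    componentInner R s a v ≤ 0 := by
  unfold componentInner
  induction a with
  | nil => simp
  | cons j a ih =>
    rw [List.mem_cons, not_or] at hs
    rw [List.map_cons, List.sum_cons]
    exact add_nonpos (mul_nonpos_of_nonneg_of_nonpos (hv j) (inner_root_nonpos R hs.1)) (ih hs.2)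

theorem skewForm_congr {a : List B} {v₁ v₂ v₁' v₂' : V}
    (h : ∀ j ∈ a, R.root.repr v₁ j = R.root.repr v₁' j)
    (h' : ∀ j ∈ a, R.root.repr v₂ j = R.root.repr v₂' j) :
    skewForm R a v₁ v₂ = skewForm R a v₁' v₂' := by
  induction a with
  | nil => rfl
  | cons s a ih =>
    rw [List.forall_mem_cons] at h h'
    rw [skewForm, skewForm, h.1, h'.1, componentInner_congr h.2, componentInner_congr h'.2,
      ih h.2 h'.2]

theorem skewForm_eq_zero {a : List B} {v v' : V} (h : ∀ j ∈ a, R.root.repr v j = 0) :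
    skewForm R a v v' = 0 := by
  induction a with
  | nil => rfl
  | cons s a ih =>
    rw [List.forall_mem_cons] at h
    rw [skewForm, h.1, componentInner_eq_zero h.2, ih h.2]
    ring

theorem skewForm_swap (a : List B) (v v' : V) : skewForm R a v v' = -skewForm R a v' v := by
  induction a with
  | nil => simp [skewForm]
  | cons s a ih => rw [skewForm, skewForm, ih]; ring

theorem skewForm_concat (a : List B) (s : B) (v v' : V) :
    skewForm R (a ++ [s]) v v' = R.root.repr v s * componentInner R s a v' -
      R.root.repr v' s * componentInner R s a v + skewForm R a v v' := by
  induction a with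
  | nil => simp [skewForm, componentInner]
  | cons j a ih =>
    rw [List.cons_append, skewForm, ih, skewForm]
    simp only [componentInner, List.map_append, List.map_cons, List.map_nil, List.sum_append,
      List.sum_cons, List.sum_nil, real_inner_comm (R.root s) (R.root j)]
    ring

/-- Only the coordinate at `s` changes under the reflection. Its new correction term is proportional
to `componentInner` and cancels by antisymmetry, leaving the sign change that moves `s` from the
front to the end. -/
theorem skewForm_act_simple {s : B} {a : List B} (ha : (s :: a).Nodup) {v v' : V}
    (hv : IsSupportedOn R (s :: a) v) (hv' : IsSupportedOn R (s :: a) v') :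
    skewForm R (s :: a) (R.act (cs.simple s) v) (R.act (cs.simple s) v') =
      skewForm R (a ++ [s]) v v' := by
  have hsa := (List.nodup_cons.1 ha).1
  have hne : ∀ (v : V), ∀ j ∈ a, R.root.repr (R.act (cs.simple s) v) j = R.root.repr v j :=
    fun v j hj => repr_act_simple_of_ne R (by rintro rfl; exact hsa hj) v
  have hs : ∀ v : V, IsSupportedOn R (s :: a) v → R.root.repr (R.act (cs.simple s) v) s =
      -R.root.repr v s - 2 * componentInner R s a v / ⟪R.root s, R.root s⟫ := by
    intro v hv
    have h0 := (inner_root_self_pos R s).ne'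
    rw [act_simple_apply, ← componentInner_eq_inner ha hv, map_sub, map_smul, R.root.repr_self]
    simp only [componentInner, List.map_cons, List.sum_cons, Finsupp.coe_sub, Pi.sub_apply,
      Finsupp.coe_smul, Pi.smul_apply, Finsupp.single_eq_same, smul_eq_mul, mul_one]
    field_simp
    ring
  rw [skewForm_concat, skewForm, hs v hv, hs v' hv', componentInner_congr (hne v),
    componentInner_congr (hne v'), skewForm_congr (hne v) (hne v')]
  ring

theorem IsSupportedOn.of_subset {a b : List B} (h : b ⊆ a) {v : V} (hv : IsSupportedOn R b v) :
    IsSupportedOn R a v := fun s hs => hv s fun hb => hs (h hb)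

variable (R) in
theorem isSupportedOn_root {a : List B} {s : B} (h : s ∈ a) : IsSupportedOn R a (R.root s) :=
  fun t ht => by
    rw [R.root.repr_self, Finsupp.single_eq_of_ne]
    rintro rfl
    exact ht h

theorem IsSupportedOn.act_wordProd {a u : List B} (hu : u ⊆ a) {v : V}
    (hv : IsSupportedOn R a v) : IsSupportedOn R a (R.act (cs.wordProd u) v) := fun s hs => by
  rw [repr_act_wordProd_of_notMem R fun h => hs (hu h), hv s hs]

/-- Taking a letter is `skewForm_act_simple`. Skipping a letter is harmless because the vectors then
have no component on it. -/
theorem Steps.skewForm_act {a q u b : List B} (h : Steps a q u b) (ha : a.Nodup) {v v' : V}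
    (hv : IsSupportedOn R b v) (hv' : IsSupportedOn R b v') :
    skewForm R a (R.act (cs.wordProd u) v) (R.act (cs.wordProd u) v') = skewForm R b v v' := by
  induction h with
  | refl => simp only [cs.wordProd_nil, act_one_apply]
  | @take s a q u b h ih =>
    have hsub : b ⊆ s :: a := fun x hx => by simpa [or_comm] using h.subset hx
    have hu : u ⊆ s :: a := fun x hx => by simpa [or_comm] using h.word_subset hx
    rw [cs.wordProd_cons, act_mul_apply, act_mul_apply, skewForm_act_simple ha
      ((hv.of_subset hsub).act_wordProd hu) ((hv'.of_subset hsub).act_wordProd hu)]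
    exact ih ((List.perm_append_singleton _ _).nodup_iff.2 ha) hv hv'
  | @skip s a q u b h ih =>
    have hs := (List.nodup_cons.1 ha).1
    have h1 := ((hv.of_subset h.subset).act_wordProd h.word_subset) s hs
    have h2 := ((hv'.of_subset h.subset).act_wordProd h.word_subset) s hs
    rw [skewForm, h1, h2, ih (List.nodup_cons.1 ha).2 hv hv']
    ring

theorem skewForm_cons_root {s : B} {a : List B} (ha : (s :: a).Nodup) {v : V}
    (hv : IsSupportedOn R a v) : skewForm R (s :: a) (R.root s) v = -⟪R.root s, v⟫ := by
  obtain ⟨hs, ha⟩ := List.nodup_cons.1 ha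
  have h0 : ∀ j ∈ a, R.root.repr (R.root s) j = 0 := fun j hj => by
    rw [R.root.repr_self, Finsupp.single_eq_of_ne]
    rintro rfl
    exact hs hj
  rw [skewForm, skewForm_eq_zero h0, componentInner_eq_zero h0, R.root.repr_self,
    componentInner_eq_inner ha hv]
  simp

theorem skewForm_concat_root {s : B} {a : List B} (hs : s ∉ a) (v : V) :
    skewForm R (a ++ [s]) (R.root s) v = componentInner R s a v := by
  have h0 : ∀ j ∈ a, R.root.repr (R.root s) j = 0 := fun j hj => by
    rw [R.root.repr_self, Finsupp.single_eq_of_ne]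
    rintro rfl
    exact hs hj
  rw [skewForm_concat, skewForm_eq_zero h0, componentInner_eq_zero h0, R.root.repr_self]
  simp

theorem skewForm_smul_left (a : List B) (x : ℝ) (v v' : V) :
    skewForm R a (x • v) v' = x * skewForm R a v v' := by
  have h : ∀ s (a : List B), componentInner R s a (x • v) = x * componentInner R s a v := by
    intro s a
    simp only [componentInner, map_smul, Finsupp.smul_apply, smul_eq_mul, mul_assoc,
      List.sum_map_mul_left]
  induction a with
  | nil => simp [skewForm]
  | cons s a ih =>
    rw [skewForm, skewForm, ih, h, map_smul, Finsupp.smul_apply, smul_eq_mul]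
    ring

/-! ### Letters that are skipped although the root is negative -/

/-- The exchange condition for roots: a simple reflection turns a positive root negative only if
that root is a multiple of its own simple root. -/
theorem exists_sign_change {v : V} (hv : IsRootRay R v) (hp : IsNonneg R v) {u : List B}
    (hn : IsNonneg R (-R.act (cs.wordProd u) v)) :
    ∃ u₁ r u₂, ∃ x : ℝ, 0 < x ∧ u = u₁ ++ r :: u₂ ∧ R.act (cs.wordProd u₂) v = x • R.root r := by
  induction u with
  | nil =>
    rw [cs.wordProd_nil, act_one_apply] at hn
    exact absurd hn (hv.not_isNonneg_neg hp)
  | cons r u ih =>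
    rcases (hv.act (cs.wordProd u)).isNonneg_or with h | h
    · by_cases he : ∃ x : ℝ, 0 < x ∧ R.act (cs.wordProd u) v = x • R.root r
      · obtain ⟨x, hx, he⟩ := he
        exact ⟨[], r, u, x, hx, rfl, he⟩
      · have h1 := (hv.act _).isNonneg_act_simple h he
        rw [← act_mul_apply, ← cs.wordProd_cons] at h1
        exact absurd hn ((hv.act _).not_isNonneg_neg h1)
    · obtain ⟨u₁, r', u₂, x, hx, rfl, he⟩ := ih h
      exact ⟨r :: u₁, r', u₂, x, hx, rfl, he⟩

/-- If a letter is skipped although it is a descent, then it commutes with all letters that are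
taken afterwards. -/
theorem inner_eq_zero_of_skip_descent {a q u : List B} {s : B} {b q' z b' : List B}
    (ha : a.Nodup) (h : Steps a q u (s :: b)) (h' : Steps b q' z b')
    (hr : cs.IsReduced (u ++ z)) (hn : IsNonneg R (-R.act (cs.wordProd u) (R.root s))) :
    ∀ t ∈ z, ⟪R.root s, R.root t⟫ = 0 := by
  induction z using List.reverseRecOn generalizing q' b' with
  | nil => simp
  | append_singleton z t ih =>
    obtain ⟨q₁, -, d, hz, -⟩ := h'.exists_of_append
    rw [← List.append_assoc] at hr
    have hz0 := ih hz (isReduced_append_left hr)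
    have hsb := h.nodup ha
    obtain ⟨hs, hb⟩ := List.nodup_cons.1 hsb
    have htb : t ∈ b := h'.word_subset (by simp)
    have hst : s ≠ t := fun h => hs (h ▸ htb)
    have ht : ⟪R.root s, R.root t⟫ = 0 := by
      by_contra hne
      have hlt := lt_of_le_of_ne (inner_root_nonpos R hst) hne
      -- Since `α_s` has become negative along `u`, an earlier taken letter `r` satisfies `u₂ α_s =
      -- x α_r`. The form of the queue just after `r` is now evaluated at `u₂ α_s` and `β = u₂ z
      -- α_t` in two ways.
      obtain ⟨u₁, r, u₂, x, hx, rfl, he⟩ := exists_sign_change (isRootRay_root R s)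
        (isNonneg_root R s) hn
      obtain ⟨q₃, q₄, e, h1, h2⟩ := h.exists_of_append_cons
      have hre := h1.nodup ha
      have her := (List.perm_append_singleton r e).nodup_iff.2 hre
      have hr' := (List.nodup_cons.1 hre).1
      have hsupp := (isSupportedOn_root R htb).act_wordProd (R := R) (u := z)
        fun y hy => h'.word_subset (by simp [hy])
      -- By invariance the value is that of the queue `s :: b` at `α_s` and `z α_t`. As `z` fixes
      -- `α_s`, this is `-⟨α_s, α_t⟩`, which is positive.
      have e1 := h2.skewForm_act (R := R) her
        (isSupportedOn_root R (List.mem_cons_self (a := s) (l := b)))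
        (hsupp.of_subset (List.subset_cons_self s b))
      rw [he, skewForm_smul_left, skewForm_concat_root hr', skewForm_cons_root hsb hsupp,
        inner_act_right, act_wordProd_inv_of_forall_inner_eq_zero R
          (fun y hy => by rw [real_inner_comm]; exact hz0 y hy)] at e1
      have e2 : 0 < componentInner R r e
          (R.act (cs.wordProd u₂) (R.act (cs.wordProd z) (R.root t))) := by
        by_contra hc
        have := mul_nonpos_of_nonneg_of_nonpos hx.le (not_lt.1 hc)
        linarith
      have hroot : IsRootRay R (R.act (cs.wordProd u₂) (R.act (cs.wordProd z) (R.root t))) :=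
        ((isRootRay_root R t).act _).act _
      have hpos : IsNonneg R (R.act (cs.simple r)
          (R.act (cs.wordProd u₂) (R.act (cs.wordProd z) (R.root t)))) := by
        have h3 : cs.IsReduced ((r :: (u₂ ++ z)) ++ [t]) := by
          apply isReduced_append_right (u := u₁)
          simpa using hr
        have h4 := isNonneg_of_isReduced_concat R h3
        rwa [cs.wordProd_cons, cs.wordProd_append, act_mul_apply, act_mul_apply] at h4
      -- Both signs of `β` are impossible. A positive `β` has nonpositive `componentInner`. As `r β`
      -- is positive, a negative `β` is a multiple of `α_r` and has no component on `e`.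
      rcases hroot.isNonneg_or with h3 | h3
      · exact absurd (componentInner_nonpos hr' h3) (not_le.2 e2)
      · by_cases hx : ∃ x : ℝ, 0 < x ∧
          -R.act (cs.wordProd u₂) (R.act (cs.wordProd z) (R.root t)) = x • R.root r
        · obtain ⟨x, -, hx⟩ := hx
          refine e2.ne' (componentInner_eq_zero fun j hj => ?_)
          rw [neg_eq_iff_eq_neg.1 hx, map_neg, map_smul, R.root.repr_self, Finsupp.neg_apply,
            Finsupp.smul_apply, Finsupp.single_eq_of_ne]
          · simp
          · rintro rfl
            exact hr' hj
        · have h4 := hroot.neg.isNonneg_act_simple h3 hx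
          rw [map_neg] at h4
          exact (hroot.act _).not_isNonneg_neg hpos h4
    intro y hy
    rcases List.mem_append.1 hy with hy | hy
    · exact hz0 y hy
    · rw [List.mem_singleton.1 hy, ht]

/-! ### The greedy word -/

variable (R) in
/-- The word `w` is obtained, starting from the element `x` and the list `a` of active letters, by
taking each letter that increases the length. -/
inductive Greedy : W → List B → List B → List B → Prop
  | nil (x : W) : Greedy x [] [] []
  | take {x : W} {s : B} {a q w : List B} : IsNonneg R (R.act x (R.root s)) →
      Greedy (x * cs.simple s) (a ++ [s]) q w → Greedy x (s :: a) (s :: q) (s :: w)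
  | skip {x : W} {s : B} {a q w : List B} : IsNonneg R (-R.act x (R.root s)) →
      Greedy x a q w → Greedy x (s :: a) (s :: q) w

theorem Greedy.steps {x : W} {a q w : List B} (h : Greedy R x a q w) : Steps a q w [] := by
  induction h with
  | nil => exact .refl []
  | take _ _ ih => exact .take ih
  | skip _ _ ih => exact .skip ih

theorem Greedy.isReduced {x : W} {a q w : List B} (h : Greedy R x a q w) {u : List B}
    (hu : cs.IsReduced u) (hx : cs.wordProd u = x) : cs.IsReduced (u ++ w) := by
  induction h generalizing u with
  | nil => simpa using hu
  | take h1 _ ih =>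
    rw [List.append_cons]
    subst hx
    exact ih ((isReduced_concat_iff R hu).2 h1)
      (by rw [cs.wordProd_append, cs.wordProd_singleton])
  | skip _ _ ih => exact ih hu hx

-- The process terminates because taking a letter increases the length, bounded by that of the
-- longest element, and skipping shortens the queue.
variable (R) in
theorem exists_greedy [Finite W] (x : W) (a : List B) : ∃ q w, Greedy R x a q w := by
  have key : ∀ n : ℕ, ∀ (x : W) (a : List B), cs.length (longestElement cs) - cs.length x = n →
      ∃ q w, Greedy R x a q w := by
    intro n
    induction n using Nat.strong_induction_on with
    | _ n ih =>
    intro x a hx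
    induction a with
    | nil => exact ⟨_, _, .nil x⟩
    | cons s a iha =>
      by_cases hd : cs.IsRightDescent x s
      · obtain ⟨q, w, h⟩ := iha
        exact ⟨_, _, .skip (isNonneg_neg_act_root R hd) h⟩
      · have h1 := (cs.not_isRightDescent_iff).1 hd
        have h2 := length_le_length_longestElement cs (x * cs.simple s)
        obtain ⟨q, w, h⟩ := ih _ (by omega) (x * cs.simple s) (a ++ [s]) rfl
        exact ⟨_, _, .take (isNonneg_act_root R hd) h⟩
  exact key _ x a rfl

theorem Greedy.inner_eq_zero_of_skip {c q₀ u b q w : List B} {s : B} (hc : c.Nodup)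
    (h₀ : Steps c q₀ u (s :: b)) (hu : cs.IsReduced u)
    (hn : IsNonneg R (-R.act (cs.wordProd u) (R.root s))) (h : Greedy R (cs.wordProd u) b q w) :
    ∀ t ∈ w, ⟪R.root s, R.root t⟫ = 0 :=
  inner_eq_zero_of_skip_descent hc h₀ h.steps (h.isReduced hu rfl) hn

/-- The letters skipped so far are descents. -/
theorem Greedy.exists_steps_of_append {c q₀ u b q w₁ w₂ : List B} (hc : c.Nodup)
    (h₀ : Steps c q₀ u b) (hu : cs.IsReduced u)
    (h : Greedy R (cs.wordProd u) b q (w₁ ++ w₂)) :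
    ∃ q₁ d, Steps b q₁ w₁ d ∧ ∀ s ∈ b, s ∉ d →
      IsNonneg R (-R.act (cs.wordProd (u ++ w₁)) (R.root s)) := by
  generalize hx : cs.wordProd u = x at h
  generalize hw : w₁ ++ w₂ = w at h
  induction h generalizing u q₀ w₁ with
  | nil x =>
    obtain ⟨rfl, rfl⟩ := List.append_eq_nil_iff.1 hw
    exact ⟨[], [], .refl _, by simp⟩
  | @take x s a q w h1 h ih =>
    cases w₁ with
    | nil => exact ⟨[], _, .refl _, fun s hs hs' => absurd hs hs'⟩
    | cons y w₁ =>
      rw [List.cons_append, List.cons.injEq] at hw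
      obtain ⟨rfl, hw⟩ := hw
      subst hx
      obtain ⟨q₁, d, h2, h3⟩ := ih (h₀.trans (.take (.refl _)))
        ((isReduced_concat_iff R hu).2 h1) (by rw [cs.wordProd_append, cs.wordProd_singleton]) hw
      refine ⟨_, d, .take h2, fun s hs hd => ?_⟩
      rw [List.append_cons]
      exact h3 s (by simpa [or_comm] using hs) hd
  | @skip x s a q w h1 h ih =>
    have h₁ := h₀.trans (.skip (.refl _))
    rw [List.append_nil] at h₁
    obtain ⟨q₁, d, h2, h3⟩ := ih h₁ hu hx hw
    subst hx
    refine ⟨_, d, .skip h2, fun t ht hd => ?_⟩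
    rcases List.mem_cons.1 ht with rfl | ht
    -- The skipped letter is a descent at this moment and remains one, since the letters taken later
    -- fix its root.
    · have h4 := h.inner_eq_zero_of_skip hc h₀ hu h1
      rw [cs.wordProd_append, act_mul_apply, act_wordProd_of_forall_inner_eq_zero R (u := w₁) fun y hy => by
        rw [real_inner_comm]; exact h4 y (hw ▸ List.mem_append_left _ hy)]
      exact h1
    · exact h3 t ht hd

/-- If all letters are active in the beginning, then the greedy word represents the longest
element. -/
theorem Greedy.wordProd_eq [Fintype B] [Finite W] {c q w : List B} (hc : c.Nodup)
    (hc' : ∀ s, s ∈ c) (h : Greedy R 1 c q w) : cs.wordProd w = longestElement cs := by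
  apply eq_longestElement R
  rw [← cs.wordProd_nil] at h
  intro s
  -- The queue ends empty, so every active letter is eventually skipped and is a descent from then
  -- on.
  have key : ∀ {x a q w}, Greedy R x a q w → ∀ {q₀ u}, cs.wordProd u = x → Steps c q₀ u a →
      cs.IsReduced u → ∀ s ∈ a, IsNonneg R (-R.act (cs.wordProd (u ++ w)) (R.root s)) := by
    intro x a q w h
    induction h with
    | nil => intro q₀ u _ _ _ s hs; simp at hs
    | @take x s a q w h1 h ih =>
      rintro q₀ u rfl h₀ hu t ht
      rw [List.append_cons]
      exact ih (by rw [cs.wordProd_append, cs.wordProd_singleton]) (h₀.trans (.take (.refl _)))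
        ((isReduced_concat_iff R hu).2 h1) t (by simpa [or_comm] using ht)
    | @skip x s a q w h1 h ih =>
      rintro q₀ u rfl h₀ hu t ht
      rcases List.mem_cons.1 ht with rfl | ht
      · have h4 := h.inner_eq_zero_of_skip hc h₀ hu h1
        rw [cs.wordProd_append, act_mul_apply,
          act_wordProd_of_forall_inner_eq_zero R (u := w) fun y hy => by
            rw [real_inner_comm]; exact h4 y hy]
        exact h1
      · have h₁ := h₀.trans (.skip (.refl _))
        rw [List.append_nil] at h₁
        exact ih rfl h₁ hu t ht
  exact key h rfl (.refl _) (by simp [CoxeterSystem.IsReduced]) s (hc' s)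

end Form


/-! ### Positions in a periodic word -/

/-- The analogue of `Steps` for positions in a periodic sequence with period `n`: the list contains
the next position of every active letter. -/
inductive PositionSteps (n : ℕ) : List ℕ → List ℕ → Prop
  | nil (a : List ℕ) : PositionSteps n a []
  | take {k : ℕ} {a p : List ℕ} : PositionSteps n (a ++ [k + n]) p → PositionSteps n (k :: a) (k :: p)
  | skip {k : ℕ} {a p : List ℕ} : PositionSteps n a p → PositionSteps n (k :: a) p

namespace PositionSteps

variable {n : ℕ}

theorem exists_mem {a p : List ℕ} (h : PositionSteps n a p) :
    ∀ k ∈ p, ∃ j ∈ a, k % n = j % n := by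
  induction h with
  | nil => simp
  | @take k a p _ ih =>
    intro k' hk'
    rcases List.mem_cons.1 hk' with rfl | hk'
    · exact ⟨k', by simp, rfl⟩
    · obtain ⟨j, hj, he⟩ := ih k' hk'
      rcases List.mem_append.1 hj with hj | hj
      · exact ⟨j, by simp [hj], he⟩
      · refine ⟨k, by simp, ?_⟩
        rw [he, List.mem_singleton.1 hj, Nat.add_mod_right]
  | skip _ ih =>
    intro k' hk'
    obtain ⟨j, hj, he⟩ := ih k' hk'
    exact ⟨j, by simp [hj], he⟩

theorem le_of_mem {a p : List ℕ} (h : PositionSteps n a p) {m : ℕ} (hm : ∀ j ∈ a, m ≤ j) :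
    ∀ k ∈ p, m ≤ k := by
  induction h with
  | nil => simp
  | @take k a p _ ih =>
    have hk := hm k (by simp)
    intro k' hk'
    rcases List.mem_cons.1 hk' with rfl | hk'
    · exact hk
    · refine ih (fun j hj => ?_) k' hk'
      rcases List.mem_append.1 hj with hj | hj
      · exact hm j (by simp [hj])
      · rw [List.mem_singleton.1 hj]
        omega
  | skip _ ih => exact ih fun j hj => hm j (by simp [hj])

theorem mem_or {a p : List ℕ} (h : PositionSteps n a p) :
    ∀ k ∈ p, k ∈ a ∨ n ≤ k ∧ k - n ∈ p := by
  induction h with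
  | nil => simp
  | @take k a p _ ih =>
    intro k' hk'
    rcases List.mem_cons.1 hk' with rfl | hk'
    · simp
    · rcases ih k' hk' with h1 | h1
      · rcases List.mem_append.1 h1 with h1 | h1
        · simp [h1]
        · rw [List.mem_singleton.1 h1]
          right
          simp
      · exact .inr ⟨h1.1, by simp [h1.2]⟩
  | skip _ ih =>
    intro k' hk'
    rcases ih k' hk' with h1 | h1
    · simp [h1]
    · exact .inr h1

/-- The positions lie in a window of length `n`. -/
structure IsWindow (n : ℕ) (a : List ℕ) : Prop where
  pairwise : a.Pairwise (· < ·)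
  lt_add : ∀ x ∈ a, ∀ y ∈ a, y < x + n

theorem IsWindow.tail {k : ℕ} {a : List ℕ} (h : IsWindow n (k :: a)) : IsWindow n a :=
  ⟨(List.pairwise_cons.1 h.1).2, fun x hx y hy => h.2 x (by simp [hx]) y (by simp [hy])⟩

theorem IsWindow.rotate {k : ℕ} {a : List ℕ} (h : IsWindow n (k :: a)) :
    IsWindow n (a ++ [k + n]) := by
  obtain ⟨h1, h2⟩ := List.pairwise_cons.1 h.1
  have h3 := h.2 k (by simp)
  have h4 := h.2
  refine ⟨List.pairwise_append.2 ⟨h2, by simp, fun x hx y hy => ?_⟩, fun x hx y hy => ?_⟩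
  · rw [List.mem_singleton.1 hy]
    exact h3 x (by simp [hx])
  · have hk := h3 k (by simp)
    simp only [List.mem_append, List.mem_singleton] at hx hy
    rcases hx with hx | rfl <;> rcases hy with hy | rfl
    · exact h4 x (by simp [hx]) y (by simp [hy])
    · have := h1 x hx
      omega
    · have := h3 y (by simp [hy])
      omega
    · omega

theorem pairwise {a p : List ℕ} (h : PositionSteps n a p) (ha : IsWindow n a) :
    p.Pairwise (· < ·) := by
  induction h with
  | nil => exact .nil
  | @take k a p h ih =>
    refine List.pairwise_cons.2 ⟨fun k' hk' => ?_, ih ha.rotate⟩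
    refine h.le_of_mem (m := k + 1) (fun j hj => ?_) k' hk'
    rcases List.mem_append.1 hj with hj | hj
    · exact (List.pairwise_cons.1 ha.1).1 j hj
    · rw [List.mem_singleton.1 hj]
      have := ha.2 k (by simp) k (by simp)
      omega
  | skip _ ih => exact ih ha.tail

theorem IsWindow.mod_ne {k : ℕ} {a : List ℕ} (h : IsWindow n (k :: a)) {j : ℕ} (hj : j ∈ a) :
    k % n ≠ j % n := by
  intro he
  have h1 := (List.pairwise_cons.1 h.1).1 j hj
  have h2 := h.2 k (by simp) j (by simp [hj])
  have h3 : n ∣ j - k := (Nat.modEq_iff_dvd' h1.le).1 he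
  exact absurd (Nat.le_of_dvd (by omega) h3) (by omega)

theorem isWindow_range (n : ℕ) : IsWindow n (List.range n) :=
  ⟨List.pairwise_lt_range, fun x _ y hy => by
    have := List.mem_range.1 hy
    omega⟩

/-- A sequence of positions such that each of them is active or is the successor of a position in
the sequence can be read off the list of active positions. -/
theorem of_mem_or (hn : 0 < n) {a p : List ℕ} (ha : IsWindow n a) (hp : p.Pairwise (· < ·))
    (h : ∀ k ∈ p, k ∈ a ∨ n ≤ k ∧ k - n ∈ p) : PositionSteps n a p := by
  induction hm : p.length + a.length using Nat.strong_induction_on generalizing a p with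
  | _ m ih =>
  cases p with
  | nil => exact .nil a
  | cons x p =>
    obtain ⟨hp1, hp2⟩ := List.pairwise_cons.1 hp
    have hx : x ∈ a := by
      rcases h x (by simp) with h1 | ⟨h1, h2⟩
      · exact h1
      · rcases List.mem_cons.1 h2 with h2 | h2
        · omega
        · have := hp1 _ h2
          omega
    cases a with
    | nil => simp at hx
    | cons k a =>
      have ha1 := (List.pairwise_cons.1 ha.1).1
      simp only [List.length_cons] at hm
      by_cases hxk : x = k
      · subst hxk
        refine .take (ih _ ?_ ha.rotate hp2 ?_ rfl)
        · simp only [List.length_append, List.length_cons, List.length_nil]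
          omega
        · intro k' hk'
          have hlt := hp1 k' hk'
          rcases h k' (by simp [hk']) with h1 | ⟨h1, h2⟩
          · left
            rcases List.mem_cons.1 h1 with h1 | h1
            · omega
            · simp [h1]
          · rcases List.mem_cons.1 h2 with h2 | h2
            · left
              simp only [List.mem_append, List.mem_singleton]
              right
              omega
            · exact .inr ⟨h1, h2⟩
      · refine .skip (ih _ ?_ ha.tail hp ?_ rfl)
        · simp only [List.length_cons]
          omega
        · intro k' hk'
          rcases h k' hk' with h1 | h1
          · rcases List.mem_cons.1 h1 with rfl | h1
            · have hkx : k' < x := ha1 x ((List.mem_cons.1 hx).resolve_left hxk)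
              rcases List.mem_cons.1 hk' with h2 | h2
              · omega
              · have := hp1 k' h2
                omega
            · exact .inl h1
          · exact .inr h1

end PositionSteps

/-! ### Sortable elements are the reduced queue readings -/

section Sorting

open PositionSteps

variable {B W V : Type*} [Group W] {M : CoxeterMatrix B} {cs : CoxeterSystem M W}
  [NormedAddCommGroup V] [InnerProductSpace ℝ V] (R : SimpleRoots cs V)

/-- The letter at position `k` of the periodic word with period `l`. -/
def periodicLetter (l : List B) (k : ℕ) : Option B := l[k % l.length]?

theorem periodicLetter_add (l : List B) (k : ℕ) :
    periodicLetter l (k + l.length) = periodicLetter l k := by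
  rw [periodicLetter, Nat.add_mod_right, periodicLetter]

theorem map_periodicLetter_range (l : List B) :
    (List.range l.length).map (periodicLetter l) = l.map some := by
  apply List.ext_getElem
  · simp
  · intro i h1 h2
    have hi : i < l.length := by simpa using h2
    simp [periodicLetter, Nat.mod_eq_of_lt hi, hi]

theorem periodicLetter_injective {l : List B} (hl : l.Nodup) {k k' : ℕ} {s : B}
    (h : periodicLetter l k = some s) (h' : periodicLetter l k' = some s) :
    k % l.length = k' % l.length := by
  obtain ⟨h1, h2⟩ := List.getElem?_eq_some_iff.1 h
  obtain ⟨h3, h4⟩ := List.getElem?_eq_some_iff.1 h'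
  exact (hl.getElem_inj_iff).1 (h2.trans h4.symm)

theorem PositionSteps.exists_steps {l : List B} {a p : List ℕ} (h : PositionSteps l.length a p)
    {b : List B} (hb : a.map (periodicLetter l) = b.map some) :
    ∃ q u d, Steps b q u d ∧ p.map (periodicLetter l) = u.map some := by
  induction h generalizing b with
  | nil => exact ⟨_, [], _, .refl _, rfl⟩
  | @take k a p _ ih =>
    cases b with
    | nil => simp at hb
    | cons s b =>
      simp only [List.map_cons, List.cons.injEq] at hb
      obtain ⟨q, u, d, h1, h2⟩ := ih (b := b ++ [s]) (by
        simp [periodicLetter_add, hb.1, hb.2])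
      exact ⟨_, _, _, .take h1, by simp [hb.1, h2]⟩
  | @skip k a p _ ih =>
    cases b with
    | nil => simp at hb
    | cons s b =>
      simp only [List.map_cons, List.cons.injEq] at hb
      obtain ⟨q, u, d, h1, h2⟩ := ih hb.2
      exact ⟨_, _, _, .skip h1, h2⟩

theorem Steps.exists_positionSteps {l b q u d : List B} (h : Steps b q u d) {a : List ℕ}
    (ha : a.map (periodicLetter l) = b.map some) :
    ∃ p, PositionSteps l.length a p ∧ p.map (periodicLetter l) = u.map some := by
  induction h generalizing a with
  | refl => exact ⟨[], .nil _, rfl⟩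
  | @take s b q u d _ ih =>
    cases a with
    | nil => simp at ha
    | cons k a =>
      simp only [List.map_cons, List.cons.injEq] at ha
      obtain ⟨p, h1, h2⟩ := ih (a := a ++ [k + l.length]) (by
        simp [periodicLetter_add, ha.1, ha.2])
      exact ⟨_, .take h1, by simp [ha.1, h2]⟩
  | @skip s b q u d _ ih =>
    cases a with
    | nil => simp at ha
    | cons k a =>
      simp only [List.map_cons, List.cons.injEq] at ha
      obtain ⟨p, h1, h2⟩ := ih ha.2
      exact ⟨_, .skip h1, h2⟩

/-- A queue reading is lexicographically first among the reduced subwords for its element. A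
competitor cannot start before the first active position, and it cannot use a letter that the
reading has dropped, since reduced words of the same element have the same letters. -/
theorem PositionSteps.le (R : SimpleRoots cs V) [Fintype B] {l : List B} (hl : l.Nodup) {a p : List ℕ}
    (h : PositionSteps l.length a p) (ha : IsWindow l.length a) {p' : List ℕ} {u u' : List B}
    (hu : p.map (periodicLetter l) = u.map some) (hu' : p'.map (periodicLetter l) = u'.map some)
    (hr : cs.IsReduced u) (hr' : cs.IsReduced u') (he : cs.wordProd u = cs.wordProd u')
    (hp' : p'.Pairwise (· < ·)) (hm : ∀ k ∈ p', ∃ j ∈ a, j ≤ k ∧ k % l.length = j % l.length) :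
    p ≤ p' := by
  induction h generalizing p' u u' with
  | nil =>
    cases p' with
    | nil => exact le_rfl
    | cons x p' => exact le_of_lt (show List.Lex (· < ·) [] (x :: p') from .nil)
  | @take k a p h ih =>
    cases u with
    | nil => simp at hu
    | cons s u =>
      cases p' with
      | nil =>
        have hu0 : u' = [] := by simpa using hu'.symm
        rw [hu0, cs.wordProd_nil, ← cs.length_eq_zero_iff, hr.eq] at he
        simp at he
      | cons k' p' =>
        cases u' with
        | nil => simp at hu'
        | cons s' u' =>
          simp only [List.map_cons, List.cons.injEq] at hu hu'
          have hk : k ≤ k' := by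
            obtain ⟨j, hj, hjk, -⟩ := hm k' (by simp)
            rcases List.mem_cons.1 hj with rfl | hj
            · exact hjk
            · exact ((List.pairwise_cons.1 ha.1).1 j hj).le.trans hjk
          rcases hk.lt_or_eq with hk | rfl
          · exact le_of_lt (show List.Lex (· < ·) (k :: p) (k' :: p') from .rel hk)
          · have hss : s' = s := Option.some.inj (hu'.1.symm.trans hu.1)
            subst hss
            refine List.cons_le_cons _ (ih ha.rotate hu.2 hu'.2 (isReduced_append_right (u := [s']) hr)
              (isReduced_append_right (u := [s']) hr') ?_ (List.pairwise_cons.1 hp').2 ?_)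
            · simpa [cs.wordProd_cons] using he
            · intro x hx
              have hkx := (List.pairwise_cons.1 hp').1 x hx
              obtain ⟨j, hj, hjx, hjm⟩ := hm x (by simp [hx])
              rcases List.mem_cons.1 hj with rfl | hj
              · refine ⟨j + l.length, by simp, ?_, by simpa using hjm⟩
                have h3 : l.length ∣ x - j := (Nat.modEq_iff_dvd' hkx.le).1 hjm.symm
                have := Nat.le_of_dvd (by omega) h3
                omega
              · exact ⟨j, by simp [hj], hjx, hjm⟩
  | @skip k a p h ih =>
    refine ih ha.tail hu hu' hr hr' he hp' fun x hx => ?_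
    obtain ⟨j, hj, hjx, hjm⟩ := hm x hx
    rcases List.mem_cons.1 hj with rfl | hj
    -- A competitor using the skipped letter forces that letter to occur in `u`; but its residue
    -- class has left the window of active positions.
    · exfalso
      have h1 : periodicLetter l x ∈ u'.map some := hu' ▸ List.mem_map_of_mem hx
      obtain ⟨s, hs, hsx⟩ := List.mem_map.1 h1
      have h2 : some s ∈ p.map (periodicLetter l) :=
        hu ▸ List.mem_map_of_mem (mem_of_wordProd_eq R hr' he hs)
      obtain ⟨y, hy, hys⟩ := List.mem_map.1 h2
      obtain ⟨i, hi, him⟩ := h.exists_mem y hy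
      refine ha.mod_ne hi ?_
      rw [← him, ← hjm]
      exact periodicLetter_injective hl hsx.symm hys
    · exact ⟨j, hj, hjx, hjm⟩

variable (c : CoxeterWord B)

theorem sortingPositions_eq (R : SimpleRoots cs V) [Fintype B] {p : List ℕ} {u : List B}
    (h : PositionSteps c.letters.length (List.range c.letters.length) p)
    (hu : p.map (periodicLetter c.letters) = u.map some) (hr : cs.IsReduced u)
    (hp : p.Pairwise (· < ·)) :
    sortingPositions cs c (cs.wordProd u) = p := by
  obtain ⟨⟨h1, h2, h3, h4⟩, h5⟩ := sortingWord_spec cs c (cs.wordProd u)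
  refine le_antisymm (h5 u p ⟨hp, hu, hr, rfl⟩) ?_
  refine h.le R c.nodup (isWindow_range _) hu h2 hr h3 h4.symm h1 fun k hk => ?_
  have hn : 0 < c.letters.length := by
    by_contra h0
    have h6 : periodicLetter c.letters k ∈ (sortingWord cs c (cs.wordProd u)).map some :=
      h2 ▸ List.mem_map_of_mem hk
    obtain ⟨s, -, hs⟩ := List.mem_map.1 h6
    have h7 : c.letters = [] := List.length_eq_zero_iff.1 (by omega)
    simp [periodicLetter, h7] at hs
  exact ⟨k % c.letters.length, List.mem_range.2 (Nat.mod_lt _ hn), Nat.mod_le _ _, by simp⟩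

theorem sortingWord_eq (R : SimpleRoots cs V) [Fintype B] {q u b : List B}
    (h : Steps c.letters q u b) (hr : cs.IsReduced u) : sortingWord cs c (cs.wordProd u) = u := by
  obtain ⟨p, hp, hpu⟩ := h.exists_positionSteps (map_periodicLetter_range c.letters)
  have h1 := sortingPositions_eq c R hp hpu hr (hp.pairwise (isWindow_range _))
  obtain ⟨⟨-, h2, -⟩, -⟩ := sortingWord_spec cs c (cs.wordProd u)
  rw [h1] at h2
  exact List.map_injective_iff.2 (Option.some_injective B) (h2.symm.trans hpu)

/-- A letter taken in a later copy of `c` was active there only because it had been taken one period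
earlier; this is the nestedness of the blocks. -/
theorem isSortable_of_steps (R : SimpleRoots cs V) [Fintype B] {q u b : List B}
    (h : Steps c.letters q u b) (hr : cs.IsReduced u) : IsSortable cs c (cs.wordProd u) := by
  obtain ⟨p, hp, hpu⟩ := h.exists_positionSteps (map_periodicLetter_range c.letters)
  have h1 := sortingPositions_eq c R hp hpu hr (hp.pairwise (isWindow_range _))
  rintro j s ⟨k, hk, hkj, hks⟩
  rw [h1] at hk
  obtain ⟨hi, -⟩ := List.getElem?_eq_some_iff.1 hks
  have hn : 0 < c.letters.length := by omega
  rcases hp.mem_or k hk with h2 | ⟨h2, h3⟩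
  · rw [Nat.div_eq_of_lt (List.mem_range.1 h2)] at hkj
    omega
  · obtain ⟨i, rfl⟩ := Nat.exists_eq_add_of_le' h2
    rw [Nat.add_sub_cancel] at h3
    refine ⟨i, h1 ▸ h3, ?_, by simpa using hks⟩
    rw [Nat.add_div_right _ hn] at hkj
    omega

theorem IsSortable.exists_steps {w : W} (h : IsSortable cs c w) :
    ∃ q u b, Steps c.letters q u b ∧ cs.IsReduced u ∧ cs.wordProd u = w := by
  obtain ⟨⟨h1, h2, h3, h4⟩, -⟩ := sortingWord_spec cs c w
  rcases Nat.eq_zero_or_pos c.letters.length with hn | hn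
  -- Without letters the period is `0`, which `PositionSteps.of_mem_or` excludes; the sorting word
  -- is then empty.
  · have h5 : c.letters = [] := List.length_eq_zero_iff.1 hn
    refine ⟨_, _, _, .refl _, (?_ : cs.IsReduced []), ?_⟩
    · simp [CoxeterSystem.IsReduced]
    · have h6 : sortingWord cs c w = [] := by
        rw [List.eq_nil_iff_forall_not_mem]
        intro s
        simpa [h5] using c.complete s
      rw [← h4, h6]
  have hp : PositionSteps c.letters.length (List.range c.letters.length)
      (sortingPositions cs c w) := by
    refine .of_mem_or hn (isWindow_range _) h1 fun k hk => ?_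
    rcases Nat.lt_or_ge k c.letters.length with hkn | hkn
    · exact .inl (List.mem_range.2 hkn)
    right
    refine ⟨hkn, ?_⟩
    have hkm := Nat.mod_lt k hn
    obtain ⟨i, rfl⟩ := Nat.exists_eq_add_of_le' hkn
    rw [Nat.add_sub_cancel]
    rw [Nat.add_mod_right] at hkm
    have h5 : c.letters[i % c.letters.length] ∈
        sortingBlock cs c w (i / c.letters.length) := by
      refine h _ ⟨_, hk, Nat.add_div_right _ hn, ?_⟩
      rw [Nat.add_mod_right, List.getElem?_eq_getElem]
    obtain ⟨k', hk', h6, h7⟩ := h5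
    have h8 := periodicLetter_injective c.nodup (l := c.letters) (k := k') (k' := i) h7
      (List.getElem?_eq_getElem hkm)
    have h9 := Nat.div_add_mod k' c.letters.length
    have h10 := Nat.div_add_mod i c.letters.length
    rw [h6, h8] at h9
    rwa [← h10, h9]
  obtain ⟨q, u, d, h5, h6⟩ := hp.exists_steps (map_periodicLetter_range c.letters)
  have h7 : sortingWord cs c w = u :=
    List.map_injective_iff.2 (Option.some_injective B) (h2.symm.trans h6)
  exact ⟨q, u, d, h5, h7 ▸ h3, h7 ▸ h4⟩

end Sorting


/-! ### Singletons and prefixes of the greedy word -/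

section Singletons

variable {B W V : Type*} [Group W] {M : CoxeterMatrix B} {cs : CoxeterSystem M W}
  [NormedAddCommGroup V] [InnerProductSpace ℝ V] {R : SimpleRoots cs V}

theorem skewForm_cons_root_left {s : B} {a : List B} (hs : s ∉ a) (v : V) :
    skewForm R (s :: a) (R.root s) v = -componentInner R s a v := by
  have h0 : ∀ j ∈ a, R.root.repr (R.root s) j = 0 := fun j hj => by
    rw [R.root.repr_self, Finsupp.single_eq_of_ne]
    rintro rfl
    exact hs hj
  rw [skewForm, skewForm_eq_zero h0, componentInner_eq_zero h0, R.root.repr_self]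
  simp

theorem componentInner_neg {a : List B} {s t : B} (hs : s ∉ a) {v : V} (hv : IsNonneg R v)
    (ht : t ∈ a) (h : ⟪R.root s, R.root t⟫ ≠ 0) (hvt : 0 < R.root.repr v t) :
    componentInner R s a v < 0 := by
  induction a with
  | nil => simp at ht
  | cons j a ih =>
    rw [List.mem_cons, not_or] at hs
    have h1 := inner_root_nonpos R hs.1
    rw [componentInner, List.map_cons, List.sum_cons]
    rcases List.mem_cons.1 ht with rfl | ht
    · exact add_neg_of_neg_of_nonpos
        (mul_neg_of_pos_of_neg hvt (lt_of_le_of_ne h1 h)) (componentInner_nonpos hs.2 hv)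
    · exact add_neg_of_nonpos_of_neg (mul_nonpos_of_nonneg_of_nonpos (hv j) h1) (ih hs.2 ht)

theorem skewForm_add_left (a : List B) (v₁ v₂ v' : V) :
    skewForm R a (v₁ + v₂) v' = skewForm R a v₁ v' + skewForm R a v₂ v' := by
  have h : ∀ s (a : List B), componentInner R s a (v₁ + v₂) =
      componentInner R s a v₁ + componentInner R s a v₂ := by
    intro s a
    simp only [componentInner, map_add, Finsupp.add_apply, add_mul, List.sum_map_add]
  induction a with
  | nil => simp [skewForm]
  | cons s a ih =>
    rw [skewForm, skewForm, skewForm, ih, h, map_add, Finsupp.add_apply]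
    ring

/-- The inversions of a sortable element are aligned with the skew form. -/
theorem Steps.isNonneg_neg_of_skewForm_pos {a q u b : List B} (h : Steps a q u b) (ha : a.Nodup)
    (hr : cs.IsReduced u) {x d : V} (hx : IsRootRay R x) (hxp : IsNonneg R x)
    (hxs : IsSupportedOn R a x) (hd : IsRootRay R d) (hdp : IsNonneg R d)
    (hds : IsSupportedOn R a d) (hpos : 0 < skewForm R a x d)
    (hn : IsNonneg R (-R.act (cs.wordProd u)⁻¹ (x + d))) :
    IsNonneg R (-R.act (cs.wordProd u)⁻¹ x) := by
  induction h generalizing x d with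
  | refl =>
    rw [cs.wordProd_nil, inv_one, act_one_apply] at *
    simpa using hn.add hdp
  | @take s a q u b h ih =>
    have hs := (List.nodup_cons.1 ha).1
    have hcons : ∀ v : V, R.act (cs.wordProd (s :: u))⁻¹ v =
        R.act (cs.wordProd u)⁻¹ (R.act (cs.simple s) v) := fun v => by
      rw [cs.wordProd_cons, mul_inv_rev, cs.inv_simple, act_mul_apply]
    by_cases he : ∃ k : ℝ, 0 < k ∧ x = k • R.root s
    -- A multiple of `α_s` is made negative by the first letter and stays an inversion because the
    -- word is reduced.
    · obtain ⟨k, hk, rfl⟩ := he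
      rw [hcons, map_smul, act_simple_root_self, map_smul, map_neg, smul_neg, neg_neg]
      exact (isNonneg_of_isReduced_cons R hr).smul hk.le
    · have hd' : ¬ ∃ k : ℝ, 0 < k ∧ d = k • R.root s := by
        -- With `α_s`, the first root of the queue, as second argument, the form is nonpositive on
        -- positive vectors.
        rintro ⟨k, hk, rfl⟩
        rw [skewForm_swap, skewForm_smul_left, skewForm_cons_root_left hs] at hpos
        nlinarith [componentInner_nonpos hs hxp]
      have hsupp : ∀ v : V, IsSupportedOn R (s :: a) v →
          IsSupportedOn R (a ++ [s]) (R.act (cs.simple s) v) := by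
        intro v hv
        rw [← cs.wordProd_singleton]
        exact IsSupportedOn.act_wordProd (by simp)
          (hv.of_subset fun y hy => by simpa [or_comm] using hy)
      rw [hcons] at hn ⊢
      rw [map_add] at hn
      refine ih ((List.perm_append_singleton _ _).nodup_iff.2 ha)
        (isReduced_append_right (u := [s]) hr) (hx.act _) (hx.isNonneg_act_simple hxp he)
        (hsupp x hxs) (hd.act _) (hd.isNonneg_act_simple hdp hd') (hsupp d hds) ?_ hn
      have h1 : ∀ v : V, IsSupportedOn R (s :: a) v →
          IsSupportedOn R (s :: a) (R.act (cs.simple s) v) := fun v hv =>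
        (hsupp v hv).of_subset fun y hy => by simpa [or_comm] using hy
      rw [← skewForm_act_simple ha (h1 x hxs) (h1 d hds), ← act_mul_apply, ← act_mul_apply,
        cs.simple_mul_simple_self, act_one_apply, act_one_apply]
      exact hpos
  | @skip s a q u b h ih =>
    obtain ⟨hs, ha⟩ := List.nodup_cons.1 ha
    -- A word without `s` preserves the coordinate at `s`. Hence `x` and `d` both have coordinate
    -- zero there and are supported on the rest of the queue.
    have h1 := hn s
    rw [map_neg, Finsupp.neg_apply,
      repr_act_wordProd_inv_of_notMem R fun hsu => hs (h.word_subset hsu), map_add,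
      Finsupp.add_apply] at h1
    have hxs0 : R.root.repr x s = 0 := by linarith [hxp s, hdp s]
    have hds0 : R.root.repr d s = 0 := by linarith [hxp s, hdp s]
    have hsupp : ∀ v : V, R.root.repr v s = 0 → IsSupportedOn R (s :: a) v →
        IsSupportedOn R a v := by
      intro v hv hvs t ht
      by_cases hts : t = s
      · rw [hts, hv]
      · exact hvs t (by simp [hts, ht])
    refine ih ha hr hx hxp (hsupp x hxs0 hxs) hd hdp (hsupp d hds0 hds) ?_ hn
    simpa [skewForm, hxs0, hds0] using hpos

/-- Each further letter `t ≠ s` adds a nonnegative multiple of the positive root created by `t`. -/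
theorem isNonneg_act_wordProd_append_sub {u z : List B} {s : B} (hs : s ∉ z)
    (hr : cs.IsReduced (u ++ z)) : IsNonneg R (R.act (cs.wordProd (u ++ z)) (R.root s) -
      R.act (cs.wordProd u) (R.root s)) := by
  induction z using List.reverseRecOn with
  | nil =>
    intro t
    simp
  | append_singleton z t ih =>
    rw [← List.append_assoc] at hr ⊢
    have h1 := ih (fun h => hs (by simp [h])) (isReduced_append_left hr)
    have h2 := isNonneg_of_isReduced_concat R hr
    have hst : t ≠ s := by rintro rfl; exact hs (by simp)
    have h3 : 0 ≤ -(2 * ⟪R.root t, R.root s⟫ / ⟪R.root t, R.root t⟫) := by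
      have := R.cartan_nonpos t s hst
      linarith
    rw [cs.wordProd_append (u ++ z), cs.wordProd_singleton, act_mul_apply, act_simple_apply,
      map_sub, map_smul]
    have := h1.add (h2.smul h3)
    rwa [neg_smul, ← sub_eq_add_neg, sub_right_comm] at this

/-- The difference `z α_s - α_s` is built up letter by letter. Taking `r` contributes a Cartan
number times `componentInner`, both nonpositive. Strict positivity comes from the last occurrence of
`t` in `z`. -/
theorem Steps.skewForm_act_sub_nonneg {b q z d : List B} (h : Steps b q z d) (hb : b.Nodup)
    {s t : B} (hs : s ∉ b) (ht : t ∈ d) (hr : cs.IsReduced (z ++ [t])) :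
    0 ≤ skewForm R b (R.act (cs.wordProd z) (R.root s) - R.root s)
      (R.act (cs.wordProd z) (R.root t)) ∧ (t ∈ z → ⟪R.root s, R.root t⟫ ≠ 0 →
    0 < skewForm R b (R.act (cs.wordProd z) (R.root s) - R.root s)
      (R.act (cs.wordProd z) (R.root t))) := by
  induction h with
  | refl b =>
    rw [cs.wordProd_nil, act_one_apply, sub_self, skewForm_eq_zero (by simp)]
    simp
  | @take r e q z d h ih =>
    have hre := (List.nodup_cons.1 hb).1
    have hrs : r ≠ s := by rintro rfl; exact hs (by simp)
    have hr' := isReduced_append_right (u := [r]) hr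
    obtain ⟨ih1, ih2⟩ := ih ((List.perm_append_singleton _ _).nodup_iff.2 hb)
      (by simpa [or_comm] using hs) ht hr'
    have htb : t ∈ r :: e := by simpa [or_comm] using h.subset ht
    have hy : IsNonneg R (R.act (cs.wordProd z) (R.root t)) := isNonneg_of_isReduced_concat R hr'
    have hzs : z ⊆ r :: e := fun y hy => by simpa [or_comm] using h.word_subset hy
    have hyt : IsSupportedOn R (r :: e) (R.act (cs.wordProd z) (R.root t)) :=
      (isSupportedOn_root R htb).act_wordProd hzs
    have hδ : IsSupportedOn R (r :: e) (R.act (cs.wordProd z) (R.root s) - R.root s) := by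
      intro j hj
      rw [map_sub, Finsupp.sub_apply, repr_act_wordProd_of_notMem R fun h => hj (hzs h), sub_self]
    have e1 := skewForm_act_simple hb hδ hyt
    have e2 : R.act (cs.wordProd (r :: z)) (R.root s) - R.root s =
        R.act (cs.simple r) (R.act (cs.wordProd z) (R.root s) - R.root s) +
          (2 * ⟪R.root r, R.root s⟫ / ⟪R.root r, R.root r⟫) • R.act (cs.simple r) (R.root r) := by
      rw [cs.wordProd_cons, act_mul_apply, map_sub, act_simple_apply R r (R.root s),
        act_simple_root_self]
      module
    have e3 := skewForm_act_simple hb (isSupportedOn_root R (s := r) (by simp)) hyt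
    rw [skewForm_concat_root hre] at e3
    have hk : 2 * ⟪R.root r, R.root s⟫ / ⟪R.root r, R.root r⟫ ≤ 0 := R.cartan_nonpos r s hrs
    rw [e2, skewForm_add_left, skewForm_smul_left, cs.wordProd_cons, act_mul_apply, e1, e3]
    have hψ := componentInner_nonpos hre hy
    refine ⟨add_nonneg ih1 (mul_nonneg_of_nonpos_of_nonpos hk hψ), fun htz hst => ?_⟩
    by_cases htz' : t ∈ z
    · exact add_pos_of_pos_of_nonneg (ih2 htz' hst) (mul_nonneg_of_nonpos_of_nonpos hk hψ)
    · obtain rfl : t = r := (List.mem_cons.1 htz).resolve_right htz'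
      refine add_pos_of_nonneg_of_pos ih1 (mul_pos_of_neg_of_neg (lt_of_le_of_ne hk ?_) ?_)
      · rw [real_inner_comm]
        exact div_ne_zero (mul_ne_zero two_ne_zero hst) (inner_root_self_pos R t).ne'
      · have h1 := componentInner_eq_inner hb hyt t
        rw [componentInner, List.map_cons, List.sum_cons, repr_act_wordProd_of_notMem R htz',
          R.root.repr_self, Finsupp.single_eq_same, one_mul] at h1
        -- Equality in Cauchy–Schwarz would give `z α_t = α_t`, contradicting that `t z t` is
        -- reduced.
        have h2 : ⟪R.root t, R.act (cs.wordProd z) (R.root t)⟫ < ⟪R.root t, R.root t⟫ := by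
          have h3 : ‖R.act (cs.wordProd z) (R.root t)‖ = ‖R.root t‖ :=
            (R.act (cs.wordProd z)).norm_map _
          have hle := real_inner_le_norm (R.root t) (R.act (cs.wordProd z) (R.root t))
          rw [h3, ← real_inner_self_eq_norm_mul_norm] at hle
          refine lt_of_le_of_ne hle fun he => ?_
          have h4 := (inner_eq_norm_mul_iff_real (x := R.root t)
            (y := R.act (cs.wordProd z) (R.root t))).1 (by
              rw [he, h3, real_inner_self_eq_norm_mul_norm])
          rw [h3] at h4
          have h5 := smul_right_injective V (norm_pos_iff.2 (R.root.ne_zero t)).ne' h4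
          have h6 := isNonneg_of_isReduced_concat R hr
          rw [cs.wordProd_cons, act_mul_apply, ← h5, act_simple_root_self] at h6
          exact R.root.ne_zero t ((isNonneg_root R t).eq_zero h6)
        rw [← h1] at h2
        rw [componentInner]
        linarith
  | @skip r e q z d h ih =>
    obtain ⟨hre, he⟩ := List.nodup_cons.1 hb
    have hrz : r ∉ z := fun hz => hre (h.word_subset hz)
    have htr : t ≠ r := by
      rintro rfl
      exact hre (h.subset ht)
    have h1 : R.root.repr (R.act (cs.wordProd z) (R.root s) - R.root s) r = 0 := by
      rw [map_sub, Finsupp.sub_apply, repr_act_wordProd_of_notMem R hrz, sub_self]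
    have h2 : R.root.repr (R.act (cs.wordProd z) (R.root t)) r = 0 := by
      rw [repr_act_wordProd_of_notMem R hrz, R.root.repr_self, Finsupp.single_eq_of_ne htr.symm]
    rw [skewForm, h1, h2, zero_mul, zero_mul, sub_zero, zero_add]
    exact ih he (fun h => hs (by simp [h])) ht hr

theorem exists_last_of_exists {α : Type*} {p : α → Prop} {z : List α} (h : ∃ t ∈ z, p t) :
    ∃ z₁ t z₂, z = z₁ ++ t :: z₂ ∧ p t ∧ ∀ t' ∈ z₂, ¬ p t' := by
  induction z with
  | nil => simp at h
  | cons r z ih =>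
    by_cases hz : ∃ t ∈ z, p t
    · obtain ⟨z₁, t, z₂, rfl, h1⟩ := ih hz
      exact ⟨r :: z₁, t, z₂, rfl, h1⟩
    · obtain ⟨t, ht, hp⟩ := h
      rcases List.mem_cons.1 ht with rfl | ht
      · exact ⟨[], t, z, rfl, hp, fun t' ht' hp' => hz ⟨t', ht', hp'⟩⟩
      · exact absurd ⟨t, ht, hp⟩ hz

/-- Split `z α_s` into `α_s` and the difference. If `t` is not in `z`, then `z α_t` has coefficient
one at `α_t` and the first part is strictly positive; otherwise the second part is. -/
theorem Steps.skewForm_act_pos {b q z d : List B} (h : Steps b q z d) {s t : B}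
    (hb : (s :: b).Nodup) (ht : t ∈ d) (hr : cs.IsReduced (z ++ [t]))
    (hst : ⟪R.root s, R.root t⟫ ≠ 0) :
    0 < skewForm R (s :: b) (R.act (cs.wordProd z) (R.root s))
      (R.act (cs.wordProd z) (R.root t)) := by
  obtain ⟨hs, hb⟩ := List.nodup_cons.1 hb
  have hsz : s ∉ z := fun hz => hs (h.word_subset hz)
  have hts : t ≠ s := by
    rintro rfl
    exact hs (h.subset ht)
  obtain ⟨h1, h2⟩ := h.skewForm_act_sub_nonneg (R := R) hb hs ht hr
  have h3 : R.root.repr (R.act (cs.wordProd z) (R.root s) - R.root s) s = 0 := by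
    rw [map_sub, Finsupp.sub_apply, repr_act_wordProd_of_notMem R hsz, sub_self]
  have h4 : R.root.repr (R.act (cs.wordProd z) (R.root t)) s = 0 := by
    rw [repr_act_wordProd_of_notMem R hsz, R.root.repr_self, Finsupp.single_eq_of_ne hts.symm]
  have h5 : skewForm R (s :: b) (R.act (cs.wordProd z) (R.root s))
      (R.act (cs.wordProd z) (R.root t)) =
      -componentInner R s b (R.act (cs.wordProd z) (R.root t)) +
        skewForm R b (R.act (cs.wordProd z) (R.root s) - R.root s)
          (R.act (cs.wordProd z) (R.root t)) := by
    have h6 : R.act (cs.wordProd z) (R.root s) =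
        R.root s + (R.act (cs.wordProd z) (R.root s) - R.root s) := by abel
    conv_lhs => rw [h6]
    rw [skewForm_add_left, skewForm_cons_root_left hs]
    congr 1
    rw [skewForm, h3, h4]
    ring
  have hy := isNonneg_of_isReduced_concat R hr
  rw [h5]
  by_cases htz : t ∈ z
  · exact add_pos_of_nonneg_of_pos (by linarith [componentInner_nonpos (R := R) hs hy]) (h2 htz hst)
  · refine add_pos_of_pos_of_nonneg ?_ h1
    have := componentInner_neg (R := R) hs hy (h.subset ht) hst (by
      rw [repr_act_wordProd_of_notMem R htz, R.root.repr_self, Finsupp.single_eq_same]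
      exact one_pos)
    linarith

/-- The root `x α_s` is the only inversion of `x s` that is not one of `x`; an element below `x s`
that avoids it lies below `x`. -/
theorem WeakLE.of_le_mul_simple {x v : W} {s : B} (h : WeakLE cs v (x * cs.simple s))
    (hx : IsNonneg R (R.act x (R.root s)))
    (hv : ¬ IsNonneg R (-R.act v⁻¹ (R.act x (R.root s)))) : WeakLE cs v x := by
  obtain ⟨y, hy, hl⟩ := h
  have hy' : y = v⁻¹ * x * cs.simple s := by rw [mul_assoc, ← hy, inv_mul_cancel_left]
  have h1 : cs.IsRightDescent y s := by
    rw [← isNonneg_neg_act_root_iff R, hy', act_mul_apply, act_simple_root_self, map_neg, neg_neg,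
      act_mul_apply]
    by_contra h
    exact hv ((((isRootRay_act_root R x s).act _).isNonneg_neg_iff).2 h)
  refine ⟨y * cs.simple s, ?_, ?_⟩
  · rw [hy']
    simp [mul_assoc]
  · have h2 := cs.isRightDescent_iff.1 h1
    have h3 := cs.not_isRightDescent_iff.1 ((isNonneg_act_root_iff R).1 hx)
    omega

variable {c : CoxeterWord B}

/-- The letters that follow, in the sorting word of a singleton, an increasing letter that is not
taken are orthogonal to this letter. -/
theorem IsSingleton.inner_eq_zero_of_skip {q₀ u b q z b' : List B} {s : B}
    (h₀ : Steps c.letters q₀ u (s :: b)) (h : Steps b q z b') (hr : cs.IsReduced (u ++ z))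
    (hn : IsNonneg R (R.act (cs.wordProd u) (R.root s)))
    (hx : IsSingleton cs c (cs.wordProd (u ++ z))) :
    ∀ t ∈ z, ⟪R.root s, R.root t⟫ = 0 := by
  by_contra! hex
  -- Choosing the last letter `t` not orthogonal to `s` makes `z₂` fix `α_s`.
  obtain ⟨z₁, t, z₂, rfl, hst, hz₂⟩ := exists_last_of_exists hex
  simp only [not_not] at hz₂
  have hnd := h₀.nodup c.nodup
  have hsb := (List.nodup_cons.1 hnd).1
  have hsz : s ∉ z₁ ++ t :: z₂ := fun h' => hsb (h.word_subset h')
  obtain ⟨q₁, q₂, d, h1, -⟩ := h.exists_of_append_cons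
  have hr1 : cs.IsReduced (u ++ z₁ ++ [t]) := by
    have : u ++ (z₁ ++ t :: z₂) = (u ++ z₁ ++ [t]) ++ z₂ := by simp
    exact isReduced_append_left (this ▸ hr)
  set x := cs.wordProd (u ++ (z₁ ++ t :: z₂)) with hxdef
  set y := cs.wordProd (u ++ z₁) with hydef
  have hts : t ≠ s := by
    rintro rfl
    exact hsz (by simp)
  set k : ℝ := -(2 * ⟪R.root t, R.root s⟫ / ⟪R.root t, R.root t⟫) with hk
  have hk0 : 0 < k := by
    have h2 := R.cartan_nonpos t s hts
    have h3 : 2 * ⟪R.root t, R.root s⟫ / ⟪R.root t, R.root t⟫ ≠ 0 := by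
      rw [real_inner_comm]
      exact div_ne_zero (mul_ne_zero two_ne_zero hst) (inner_root_self_pos R t).ne'
    rw [hk, neg_pos]
    exact lt_of_le_of_ne h2 h3
  have hxy : x = y * (cs.simple t * cs.wordProd z₂) := by
    rw [hxdef, hydef, ← cs.wordProd_cons, ← cs.wordProd_append, List.append_assoc]
  have hz₂s : R.act (cs.wordProd z₂) (R.root s) = R.root s :=
    act_wordProd_of_forall_inner_eq_zero R fun t' ht' => by
      rw [real_inner_comm]
      exact hz₂ t' ht'
  have hβ : R.act x (R.root s) = R.act y (R.root s) + k • R.act y (R.root t) := by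
    rw [hxy, act_mul_apply, act_mul_apply, hz₂s, act_simple_apply, map_sub, map_smul, hk, neg_smul,
      sub_eq_add_neg]
  have hβn : IsNonneg R (R.act x (R.root s)) := by
    have := (isNonneg_act_wordProd_append_sub (R := R) hsz hr).add hn
    rwa [sub_add_cancel] at this
  have ha : IsNonneg R (R.act y (R.root s)) := by
    have := (isNonneg_act_wordProd_append_sub (R := R) (s := s) (z := z₁)
      (fun h' => hsz (by simp [h'])) (isReduced_append_left hr1)).add hn
    rwa [sub_add_cancel] at this
  have hd := isNonneg_of_isReduced_concat R hr1
  have hlt : ¬ cs.IsRightDescent x s := (isNonneg_act_root_iff R).1 hβn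
  have hlen := cs.not_isRightDescent_iff.1 hlt
  have hmax : ¬ IsMaxSortableBelow cs c (x * cs.simple s) x := by
    intro h'
    have h2 : x * cs.simple s ∈ ({x} : Set W) := hx ▸ h'
    rw [Set.mem_singleton_iff] at h2
    rw [h2] at hlen
    omega
  have hxs : IsSortable cs c x := by
    have h2 : x ∈ {u : W | IsMaxSortableBelow cs c u x} := by rw [hx]; rfl
    exact h2.1
  -- The element `x s` is longer than `x` and not in its fiber, so some sortable `v` below it is not
  -- below `x`. Such a `v` must have `x α_s` as an inversion.
  have hex' : ∃ v, IsSortable cs c v ∧ WeakLE cs v (x * cs.simple s) ∧ ¬ WeakLE cs v x := by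
    by_contra! h'
    exact hmax ⟨hxs, ⟨cs.simple s, rfl, by rw [cs.length_simple, hlen]⟩, h'⟩
  obtain ⟨v, hv, hvs, hvx⟩ := hex'
  have hvn : IsNonneg R (-R.act v⁻¹ (R.act x (R.root s))) := by
    by_contra h'
    exact hvx (hvs.of_le_mul_simple hβn h')
  obtain ⟨qv, uv, bv, hsv, hrv, rfl⟩ := hv.exists_steps
  rw [hβ] at hvn
  have hall : ∀ v : V, IsSupportedOn R c.letters v := fun v j hj => absurd (c.complete j) hj
  -- The inversion `x α_s` is `y α_s + k y α_t` with positive form between the summands, so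
  -- alignment makes `y α_s` an inversion of `v`, and hence of `x s`.
  have hneg := hsv.isNonneg_neg_of_skewForm_pos c.nodup hrv (isRootRay_act_root R y s) ha (hall _)
    ((isRootRay_act_root R y t).smul hk0) (hd.smul hk0.le) (hall _) (by
      rw [skewForm_swap, skewForm_smul_left, ← mul_neg, ← skewForm_swap]
      refine mul_pos hk0 ?_
      have hsub : z₁ ⊆ s :: b := fun j hj => List.mem_cons_of_mem _ (h1.word_subset hj)
      rw [hydef, cs.wordProd_append, act_mul_apply, act_mul_apply, h₀.skewForm_act c.nodup
        ((isSupportedOn_root R (by simp)).act_wordProd hsub)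
        ((isSupportedOn_root R (List.mem_cons_of_mem _ (h1.subset (by simp)))).act_wordProd hsub)]
      refine h1.skewForm_act_pos hnd (by simp) ?_ hst
      rw [List.append_assoc] at hr1
      exact isReduced_append_right hr1) hvn
  have hneg2 := hvs.isNonneg_neg R (isRootRay_act_root R y s) ha hneg
  have hr' : R.act (x * cs.simple s)⁻¹ (R.act y (R.root s)) =
      R.act (cs.simple s) (R.act (cs.wordProd (t :: z₂))⁻¹ (R.root s)) := by
    rw [← act_mul_apply, ← act_mul_apply, hxy, cs.wordProd_cons]
    congr 2
    simp [mul_assoc]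
  rw [hr'] at hneg2
  set r := R.act (cs.wordProd (t :: z₂))⁻¹ (R.root s) with hrdef
  -- The root `r` has coordinate one at `s`, hence is positive. The reflection in `s` makes it
  -- negative only if `r = α_s`; then `t` fixes `α_s`, contrary to the choice of `t`.
  have hrs : R.root.repr r s = 1 := by
    rw [hrdef, repr_act_wordProd_inv_of_notMem R fun h' => hsz (by simp [List.mem_cons.1 h']),
      R.root.repr_self, Finsupp.single_eq_same]
  have hray : IsRootRay R r := (isRootRay_root R s).act _
  have hrn : IsNonneg R r := by
    refine hray.isNonneg_or.resolve_right fun h' => ?_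
    have := h' s
    rw [map_neg, Finsupp.neg_apply, hrs] at this
    linarith
  have hrk : ∃ a : ℝ, 0 < a ∧ r = a • R.root s := by
    by_contra h'
    exact (hray.act _).not_isNonneg_neg (hray.isNonneg_act_simple hrn h') hneg2
  obtain ⟨a, -, hra⟩ := hrk
  rw [hra, map_smul, Finsupp.smul_apply, R.root.repr_self, Finsupp.single_eq_same, smul_eq_mul,
    mul_one] at hrs
  rw [hrs, one_smul] at hra
  have h5 : R.act (cs.simple t) (R.root s) = R.root s := by
    conv_rhs => rw [← act_apply_inv_apply R (cs.wordProd (t :: z₂)) (R.root s), ← hrdef, hra,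
      cs.wordProd_cons, act_mul_apply, hz₂s]
  exact hst ((real_inner_comm _ _).trans (inner_eq_zero_of_act_simple R h5))

variable (R) in
/-- `OrthoSteps R a u`: the word `u` is read cyclically off the list `a` of active letters in such a
way that every letter that is skipped is orthogonal to all the letters that are taken later. -/
inductive OrthoSteps : List B → List B → Prop
  | nil (a : List B) : OrthoSteps a []
  | take {s : B} {a u : List B} : OrthoSteps (a ++ [s]) u → OrthoSteps (s :: a) (s :: u)
  | skip {s : B} {a u : List B} : (∀ t ∈ u, ⟪R.root s, R.root t⟫ = 0) → OrthoSteps a u →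
      OrthoSteps (s :: a) u

/-- A letter skipped by a singleton is either an ascent, handled by the singleton property, or a
descent, handled by the skew form. -/
theorem IsSingleton.orthoSteps_of_steps {b q z d : List B} (h : Steps b q z d)
    {q₀ u : List B} (h₀ : Steps c.letters q₀ u b) (hr : cs.IsReduced (u ++ z))
    (hx : IsSingleton cs c (cs.wordProd (u ++ z))) : OrthoSteps R b z := by
  induction h generalizing q₀ u with
  | refl => exact .nil _
  | @take s a q z b h ih =>
    have h1 : u ++ s :: z = (u ++ [s]) ++ z := by simp
    rw [h1] at hr hx
    exact .take (ih (h₀.trans (.take (.refl _))) hr hx)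
  | @skip s a q z b h ih =>
    refine .skip ?_ (ih (u := u) (by simpa using h₀.trans (.skip (.refl _))) hr hx)
    rcases (isRootRay_act_root R (cs.wordProd u) s).isNonneg_or with hn | hn
    · exact hx.inner_eq_zero_of_skip h₀ h hr hn
    · exact inner_eq_zero_of_skip_descent c.nodup h₀ h hr hn

variable (R) in
/-- The first list is obtained from the second one by deleting letters that are orthogonal to all
the letters of `u`. -/
inductive OrthoSublist (u : List B) : List B → List B → Prop
  | nil : OrthoSublist u [] []
  | keep {s : B} {a b : List B} : OrthoSublist u b a → OrthoSublist u (s :: b) (s :: a)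
  | drop {s : B} {a b : List B} : (∀ t ∈ u, ⟪R.root s, R.root t⟫ = 0) → OrthoSublist u b a →
      OrthoSublist u b (s :: a)

theorem OrthoSublist.mono {u u' a b : List B} (h : OrthoSublist R u b a) (hu : u' ⊆ u) :
    OrthoSublist R u' b a := by
  induction h with
  | nil => exact .nil
  | keep _ ih => exact .keep ih
  | drop h _ ih => exact .drop (fun t ht => h t (hu ht)) ih

theorem OrthoSublist.append {u a b a' b' : List B} (h : OrthoSublist R u b a)
    (h' : OrthoSublist R u b' a') : OrthoSublist R u (b ++ b') (a ++ a') := by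
  induction h with
  | nil => exact h'
  | keep _ ih => exact .keep ih
  | drop h _ ih => exact .drop h ih

theorem OrthoSublist.refl (u a : List B) : OrthoSublist R u a a := by
  induction a with
  | nil => exact .nil
  | cons s a ih => exact .keep ih

/-- A word with orthogonal skips runs parallel to the greedy word. -/
theorem Greedy.exists_prefix_of_orthoSteps [Fintype B] {x : W} {a q w : List B}
    (h : Greedy R x a q w) {b y ξ v : List B} (hb : OrthoSublist R y b a) (hy : OrthoSteps R b y)
    (hx : x = cs.wordProd ξ * cs.wordProd v) (hv : ∀ s ∈ v, ∀ t ∈ y, ⟪R.root s, R.root t⟫ = 0)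
    (hr : cs.IsReduced (ξ ++ y)) {s : B} (hs : s ∈ y) :
    ∃ w₁ w₂, w = w₁ ++ s :: w₂ ∧ R.act (cs.wordProd (ξ ++ y)) (weight R s) =
      R.act (x * cs.wordProd (w₁ ++ [s])) (weight R s) := by
  induction h generalizing b y ξ v s with
  | nil =>
    cases hb
    cases hy
    simp at hs
  | @take x r a q w hxr h ih =>
    -- Here the greedy word takes `r` and `y` does not. Then `r` is orthogonal to the rest of `y`,
    -- so it joins `v`, and its return to the greedy queue does no harm.
    have aux : ∀ {b : List B}, OrthoSublist R y b (a ++ [r]) → OrthoSteps R b y →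
        (∀ t ∈ y, ⟪R.root r, R.root t⟫ = 0) →
        ∃ w₁ w₂, r :: w = w₁ ++ s :: w₂ ∧ R.act (cs.wordProd (ξ ++ y)) (weight R s) =
          R.act (x * cs.wordProd (w₁ ++ [s])) (weight R s) := by
      intro b hb hy hro
      obtain ⟨w₁, w₂, rfl, h2⟩ := ih (v := v ++ [r]) hb hy
        (by rw [hx, cs.wordProd_append, cs.wordProd_singleton, mul_assoc]) (fun s hs => by
          rcases List.mem_append.1 hs with hs | hs
          · exact hv s hs
          · rw [List.mem_singleton.1 hs]
            exact hro) hr hs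
      exact ⟨r :: w₁, w₂, rfl, by rw [h2, List.cons_append, cs.wordProd_cons, mul_assoc]⟩
    cases hb with
    | drop hro hb =>
      refine aux ?_ hy hro
      simpa using hb.append (.drop (s := r) hro .nil)
    | @keep _ _ b hb =>
      cases hy with
      | nil => simp at hs
      | skip hro hy =>
        refine aux ?_ hy hro
        simpa using hb.append (.drop (s := r) hro .nil)
      | @take _ _ y hy =>
        have h1 : ξ ++ r :: y = (ξ ++ [r]) ++ y := by simp
        have hvr : ∀ t ∈ v, ⟪R.root r, R.root t⟫ = 0 := fun t ht => by
          rw [real_inner_comm]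
          exact hv t ht r (by simp)
        have hx' : x * cs.simple r = cs.wordProd (ξ ++ [r]) * cs.wordProd v := by
          rw [hx, mul_assoc, ← simple_mul_wordProd_comm R hvr, cs.wordProd_append,
            cs.wordProd_singleton, mul_assoc]
        by_cases hsy : s ∈ y
        · rw [h1] at hr ⊢
          obtain ⟨w₁, w₂, rfl, h2⟩ := ih (v := v)
            ((hb.mono (by simp)).append (OrthoSublist.refl _ [r])) hy hx'
            (fun s hs t ht => hv s hs t (by simp [ht])) hr hsy
          exact ⟨r :: w₁, w₂, rfl, by rw [h2, List.cons_append, cs.wordProd_cons, mul_assoc]⟩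
        -- This is the last use of `s` in `y`; neither the rest of `y` nor `v` moves `ω_s`.
        · obtain rfl : s = r := (List.mem_cons.1 hs).resolve_right hsy
          refine ⟨[], w, rfl, ?_⟩
          have hsv : s ∉ v := fun h' => ne_of_inner_root_eq_zero R (hvr s h') rfl
          rw [List.nil_append, cs.wordProd_singleton, hx', h1, cs.wordProd_append (ξ ++ [s]),
            act_mul_apply, act_wordProd_weight_of_notMem R hsy, act_mul_apply,
            act_wordProd_weight_of_notMem R hsv]
  | @skip x r a q w hxr h ih =>
    cases hb with
    | drop hro hb => exact ih hb hy hx hv hr hs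
    | @keep _ _ b hb =>
      cases hy with
      | nil => simp at hs
      | skip hro hy => exact ih hb hy hx hv hr hs
      | @take _ _ y hy =>
        -- The greedy word cannot skip a letter that `y` takes: `v` fixes its root, and `ξ` sends
        -- that root to a positive one by reducedness.
        have hvr : R.act (cs.wordProd v) (R.root r) = R.root r :=
          act_wordProd_of_forall_inner_eq_zero R fun t ht => hv t ht r (by simp)
        rw [hx, act_mul_apply, hvr] at hxr
        have h1 : ξ ++ r :: y = (ξ ++ [r]) ++ y := by simp
        rw [h1] at hr
        have h2 := isNonneg_of_isReduced_concat R (isReduced_append_left hr)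
        exact absurd hxr ((isRootRay_act_root R _ r).not_isNonneg_neg h2)

/-- Only the vectors `x(ω_s)` enter the associahedron, so it suffices to match a singleton with a
prefix of `w₀(c)` separately for each `s`. -/
theorem IsSingleton.exists_prefix [Fintype B] {x : W} (hx : IsSingleton cs c x) {q w : List B}
    (h : Greedy R 1 c.letters q w) (s : B) : R.act x (weight R s) = weight R s ∨
      ∃ w₁ w₂, w = w₁ ++ s :: w₂ ∧
        R.act x (weight R s) = R.act (cs.wordProd (w₁ ++ [s])) (weight R s) := by
  have hxs : IsSortable cs c x := by
    have h2 : x ∈ {u : W | IsMaxSortableBelow cs c u x} := by rw [hx]; rfl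
    exact h2.1
  obtain ⟨q', u, b, h1, hr, rfl⟩ := hxs.exists_steps
  by_cases hsu : s ∈ u
  · right
    obtain ⟨w₁, w₂, h2, h3⟩ := h.exists_prefix_of_orthoSteps (ξ := []) (v := []) (.refl u _)
      (IsSingleton.orthoSteps_of_steps h1 (.refl _) hr hx) (by simp) (by simp) hr hsu
    exact ⟨w₁, w₂, h2, by simpa using h3⟩
  · exact .inl (act_wordProd_weight_of_notMem R hsu)

/-- An element strictly above a prefix `w₁` in weak order lies above some longer `w₁ s`. Skipped
letters are descents of `w₁`, so `s` is still in the queue. Skipping ahead to it shows that `w₁ s`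
is sortable, so `w₁` is not maximal. -/
theorem Greedy.isSingleton_of_append [Fintype B] {q w₁ w₂ : List B}
    (h : Greedy R 1 c.letters q (w₁ ++ w₂)) : IsSingleton cs c (cs.wordProd w₁) := by
  have hred : cs.IsReduced ([] : List B) := by simp [CoxeterSystem.IsReduced]
  obtain ⟨q₁, d, h1, h2⟩ := Greedy.exists_steps_of_append (u := []) c.nodup (.refl _) hred
    (by rwa [cs.wordProd_nil])
  have hr : cs.IsReduced w₁ :=
    isReduced_append_left (v := w₂) (by simpa using h.isReduced hred cs.wordProd_nil)
  rw [List.nil_append] at h2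
  have hs := isSortable_of_steps c R h1 hr
  refine Set.ext fun u => ⟨fun ⟨_, hle, hmax⟩ => ?_, ?_⟩
  · rw [Set.mem_singleton_iff]
    by_contra hne
    obtain ⟨v, hv, hl⟩ := hle
    have hv1 : v ≠ 1 := by
      rintro rfl
      exact hne (by rw [← hv, mul_one])
    obtain ⟨s, hsv⟩ := cs.exists_leftDescent_of_ne_one hv1
    have hsl := cs.isLeftDescent_iff.1 hsv
    have h3 : cs.wordProd w₁ * cs.simple s * (cs.simple s * v) = u := by
      rw [← hv]
      simp [mul_assoc]
    have h4 : cs.length u ≤ cs.length (cs.wordProd w₁ * cs.simple s) +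
        cs.length (cs.simple s * v) := h3 ▸ cs.length_mul_le _ _
    have h5 : ¬ cs.IsRightDescent (cs.wordProd w₁) s := by
      intro h'
      have := cs.isRightDescent_iff.1 h'
      omega
    have h6 := cs.not_isRightDescent_iff.1 h5
    have hsd : s ∈ d := by
      by_contra h'
      exact h5 ((isNonneg_neg_act_root_iff R).1 (h2 s (c.complete s) h'))
    obtain ⟨d₁, d₂, rfl⟩ := List.append_of_mem hsd
    have h7 := h1.trans ((Steps.skip_append d₁ (s :: d₂)).trans (.take (.refl _)))
    have h8 : cs.IsReduced (w₁ ++ [s]) :=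
      (isReduced_concat_iff R hr).2 ((isNonneg_act_root_iff R).2 h5)
    have h9 := isSortable_of_steps c R h7 (by simpa using h8)
    rw [List.nil_append, cs.wordProd_append, cs.wordProd_singleton] at h9
    obtain ⟨y, -, hy⟩ := hmax _ h9 ⟨_, h3, by omega⟩
    omega
  · rintro rfl
    exact ⟨hs, ⟨1, mul_one _, by simp⟩, fun _ _ h => h⟩

end Singletons


/-! ### Subwords as marked words, and their Bruhat bounds -/

section Marked

variable {B W V : Type*} [Group W] {M : CoxeterMatrix B} {cs : CoxeterSystem M W}
  [NormedAddCommGroup V] [InnerProductSpace ℝ V] (R : SimpleRoots cs V)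

/-- The subword of the letters marked with `true`. -/
def taken (L : List (B × Bool)) : List B := (L.filter Prod.snd).map Prod.fst

@[simp]
theorem taken_nil : taken ([] : List (B × Bool)) = [] := rfl

@[simp]
theorem taken_cons_true (s : B) (L : List (B × Bool)) : taken ((s, true) :: L) = s :: taken L := by
  simp [taken]

@[simp]
theorem taken_cons_false (s : B) (L : List (B × Bool)) : taken ((s, false) :: L) = taken L := by
  simp [taken]

@[simp]
theorem taken_append (L L' : List (B × Bool)) : taken (L ++ L') = taken L ++ taken L' := by
  simp [taken]

theorem taken_subset (L : List (B × Bool)) : taken L ⊆ L.map Prod.fst :=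
  List.map_subset _ fun _ h => List.mem_of_mem_filter h

theorem taken_map_true (u : List B) : taken (u.map fun s => (s, true)) = u := by
  induction u with
  | nil => rfl
  | cons s u ih => rw [List.map_cons, taken_cons_true, ih]

/-- The letters skipped in the marked word are orthogonal to the letters that are taken later. -/
def OrthoSkips : List (B × Bool) → Prop
  | [] => True
  | (s, e) :: l => (e = false → ∀ t ∈ taken l, ⟪R.root s, R.root t⟫ = 0) ∧ OrthoSkips l

/-- The marked version of `Steps`. -/
inductive Run : List B → List (B × Bool) → List B → Prop
  | refl (a : List B) : Run a [] a
  | take {s : B} {a b : List B} {l : List (B × Bool)} : Run (a ++ [s]) l b →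
      Run (s :: a) ((s, true) :: l) b
  | skip {s : B} {a b : List B} {l : List (B × Bool)} : Run a l b →
      Run (s :: a) ((s, false) :: l) b

variable {R}

theorem OrthoSkips.append_right {l l' : List (B × Bool)} (h : OrthoSkips R (l ++ l')) :
    OrthoSkips R l' := by
  induction l with
  | nil => exact h
  | cons p l ih => exact ih h.2

theorem OrthoSkips.append_left {l l' : List (B × Bool)} (h : OrthoSkips R (l ++ l')) :
    OrthoSkips R l := by
  induction l with
  | nil => trivial
  | cons p l ih => exact ⟨fun he t ht => h.1 he t (by simp [ht]), ih h.2⟩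

theorem Run.steps {a b : List B} {l : List (B × Bool)} (h : Run a l b) :
    Steps a (l.map Prod.fst) (taken l) b := by
  induction h with
  | refl => exact .refl _
  | take _ ih => rw [taken_cons_true]; exact .take ih
  | skip _ ih => rw [taken_cons_false]; exact .skip ih

theorem Run.exists_of_append {a b : List B} {l l' : List (B × Bool)} (h : Run a (l ++ l') b) :
    ∃ d, Run a l d ∧ Run d l' b := by
  induction l generalizing a with
  | nil => exact ⟨a, .refl a, h⟩
  | cons p l ih =>
    cases h with
    | take h =>
      obtain ⟨d, h1, h2⟩ := ih h
      exact ⟨d, .take h1, h2⟩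
    | skip h =>
      obtain ⟨d, h1, h2⟩ := ih h
      exact ⟨d, .skip h1, h2⟩

/-- The letters after a given `s` are the rest of the queue, followed by the word that the run takes
from this `s` on. All estimates split `Q` in this way. -/
theorem Run.exists_of_append_cons {a : List B} {s : B} {e : Bool} {l l' : List (B × Bool)}
    (h : Run a (l ++ (s, e) :: l') []) : ∃ d, Run a l (s :: d) ∧
      l'.map Prod.fst = d ++ taken ((s, e) :: l') := by
  obtain ⟨d, h1, h2⟩ := h.exists_of_append
  have h3 := h2.steps.append_eq
  cases h2 with
  | take h2 => exact ⟨_, h1, by simpa using h3⟩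
  | skip h2 => exact ⟨_, h1, by simpa using h3⟩

/-- A letter that is still active at the end has not been skipped. -/
theorem Run.ne_of_mem {a b : List B} {l : List (B × Bool)} (h : Run a l b) (ha : a.Nodup) {s : B}
    (hs : s ∈ b) : ∀ r, (r, false) ∈ l → r ≠ s := by
  induction h with
  | refl => simp
  | take _ ih =>
    intro r hr
    exact ih ((List.perm_append_singleton _ _).nodup_iff.2 ha) hs r (by simpa using hr)
  | @skip t a b l h ih =>
    obtain ⟨h1, h2⟩ := List.nodup_cons.1 ha
    intro r hr
    rcases List.mem_cons.1 hr with hr | hr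
    · obtain rfl : r = t := congrArg Prod.fst hr
      rintro rfl
      exact h1 (h.steps.subset hs)
    · exact ih h2 hs r hr

/-- An active letter is read later, if no letter stays active. -/
theorem Run.exists_next {a : List B} {l : List (B × Bool)} (h : Run a l []) {s : B} (hs : s ∈ a) :
    ∃ l₁ e l₂, l = l₁ ++ (s, e) :: l₂ ∧ s ∉ taken l₁ := by
  generalize hb : ([] : List B) = b at h
  induction h with
  | refl => subst hb; simp at hs
  | @take t a b l h ih =>
    by_cases hst : s = t
    · subst hst
      exact ⟨[], true, l, rfl, by simp⟩
    · obtain ⟨l₁, e, l₂, rfl, h2⟩ := ih (by simpa [hst] using hs) hb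
      exact ⟨(t, true) :: l₁, e, l₂, rfl, by simp [hst, h2]⟩
  | @skip t a b l h ih =>
    by_cases hst : s = t
    · subst hst
      exact ⟨[], false, l, rfl, by simp⟩
    · obtain ⟨l₁, e, l₂, rfl, h2⟩ := ih (by simpa [hst] using hs) hb
      exact ⟨(t, false) :: l₁, e, l₂, rfl, by simp [h2]⟩

theorem Run.exists_of_taken_eq {a b : List B} {l : List (B × Bool)} (h : Run a l b) {w₁ w₂ : List B}
    {s : B} (hw : taken l = w₁ ++ s :: w₂) :
    ∃ l₁ l₂ d, l = l₁ ++ l₂ ∧ taken l₁ = w₁ ++ [s] ∧ s ∈ d ∧ Run d l₂ b := by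
  induction h generalizing w₁ with
  | refl => simp at hw
  | @take t a b l h ih =>
    rw [taken_cons_true] at hw
    cases w₁ with
    | nil =>
      obtain ⟨rfl, -⟩ := List.cons.inj hw
      exact ⟨[(t, true)], l, _, rfl, rfl, by simp, h⟩
    | cons r w₁ =>
      obtain ⟨rfl, hw'⟩ := List.cons.inj hw
      obtain ⟨l₁, l₂, d, rfl, h2, h3⟩ := ih (w₁ := w₁) hw'
      exact ⟨(t, true) :: l₁, l₂, d, rfl, by simp [h2], h3⟩
  | @skip t a b l h ih =>
    obtain ⟨l₁, l₂, d, rfl, h2, h3⟩ := ih (by simpa using hw)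
    exact ⟨(t, false) :: l₁, l₂, d, rfl, by simpa using h2, h3⟩

theorem Greedy.exists_run {c q₀ u b q w : List B} (hc : c.Nodup) (h₀ : Steps c q₀ u b)
    (hu : cs.IsReduced u) (h : Greedy R (cs.wordProd u) b q w) :
    ∃ l, l.map Prod.fst = q ∧ taken l = w ∧ Run b l [] ∧ OrthoSkips R l := by
  generalize hx : cs.wordProd u = x at h
  induction h generalizing q₀ u with
  | nil => exact ⟨[], rfl, rfl, .refl _, trivial⟩
  | @take x s a q w hs h ih =>
    subst hx
    obtain ⟨l, h1, h2, h3, h4⟩ := ih (u := u ++ [s]) (h₀.trans (.take (.refl _)))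
      ((isReduced_concat_iff R hu).2 hs) (by rw [cs.wordProd_append, cs.wordProd_singleton])
    exact ⟨(s, true) :: l, by simp [h1], by simp [h2], .take h3, by simp, h4⟩
  | @skip x s a q w hs h ih =>
    subst hx
    obtain ⟨l, h1, h2, h3, h4⟩ := ih (u := u) (by simpa using h₀.trans (.skip (.refl _))) hu rfl
    exact ⟨(s, false) :: l, by simp [h1], by simp [h2], .skip h3,
      fun _ => h2 ▸ h.inner_eq_zero_of_skip hc h₀ hu hs, h4⟩

theorem BruhatLE.trans {x y z : W} (h : BruhatLE R x y) (h' : BruhatLE R y z) : BruhatLE R x z :=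
  Relation.ReflTransGen.trans h h'

theorem bruhatLE_wordProd_taken {L : List (B × Bool)} (hr : cs.IsReduced (L.map Prod.fst)) :
    BruhatLE R (cs.wordProd (taken L)) (cs.wordProd (L.map Prod.fst)) := by
  induction L using List.reverseRecOn with
  | nil => exact .refl
  | append_singleton L p ih =>
    obtain ⟨s, e⟩ := p
    rw [List.map_append, List.map_singleton] at hr ⊢
    have h1 := ih (isReduced_append_left hr)
    have h2 := bruhatLE_mul_simple (R := R) (isNonneg_of_isReduced_concat R hr)
    rw [cs.wordProd_append, cs.wordProd_singleton]
    cases e with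
    | true =>
      simp only [taken_append, taken_cons_true, taken_nil, cs.wordProd_append,
        cs.wordProd_singleton]
      exact h1.mul_simple_le h2 .refl
    | false =>
      simp only [taken_append, taken_cons_false, taken_nil, List.append_nil]
      exact h1.trans h2

/-- Along a marked word with orthogonal skips, all subwords stay above the skeleton. -/
theorem OrthoSkips.bruhatLE {l l' L : List (B × Bool)} (h : OrthoSkips R (l ++ l'))
    (hr : cs.IsReduced (taken (l ++ l'))) (hL : L.map Prod.fst = l.map Prod.fst) {g : W}
    (hg : BruhatLE R (cs.wordProd (taken (l ++ l')))⁻¹ g) :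
    BruhatLE R (cs.wordProd (taken l'))⁻¹ (g * cs.wordProd (taken L)) := by
  induction l generalizing L g with
  | nil =>
    obtain rfl : L = [] := by simpa using hL
    simpa using hg
  | cons p l ih =>
    obtain ⟨s, e⟩ := p
    cases L with
    | nil => simp at hL
    | cons p' L =>
      obtain ⟨s', e'⟩ := p'
      rw [List.map_cons, List.map_cons, List.cons.injEq] at hL
      obtain ⟨rfl : s' = s, hL⟩ := hL
      -- Whether or not the subword uses the letter, the bound persists. A letter taken by the
      -- skeleton is removed from the bound by lifting; a skipped one is an ascent of the bound, by
      -- orthogonality.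
      have key : BruhatLE R (cs.wordProd (taken (l ++ l')))⁻¹ g ∧
          BruhatLE R (cs.wordProd (taken (l ++ l')))⁻¹ (g * cs.simple s') := by
        cases e with
        | true =>
          rw [List.cons_append, taken_cons_true] at hr hg
          have h1 := bruhatLE_mul_simple (R := R) (isNonneg_of_isReduced_cons R hr)
          rw [cs.wordProd_cons, mul_inv_rev, cs.inv_simple] at hg
          exact ⟨BruhatLE.trans h1 hg, hg.le_mul_simple h1
            (by rw [mul_assoc, cs.simple_mul_simple_self, mul_one]; exact .refl)⟩
        | false =>
          rw [List.cons_append, taken_cons_false] at hg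
          refine ⟨hg, hg.le_mul_simple .refl (bruhatLE_mul_simple ?_)⟩
          rw [act_wordProd_inv_of_forall_inner_eq_zero R fun t ht => ?_]
          · exact isNonneg_root R s'
          · rw [real_inner_comm]
            exact h.1 rfl t ht
      have hr' : cs.IsReduced (taken (l ++ l')) := by
        cases e with
        | true =>
          rw [List.cons_append, taken_cons_true] at hr
          exact isReduced_append_right (u := [s']) hr
        | false => simpa using hr
      cases e' with
      | true =>
        rw [taken_cons_true, cs.wordProd_cons, ← mul_assoc]
        exact ih h.2 hr' hL key.2
      | false =>
        rw [taken_cons_false]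
        exact ih h.2 hr' hL key.1

/-- Transports a Bruhat bound from the end of a reduced word back to its beginning, whichever
letters the subword uses. -/
theorem bruhatLE_of_wordProd {u : List B} {L : List (B × Bool)}
    (hr : cs.IsReduced (u ++ L.map Prod.fst)) {g : W}
    (hg : BruhatLE R (cs.wordProd (u ++ L.map Prod.fst)) (g * cs.wordProd (taken L))) :
    BruhatLE R (cs.wordProd u) g := by
  induction L generalizing u g with
  | nil => simpa using hg
  | cons p L ih =>
    obtain ⟨s, e⟩ := p
    have h1 : u ++ ((s, e) :: L).map Prod.fst = (u ++ [s]) ++ L.map Prod.fst := by simp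
    rw [h1] at hr hg
    have h2 := bruhatLE_mul_simple (R := R)
      (isNonneg_of_isReduced_concat R (isReduced_append_left hr))
    cases e with
    | true =>
      rw [taken_cons_true, cs.wordProd_cons, ← mul_assoc] at hg
      have h3 := ih hr hg
      rw [cs.wordProd_append, cs.wordProd_singleton] at h3
      have h4 := h3.le_mul_simple h2
        (by rw [mul_assoc, cs.simple_mul_simple_self, mul_one]; exact .refl)
      rwa [mul_assoc, cs.simple_mul_simple_self, mul_one] at h4
    | false =>
      rw [taken_cons_false] at hg
      have h3 := ih hr hg
      rw [cs.wordProd_append, cs.wordProd_singleton] at h3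
      exact BruhatLE.trans h2 h3

section Weights

variable [Fintype B]

/-- The skipped letters of a subword do not contribute to its action on a fundamental weight. -/
theorem OrthoSkips.exists_act_weight {l L : List (B × Bool)} (h : OrthoSkips R l)
    (hL : L.map Prod.fst = l.map Prod.fst) {s : B} (hs : ∀ r, (r, false) ∈ l → r ≠ s) :
    ∃ L' : List (B × Bool), L'.map Prod.fst = taken l ∧
      R.act (cs.wordProd (taken L)) (weight R s) = R.act (cs.wordProd (taken L')) (weight R s) := by
  induction l generalizing L with
  | nil =>
    obtain rfl : L = [] := by simpa using hL
    exact ⟨[], rfl, rfl⟩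
  | cons p l ih =>
    obtain ⟨r, e⟩ := p
    cases L with
    | nil => simp at hL
    | cons p' L =>
      obtain ⟨r', e'⟩ := p'
      rw [List.map_cons, List.map_cons, List.cons.injEq] at hL
      obtain ⟨rfl : r' = r, hL⟩ := hL
      obtain ⟨L', h1, h2⟩ := ih h.2 hL fun r hr => hs r (by simp [hr])
      cases e with
      | true =>
        refine ⟨(r', e') :: L', by simp [h1], ?_⟩
        cases e' with
        | true => simp only [taken_cons_true, cs.wordProd_cons, act_mul_apply, h2]
        | false => simpa using h2
      | false =>
        -- A letter skipped by the skeleton but used by `L` commutes past the later letters and then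
        -- fixes `ω_s`.
        refine ⟨L', by simp [h1], ?_⟩
        cases e' with
        | true =>
          rw [taken_cons_true, cs.wordProd_cons, act_mul_apply, h2, ← act_mul_apply,
            simple_mul_wordProd_comm R fun t ht => h.1 rfl t (h1 ▸ taken_subset L' ht),
            act_mul_apply, act_simple_weight_of_ne R (hs r' (by simp))]
        | false => simpa using h2

/-- Two opposite inequalities against all dominant vectors: one from the bound on `g`, whose inverse
agrees with `L` on `ω_s`, the other because `L` acts on `ω_s` like a subword of the skeleton. -/
theorem OrthoSkips.act_weight_eq {l L : List (B × Bool)} (h : OrthoSkips R l)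
    (hr : cs.IsReduced (taken l)) (hL : L.map Prod.fst = l.map Prod.fst) {s : B}
    (hs : ∀ r, (r, false) ∈ l → r ≠ s) {g : W} (hg : BruhatLE R (cs.wordProd (taken l))⁻¹ g)
    (hgs : R.act (g * cs.wordProd (taken L)) (weight R s) = weight R s) :
    R.act (cs.wordProd (taken L)) (weight R s) = R.act (cs.wordProd (taken l)) (weight R s) := by
  refine eq_of_forall_inner_isDominant R fun d hd => le_antisymm ?_ ?_
  · have h1 := hg.inner_le (isDominant_weight R s) hd
    have h2 : R.act g⁻¹ (weight R s) = R.act (cs.wordProd (taken L)) (weight R s) := by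
      conv_lhs => rw [← hgs, act_mul_apply, act_inv_apply_apply]
    rwa [inner_act_right, inner_act_right, inv_inv, h2] at h1
  · obtain ⟨L', h1, h2⟩ := h.exists_act_weight hL hs
    rw [h2, real_inner_comm d, real_inner_comm d]
    have h3 := bruhatLE_wordProd_taken (R := R) (L := L') (by rwa [h1])
    rw [h1] at h3
    exact h3.inner_le hd (isDominant_weight R s)

/-- The same sandwich: `g` lies above the product of `u`, while its inverse acts on `ω_s` like that
of some `X` below it. -/
theorem act_inv_weight_eq {u : List B} {L : List (B × Bool)}
    (hr : cs.IsReduced (u ++ L.map Prod.fst)) {g X : W} {s : B} (hX : BruhatLE R X (cs.wordProd u))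
    (hgX : R.act g⁻¹ (weight R s) = R.act X⁻¹ (weight R s))
    (hg : BruhatLE R (cs.wordProd (u ++ L.map Prod.fst)) (g * cs.wordProd (taken L))) :
    R.act g⁻¹ (weight R s) = R.act (cs.wordProd u)⁻¹ (weight R s) := by
  refine eq_of_forall_inner_isDominant R fun d hd => le_antisymm ?_ ?_
  · rw [← inner_act_right, ← inner_act_right]
    exact (bruhatLE_of_wordProd hr hg).inner_le (isDominant_weight R s) hd
  · rw [hgX, ← inner_act_right, ← inner_act_right]
    exact hX.inner_le (isDominant_weight R s) hd

end Weights

end Marked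


/-! ### Comparing brick vectors weight by weight -/

section Bounds

variable {B W V : Type*} [Group W] {M : CoxeterMatrix B} {cs : CoxeterSystem M W}
  [NormedAddCommGroup V] [InnerProductSpace ℝ V] (R : SimpleRoots cs V)

/-- The word with all letters marked. -/
def allTaken (u : List B) : List (B × Bool) := u.map fun s => (s, true)

theorem taken_cons (p : B × Bool) (L : List (B × Bool)) : taken (p :: L) = taken [p] ++ taken L := by
  rw [← taken_append, List.singleton_append]

theorem taken_allTaken (u : List B) : taken (allTaken u) = u := taken_map_true u

theorem inv_wordProd_taken_cons_mul (p : B × Bool) (l : List (B × Bool)) :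
    (cs.wordProd (taken (p :: l)))⁻¹ * cs.wordProd (taken [p]) = (cs.wordProd (taken l))⁻¹ := by
  rw [taken_cons, cs.wordProd_append]
  group

theorem isReduced_taken_of_append {l l' : List (B × Bool)} (h : cs.IsReduced (taken (l ++ l'))) :
    cs.IsReduced (taken l) ∧ cs.IsReduced (taken l') := by
  rw [taken_append] at h
  exact ⟨isReduced_append_left h, isReduced_append_right h⟩

variable [Fintype B]

/-- The brick vector of a marked word, with the initial element `g`. -/
noncomputable def brickSum : W → List (B × Bool) → V
  | _, [] => 0
  | g, p :: L => R.act g (weight R p.1) + brickSum (g * cs.wordProd (taken [p])) L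

/-- The sum of the fundamental weights of the letters of a word. -/
noncomputable def weightListSum (b : List B) : V := (b.map (weight R)).sum

theorem brickSum_append (g : W) (L L' : List (B × Bool)) :
    brickSum R g (L ++ L') = brickSum R g L + brickSum R (g * cs.wordProd (taken L)) L' := by
  induction L generalizing g with
  | nil => simp [brickSum]
  | cons p L ih =>
    rw [List.cons_append, brickSum, brickSum, ih, taken_cons p L, cs.wordProd_append, mul_assoc,
      add_assoc]

theorem brickSum_mul (g h : W) (L : List (B × Bool)) :
    brickSum R (g * h) L = R.act g (brickSum R h L) := by
  induction L generalizing h with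
  | nil => simp [brickSum]
  | cons p L ih => rw [brickSum, brickSum, map_add, act_mul_apply, mul_assoc, ih]

variable {R}

theorem OrthoSkips.inner_brickSum_le {l L : List (B × Bool)} (h : OrthoSkips R l)
    (hr : cs.IsReduced (taken l)) (hL : L.map Prod.fst = l.map Prod.fst) {g : W}
    (hg : BruhatLE R (cs.wordProd (taken l))⁻¹ g) {v : V} (hv : IsDominant R v) :
    ⟪v, brickSum R g L⟫ ≤ ⟪v, brickSum R (cs.wordProd (taken l))⁻¹ l⟫ := by
  induction l generalizing L g with
  | nil =>
    obtain rfl : L = [] := by simpa using hL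
    exact le_rfl
  | cons p l ih =>
    cases L with
    | nil => simp at hL
    | cons p' L =>
      rw [List.map_cons, List.map_cons, List.cons.injEq] at hL
      obtain ⟨hp, hL⟩ := hL
      rw [brickSum, brickSum, inner_add_right, inner_add_right, inv_wordProd_taken_cons_mul, hp]
      refine add_le_add (hg.inner_le hv (isDominant_weight R _)) ?_
      exact ih h.2 (isReduced_taken_of_append (l := [p]) hr).2 hL
        (OrthoSkips.bruhatLE (l := [p]) (L := [p']) h hr (by simp [hp]) hg)

theorem OrthoSkips.inner_brickSum_eq {l L : List (B × Bool)} (h : OrthoSkips R l)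
    (hr : cs.IsReduced (taken l)) (hL : L.map Prod.fst = l.map Prod.fst) {g : W}
    (hg : BruhatLE R (cs.wordProd (taken l))⁻¹ g) {s : B} (hs : ∀ r, (r, false) ∈ l → r ≠ s)
    (hgs : R.act (g * cs.wordProd (taken L)) (weight R s) = weight R s) :
    ⟪weight R s, brickSum R g L⟫ = ⟪weight R s, brickSum R (cs.wordProd (taken l))⁻¹ l⟫ := by
  induction l generalizing L g with
  | nil =>
    obtain rfl : L = [] := by simpa using hL
    rfl
  | cons p l ih =>
    cases L with
    | nil => simp at hL
    | cons p' L =>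
      have h1 := h.act_weight_eq hr hL hs hg hgs
      rw [List.map_cons, List.map_cons, List.cons.injEq] at hL
      obtain ⟨hp, hL⟩ := hL
      rw [brickSum, brickSum, inner_add_right, inner_add_right, inv_wordProd_taken_cons_mul, hp]
      congr 1
      · have h2 : R.act g⁻¹ (weight R s) = R.act (cs.wordProd (taken (p' :: L))) (weight R s) := by
          conv_lhs => rw [← hgs, act_mul_apply, act_inv_apply_apply]
        rw [inner_act_right, inner_act_right, inv_inv, h2, h1]
      · refine ih h.2 (isReduced_taken_of_append (l := [p]) hr).2 hL
          (OrthoSkips.bruhatLE (l := [p]) (L := [p']) h hr (by simp [hp]) hg)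
          (fun r hr => hs r (by simp [hr])) ?_
        rw [mul_assoc, ← cs.wordProd_append, ← taken_cons]
        exact hgs

theorem inner_brickSum_le_weightListSum (L : List (B × Bool)) (g : W) {v : V}
    (hv : IsDominant R v) : ⟪v, brickSum R g L⟫ ≤ ⟪v, weightListSum R (L.map Prod.fst)⟫ := by
  induction L generalizing g with
  | nil => exact le_rfl
  | cons p L ih =>
    rw [brickSum, weightListSum, List.map_cons, List.map_cons, List.sum_cons, inner_add_right,
      inner_add_right]
    refine add_le_add ?_ (ih _)
    have := (bruhatLE_one_left R g).inner_le hv (isDominant_weight R p.1)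
    rwa [act_one_apply] at this

theorem inner_brickSum_eq_weightListSum (L : List (B × Bool)) (g : W) {s : B} (hs : s ∉ taken L)
    (hg : R.act g⁻¹ (weight R s) = weight R s) :
    ⟪weight R s, brickSum R g L⟫ = ⟪weight R s, weightListSum R (L.map Prod.fst)⟫ := by
  induction L generalizing g with
  | nil => rfl
  | cons p L ih =>
    rw [taken_cons, List.mem_append, not_or] at hs
    rw [brickSum, weightListSum, List.map_cons, List.map_cons, List.sum_cons, inner_add_right,
      inner_add_right, inner_act_right, hg, ih _ hs.2, weightListSum]
    rw [mul_inv_rev, act_mul_apply, hg, act_wordProd_inv_weight_of_notMem R hs.1]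

/-- Only the final product is assumed to be bounded; reading backwards bounds every prefix product
and hence every weight. -/
theorem inner_brickSum_le_of_bruhatLE {u : List B} {L : List (B × Bool)}
    (hr : cs.IsReduced (u ++ L.map Prod.fst)) {g : W}
    (hg : BruhatLE R (cs.wordProd (u ++ L.map Prod.fst)) (g * cs.wordProd (taken L)))
    {v : V} (hv : IsDominant R v) :
    ⟪v, brickSum R g L⟫ ≤ ⟪v, brickSum R (cs.wordProd u) (allTaken (L.map Prod.fst))⟫ := by
  induction L generalizing u g with
  | nil => exact le_rfl
  | cons p L ih =>
    have h1 := bruhatLE_of_wordProd hr hg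
    rw [allTaken, List.map_cons, List.map_cons, brickSum, brickSum, inner_add_right,
      inner_add_right]
    refine add_le_add (h1.inner_le hv (isDominant_weight R _)) ?_
    have h2 : u ++ (p :: L).map Prod.fst = (u ++ [p.1]) ++ L.map Prod.fst := by simp
    rw [h2] at hr hg
    rw [taken_cons, cs.wordProd_append (taken [p]), ← mul_assoc] at hg
    have h3 := ih hr hg
    rw [cs.wordProd_append] at h3
    simpa [allTaken] using h3

theorem inner_brickSum_eq_of_bruhatLE {u : List B} {L : List (B × Bool)}
    (hr : cs.IsReduced (u ++ L.map Prod.fst)) {g X : W} {s : B} (hX : BruhatLE R X (cs.wordProd u))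
    (hgX : R.act g⁻¹ (weight R s) = R.act X⁻¹ (weight R s))
    (hg : BruhatLE R (cs.wordProd (u ++ L.map Prod.fst)) (g * cs.wordProd (taken L))) :
    ⟪weight R s, brickSum R g L⟫ =
      ⟪weight R s, brickSum R (cs.wordProd u) (allTaken (L.map Prod.fst))⟫ := by
  induction L generalizing u g X with
  | nil => rfl
  | cons p L ih =>
    have h1 := act_inv_weight_eq hr hX hgX hg
    rw [allTaken, List.map_cons, List.map_cons, brickSum, brickSum, inner_add_right,
      inner_add_right]
    congr 1
    · rw [inner_act_right, inner_act_right, h1]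
    have h2 : u ++ (p :: L).map Prod.fst = (u ++ [p.1]) ++ L.map Prod.fst := by simp
    rw [h2] at hr hg
    rw [taken_cons, cs.wordProd_append (taken [p]), ← mul_assoc] at hg
    have h4 := bruhatLE_mul_simple (R := R)
      (isNonneg_of_isReduced_concat R (isReduced_append_left hr))
    have h3 := ih (X := X * cs.wordProd (taken [p])) hr ?_ ?_ hg
    · rw [cs.wordProd_append] at h3
      simpa [allTaken] using h3
    · rw [cs.wordProd_append, cs.wordProd_singleton]
      obtain ⟨t, e⟩ := p
      cases e with
      | true => simpa using hX.mul_simple_le h4 .refl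
      | false => simpa using BruhatLE.trans hX h4
    · rw [mul_inv_rev, mul_inv_rev, act_mul_apply, act_mul_apply, hgX]

/-- A skipped letter never returns, so the later letters fix its weight, which can be moved to the
end of the run. A taken letter leaves the queue as a multiset unchanged. -/
theorem Run.brickSum_add {a b : List B} {l : List (B × Bool)} (h : Run a l b) (ha : a.Nodup)
    (g : W) : brickSum R g l + R.act (g * cs.wordProd (taken l)) (weightListSum R b) =
      brickSum R g (allTaken (taken l)) +
        R.act (g * cs.wordProd (taken l)) (weightListSum R a) := by
  induction h generalizing g with
  | refl => rfl
  | @take s a b l h ih =>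
    have h1 := ih ((List.perm_append_singleton _ _).nodup_iff.2 ha) (g * cs.simple s)
    rw [taken_cons_true, cs.wordProd_cons, ← mul_assoc]
    simp only [allTaken, List.map_cons, brickSum, taken_cons_true, taken_nil,
      cs.wordProd_singleton, add_assoc] at h1 ⊢
    rw [h1]
    simp only [weightListSum, List.map_append, List.map_cons, List.map_nil, List.sum_append,
      List.sum_cons, List.sum_nil, add_zero]
    rw [add_comm (weight R s)]
  | @skip s a b l h ih =>
    obtain ⟨hs, ha⟩ := List.nodup_cons.1 ha
    have h1 := ih ha g
    have hsl : s ∉ taken l := fun h' => hs (h.steps.word_subset h')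
    rw [taken_cons_false, brickSum, taken_cons_false, taken_nil, cs.wordProd_nil, mul_one,
      add_assoc, h1, weightListSum, weightListSum, List.map_cons, List.sum_cons, map_add,
      act_mul_apply R g _ (weight R s), act_wordProd_weight_of_notMem R hsl]
    abel

end Bounds


/-! ### Facet inequalities indexed by the positions of `Q` -/

section Positions

variable {B W V : Type*} [Group W] [Finite W] {M : CoxeterMatrix B}
  {cs : CoxeterSystem M W} [NormedAddCommGroup V] [InnerProductSpace ℝ V] (R : SimpleRoots cs V)

theorem allTaken_append (u v : List B) : allTaken (u ++ v) = allTaken u ++ allTaken v :=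
  List.map_append

theorem longestElement_mul_self [Fintype B] (R : SimpleRoots cs V) :
    longestElement cs * longestElement cs = 1 := by
  have h : (longestElement cs)⁻¹ = longestElement cs := by
    refine eq_longestElement R fun s => isNonneg_neg_act_root R ?_
    have h1 := length_le_length_longestElement cs ((longestElement cs)⁻¹ * cs.simple s)
    have h2 := cs.length_mul_simple_ne (longestElement cs)⁻¹ s
    rw [CoxeterSystem.IsRightDescent]
    rw [cs.length_inv] at h2 ⊢
    omega
  nth_rewrite 1 [← h]
  exact inv_mul_cancel (longestElement cs)

/-- The greedy marked word: reading its letters off the Coxeter word `c` and taking the marked ones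
yields a reduced word of the longest element, and the skipped letters are orthogonal to the letters
that are taken later. -/
structure Skeleton (c : List B) (l : List (B × Bool)) : Prop where
  nodup : c.Nodup
  run : Run c l []
  orthoSkips : OrthoSkips R l
  isReduced : cs.IsReduced (taken l)
  wordProd_eq : cs.wordProd (taken l) = longestElement cs

variable {R}

namespace Skeleton

variable {c : List B} {l l₁ l₂ : List (B × Bool)} {s : B} {e : Bool}

theorem exists_active (S : Skeleton R c l) (hl : l = l₁ ++ (s, e) :: l₂) :
    ∃ d, Run c l₁ (s :: d) ∧ s ∉ d ∧ l₂.map Prod.fst = d ++ taken ((s, e) :: l₂) := by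
  have h := S.run
  rw [hl] at h
  obtain ⟨d, h1, h2⟩ := h.exists_of_append_cons
  exact ⟨d, h1, (List.nodup_cons.1 (h1.steps.nodup S.nodup)).1, h2⟩

theorem isReduced_left (S : Skeleton R c l) (hl : l = l₁ ++ (s, e) :: l₂) :
    cs.IsReduced (taken l₁) :=
  (isReduced_taken_of_append (hl ▸ S.isReduced)).1

theorem isReduced_right (S : Skeleton R c l) (hl : l = l₁ ++ (s, e) :: l₂) :
    cs.IsReduced (taken ((s, e) :: l₂)) :=
  (isReduced_taken_of_append (hl ▸ S.isReduced)).2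

theorem orthoSkips_left (S : Skeleton R c l) (hl : l = l₁ ++ (s, e) :: l₂) : OrthoSkips R l₁ :=
  OrthoSkips.append_left (hl ▸ S.orthoSkips)

theorem wordProd_right (S : Skeleton R c l) (hl : l = l₁ ++ (s, e) :: l₂) :
    cs.wordProd (taken ((s, e) :: l₂)) = (cs.wordProd (taken l₁))⁻¹ * longestElement cs := by
  rw [← S.wordProd_eq, hl, taken_append, cs.wordProd_append, inv_mul_cancel_left]

theorem exists_split (hl : l = l₁ ++ (s, e) :: l₂) {d : List B}
    (hd : l₂.map Prod.fst = d ++ taken ((s, e) :: l₂)) {L : List (B × Bool)}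
    (hL : L.map Prod.fst = l.map Prod.fst) :
    ∃ L₁ e' Ld L₂, L = L₁ ++ (s, e') :: (Ld ++ L₂) ∧ L₁.map Prod.fst = l₁.map Prod.fst ∧
      Ld.map Prod.fst = d ∧ L₂.map Prod.fst = taken ((s, e) :: l₂) := by
  rw [hl, List.map_append, List.map_cons, hd] at hL
  obtain ⟨L₁, L', rfl, h1, h2⟩ := List.map_eq_append_iff.1 hL
  obtain ⟨⟨s', e'⟩, L'', rfl, h3, h4⟩ := List.map_eq_cons_iff.1 h2
  obtain ⟨Ld, L₂, rfl, h5, h6⟩ := List.map_eq_append_iff.1 h4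
  obtain rfl : s' = s := h3
  exact ⟨L₁, e', Ld, L₂, rfl, h1, h5, h6⟩

theorem bruhatLE_right (S : Skeleton R c l) (hl : l = l₁ ++ (s, e) :: l₂)
    {L₁ Ls L₂ : List (B × Bool)} (h₂ : L₂.map Prod.fst = taken ((s, e) :: l₂))
    (hw : cs.wordProd (taken (L₁ ++ Ls ++ L₂)) = longestElement cs) :
    BruhatLE R (cs.wordProd ([] ++ L₂.map Prod.fst)) ((cs.wordProd (taken l₁))⁻¹ *
      cs.wordProd (taken L₁) * cs.wordProd (taken Ls) * cs.wordProd (taken L₂)) := by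
  rw [List.nil_append, h₂, S.wordProd_right hl, ← hw, taken_append, taken_append,
    cs.wordProd_append, cs.wordProd_append]
  simp only [mul_assoc]
  exact .refl

variable [Fintype B]

/-- The bounds for the three pieces of `Q` add up to the constant of the facet inequality:
`brickSum_add` trades the prefix with its queue for the taken prefix with all of `c`. -/
theorem brickSum_identity (S : Skeleton R c l) (hl : l = l₁ ++ (s, e) :: l₂) {d : List B}
    (hd : Run c l₁ (s :: d)) :
    brickSum R (cs.wordProd (taken l₁))⁻¹ l₁ + weightListSum R (s :: d) +
      brickSum R 1 (allTaken (taken ((s, e) :: l₂))) =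
    brickSum R (cs.wordProd (taken l₁))⁻¹ (allTaken (taken l)) + weightListSum R c := by
  have h := hd.brickSum_add (R := R) S.nodup (cs.wordProd (taken l₁))⁻¹
  rw [inv_mul_cancel, act_one_apply, act_one_apply] at h
  rw [h, hl, taken_append, allTaken_append, brickSum_append, taken_allTaken, inv_mul_cancel]
  abel

/-- Split `Q` into the prefix before `s`, the current queue, and a reduced word of `x⁻¹ w₀`. The
bounds come from the skeleton, from minimality of `1` in Bruhat order, and from the known final
product, respectively. -/
theorem inner_brickSum_le (S : Skeleton R c l) (hl : l = l₁ ++ (s, e) :: l₂)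
    {L : List (B × Bool)} (hL : L.map Prod.fst = l.map Prod.fst)
    (hw : cs.wordProd (taken L) = longestElement cs) {v : V} (hv : IsDominant R v) :
    ⟪v, brickSum R (cs.wordProd (taken l₁))⁻¹ L⟫ ≤
      ⟪v, brickSum R (cs.wordProd (taken l₁))⁻¹ (allTaken (taken l)) + weightListSum R c⟫ := by
  obtain ⟨d, h1, hsd, h2⟩ := S.exists_active hl
  obtain ⟨L₁, e', Ld, L₂, rfl, h3, h4, h5⟩ := exists_split hl h2 hL
  have h6 : L₁ ++ (s, e') :: (Ld ++ L₂) = L₁ ++ (s, e') :: Ld ++ L₂ := by simp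
  rw [h6] at hw ⊢
  have h7 := S.bruhatLE_right hl h5 hw
  rw [← S.brickSum_identity hl h1, brickSum_append, brickSum_append, inner_add_right,
    inner_add_right, inner_add_right, inner_add_right]
  refine add_le_add (add_le_add ?_ ?_) ?_
  · exact (S.orthoSkips_left hl).inner_brickSum_le (S.isReduced_left hl) h3 .refl hv
  · have := inner_brickSum_le_weightListSum (R := R) ((s, e') :: Ld)
      ((cs.wordProd (taken l₁))⁻¹ * cs.wordProd (taken L₁)) hv
    rwa [List.map_cons, h4] at this
  · rw [taken_append, cs.wordProd_append, ← mul_assoc]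
    have := inner_brickSum_le_of_bruhatLE (u := []) (L := L₂)
      (by rw [List.nil_append, h5]; exact S.isReduced_right hl) h7 hv
    rwa [h5, cs.wordProd_nil] at this

section Tight

variable {L₁ Ld L₂ : List (B × Bool)} {d : List B}

/-- The weight of a position outside of a subword for the longest element does not depend on the
subword. -/
theorem act_weight_eq (S : Skeleton R c l) (hl : l = l₁ ++ (s, e) :: l₂)
    (h₁ : L₁.map Prod.fst = l₁.map Prod.fst) (hd : Run c l₁ (s :: d)) (hsd : s ∉ d)
    (h₃ : Ld.map Prod.fst = d) (h₂ : L₂.map Prod.fst = taken ((s, e) :: l₂))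
    (hw : cs.wordProd (taken (L₁ ++ (s, false) :: Ld ++ L₂)) = longestElement cs) :
    R.act (cs.wordProd (taken L₁)) (weight R s) = R.act (cs.wordProd (taken l₁)) (weight R s) := by
  refine eq_of_forall_inner_isDominant R fun μ hμ => le_antisymm ?_ ?_
  -- Upper bound: `L₂` is a subword of the reduced tail, and testing against the dominant vector
  -- `-w₀ μ` turns this into a bound on the prefix.
  · have h4 : IsDominant R (-R.act (longestElement cs) μ) := isDominant_neg_act_longestElement R hμ
    have h5 := bruhatLE_wordProd_taken (R := R) (L := L₂) (by rw [h₂]; exact S.isReduced_right hl)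
    rw [h₂, S.wordProd_right hl] at h5
    have h6 := h5.inner_le (isDominant_weight R s) h4
    have h7 : cs.wordProd (taken L₂) = (cs.wordProd (taken Ld))⁻¹ * (cs.wordProd (taken L₁))⁻¹ *
        longestElement cs := by
      rw [← hw]
      simp [cs.wordProd_append, mul_assoc]
    have h8 : s ∉ taken Ld := fun h => hsd (h₃ ▸ taken_subset _ h)
    rw [h7] at h6
    simp only [map_neg, inner_neg_right, neg_le_neg_iff, ← act_mul_apply] at h6
    simp only [mul_assoc, longestElement_mul_self R, mul_one] at h6
    rw [act_mul_apply, inner_act_right, inv_inv, act_wordProd_weight_of_notMem R h8,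
      inner_act_right, inv_inv, inner_act_right, inv_inv] at h6
    exact h6
  -- Lower bound: on `ω_s` the prefix acts like a subword of the skeleton prefix.
  · obtain ⟨L', h4, h5⟩ := (S.orthoSkips_left hl).exists_act_weight h₁
      (hd.ne_of_mem S.nodup (s := s) (by simp))
    rw [h5, real_inner_comm μ, real_inner_comm μ]
    have h6 := bruhatLE_wordProd_taken (R := R) (L := L') (by rw [h4]; exact S.isReduced_left hl)
    rw [h4] at h6
    exact h6.inner_le hμ (isDominant_weight R s)

theorem inner_brickSum_eq (S : Skeleton R c l) (hl : l = l₁ ++ (s, e) :: l₂)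
    (h₁ : L₁.map Prod.fst = l₁.map Prod.fst) (hd : Run c l₁ (s :: d)) (hsd : s ∉ d)
    (h₃ : Ld.map Prod.fst = d) (h₂ : L₂.map Prod.fst = taken ((s, e) :: l₂))
    (hw : cs.wordProd (taken (L₁ ++ (s, false) :: Ld ++ L₂)) = longestElement cs) :
    ⟪weight R s, brickSum R (cs.wordProd (taken l₁))⁻¹ (L₁ ++ (s, false) :: Ld ++ L₂)⟫ =
      ⟪weight R s, brickSum R (cs.wordProd (taken l₁))⁻¹ (allTaken (taken l)) +
        weightListSum R c⟫ := by
  have h4 := S.act_weight_eq hl h₁ hd hsd h₃ h₂ hw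
  have h5 : R.act ((cs.wordProd (taken l₁))⁻¹ * cs.wordProd (taken L₁)) (weight R s) =
      weight R s := by
    rw [act_mul_apply, h4, act_inv_apply_apply]
  have h6 : R.act ((cs.wordProd (taken l₁))⁻¹ * cs.wordProd (taken L₁))⁻¹ (weight R s) =
      weight R s := by
    conv_lhs => rw [← h5]
    rw [act_inv_apply_apply]
  have h7 : s ∉ taken ((s, false) :: Ld) := by
    rw [taken_cons_false]
    exact fun h => hsd (h₃ ▸ taken_subset _ h)
  rw [← S.brickSum_identity hl hd, brickSum_append, brickSum_append, inner_add_right,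
    inner_add_right, inner_add_right, inner_add_right]
  congr 1
  · congr 1
    · exact (S.orthoSkips_left hl).inner_brickSum_eq (S.isReduced_left hl) h₁ .refl
        (hd.ne_of_mem S.nodup (s := s) (by simp)) h5
    · rw [inner_brickSum_eq_weightListSum _ _ h7 h6, List.map_cons, h₃]
  · rw [taken_append, cs.wordProd_append, ← mul_assoc]
    have := inner_brickSum_eq_of_bruhatLE (u := []) (L := L₂) (s := s) (X := 1)
      (by rw [List.nil_append, h₂]; exact S.isReduced_right hl) (bruhatLE_one_left R _)
      (by rw [mul_inv_rev, act_mul_apply, h6, act_wordProd_inv_weight_of_notMem R h7, inv_one,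
        act_one_apply]) (S.bruhatLE_right hl h₂ hw)
    rwa [h₂, cs.wordProd_nil] at this

/-- The action of `L₁` on `ω_s` agrees with that of the skeleton both from `t` on and after `t`. If
the skeleton takes `t`, its two vectors differ by the reflection in `t`, while those of `L₁`
coincide, so the reflection fixes the vector. If it skips `t`, orthogonality suffices. -/
theorem inner_root_left (S : Skeleton R c l) (hl : l = l₁ ++ (s, e) :: l₂)
    (h₁ : L₁.map Prod.fst = l₁.map Prod.fst) (hd : Run c l₁ (s :: d)) (hsd : s ∉ d)
    (h₃ : Ld.map Prod.fst = d) (h₂ : L₂.map Prod.fst = taken ((s, e) :: l₂))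
    (hw : cs.wordProd (taken (L₁ ++ (s, false) :: Ld ++ L₂)) = longestElement cs)
    {L₃ L₄ : List (B × Bool)} {t : B} (hL₁ : L₁ = L₃ ++ (t, false) :: L₄) :
    ⟪R.root t, R.act (cs.wordProd (taken L₄)) (weight R s)⟫ = 0 := by
  have h4 := S.act_weight_eq hl h₁ hd hsd h₃ h₂ hw
  have h5 : R.act ((cs.wordProd (taken l₁))⁻¹ * cs.wordProd (taken L₁)) (weight R s) =
      weight R s := by
    rw [act_mul_apply, h4, act_inv_apply_apply]
  have hne := hd.ne_of_mem S.nodup (s := s) (by simp)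
  have ho := S.orthoSkips_left hl
  have hr := S.isReduced_left hl
  obtain ⟨g, hg'⟩ : ∃ g, g = (cs.wordProd (taken l₁))⁻¹ := ⟨_, rfl⟩
  rw [← hg'] at h5
  have hg : BruhatLE R (cs.wordProd (taken l₁))⁻¹ g := hg' ▸ .refl
  have h6 := h₁
  rw [hL₁, List.map_append, List.map_cons] at h6
  obtain ⟨l₃, l', hl₁, h7, h8⟩ := List.map_eq_append_iff.1 h6.symm
  obtain ⟨⟨t', e'⟩, l₄, rfl, h9, h10⟩ := List.map_eq_cons_iff.1 h8
  obtain rfl : t' = t := h9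
  subst hl₁
  rw [hL₁, taken_append, taken_cons_false, cs.wordProd_append, ← mul_assoc] at h5
  have h11 := ho.bruhatLE hr h7.symm hg
  have ho' := ho.append_right
  have hr' := (isReduced_taken_of_append hr).2
  have h12 := OrthoSkips.bruhatLE (l := [(t', e')]) (L := [(t', false)]) ho' hr' (by simp) h11
  rw [taken_cons_false, taken_nil, cs.wordProd_nil, mul_one] at h12
  have h13 := ho'.2.act_weight_eq (isReduced_taken_of_append (l := [(t', e')]) hr').2 h10.symm
    (fun r hr => hne r (by simp [hr])) h12 h5
  cases e' with
  | true =>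
    have h14 := ho'.act_weight_eq (L := (t', false) :: L₄) hr' (by simp [h10])
      (fun r hr => hne r (by simp only [List.mem_append]; exact .inr hr)) h11
      (by rwa [taken_cons_false])
    rw [taken_cons_false, taken_cons_true, cs.wordProd_cons, act_mul_apply, ← h13] at h14
    exact inner_eq_zero_of_act_simple R h14.symm
  | false =>
    rw [h13, inner_act_right, act_wordProd_inv_of_forall_inner_eq_zero R fun r hr => ?_]
    · exact inner_root_weight_of_ne R (hne t' (by simp))
    · rw [real_inner_comm]
      exact ho'.1 rfl r hr

/-- For `t` in the queue, only letters other than `s` are involved. For `t` in the tail,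
`act_inv_weight_eq` before and after the omitted letter gives the same vector, which the reflection
in `t` therefore fixes. -/
theorem inner_root_right (S : Skeleton R c l) (hl : l = l₁ ++ (s, e) :: l₂)
    (h₁ : L₁.map Prod.fst = l₁.map Prod.fst) (hd : Run c l₁ (s :: d)) (hsd : s ∉ d)
    (h₃ : Ld.map Prod.fst = d) (h₂ : L₂.map Prod.fst = taken ((s, e) :: l₂))
    (hw : cs.wordProd (taken (L₁ ++ (s, false) :: Ld ++ L₂)) = longestElement cs)
    {L₃ L₄ : List (B × Bool)} {t : B} (hL₂ : Ld ++ L₂ = L₃ ++ (t, false) :: L₄) :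
    ⟪R.act (cs.wordProd (taken L₃)) (R.root t), weight R s⟫ = 0 := by
  have h4 := S.act_weight_eq hl h₁ hd hsd h₃ h₂ hw
  have aux : ∀ L' : List (B × Bool), s ∉ L'.map Prod.fst → t ≠ s →
      ⟪R.act (cs.wordProd (taken L')) (R.root t), weight R s⟫ = 0 := fun L' h h' => by
    rw [inner_act_left, act_wordProd_inv_weight_of_notMem R fun h'' => h (taken_subset _ h''),
      inner_root_weight_of_ne R h']
  have key : ∀ L₅, L₃ = Ld ++ L₅ → L₂ = L₅ ++ (t, false) :: L₄ →
      ⟪R.act (cs.wordProd (taken L₃)) (R.root t), weight R s⟫ = 0 := by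
    rintro L₅ rfl rfl
    rw [List.map_append, List.map_cons] at h₂
    have hr := S.isReduced_right hl
    rw [← h₂] at hr
    have hg := S.bruhatLE_right (L₁ := L₁) (Ls := (s, false) :: Ld)
      (L₂ := L₅ ++ (t, false) :: L₄) hl (by simpa using h₂) hw
    rw [taken_cons_false] at hg
    set g := (cs.wordProd (taken l₁))⁻¹ * cs.wordProd (taken L₁) * cs.wordProd (taken Ld) with hgdef
    have h5 : R.act g⁻¹ (weight R s) = weight R s := by
      rw [hgdef, mul_inv_rev, mul_inv_rev, inv_inv, act_mul_apply, act_mul_apply, ← h4,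
        act_inv_apply_apply, act_wordProd_inv_weight_of_notMem R fun h => hsd (h₃ ▸ taken_subset _ h)]
    have h6 : R.act (g * cs.wordProd (taken L₅))⁻¹ (weight R s) =
        R.act (cs.wordProd (taken L₅))⁻¹ (weight R s) := by
      rw [mul_inv_rev, act_mul_apply, h5]
    have hr5 := isReduced_append_left hr
    have h7 := bruhatLE_wordProd_taken (R := R) hr5
    have h8 : L₅.map Prod.fst ++ t :: L₄.map Prod.fst =
        (L₅.map Prod.fst ++ [t]) ++ L₄.map Prod.fst := by simp
    have hr' := hr
    rw [h8] at hr'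
    have h9 := bruhatLE_mul_simple (R := R)
      (isNonneg_of_isReduced_concat R (isReduced_append_left hr'))
    simp only [List.nil_append, List.map_append, List.map_cons, taken_append, taken_cons_false,
      cs.wordProd_append (taken L₅), ← mul_assoc] at hg
    have h10 := act_inv_weight_eq (L := (t, false) :: L₄) hr h7 h6 (by simpa using hg)
    have h11 := act_inv_weight_eq (L := L₄) hr'
      (by rw [cs.wordProd_append, cs.wordProd_singleton]; exact BruhatLE.trans h7 h9) h6
      (by rwa [← h8])
    rw [h10, cs.wordProd_append, cs.wordProd_singleton, mul_inv_rev, act_mul_apply,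
      cs.inv_simple] at h11
    rw [taken_append, cs.wordProd_append, inner_act_left, mul_inv_rev, act_mul_apply,
      act_wordProd_inv_weight_of_notMem R fun h => hsd (h₃ ▸ taken_subset _ h), ← h6, h10]
    exact inner_eq_zero_of_act_simple R h11.symm
  rcases List.append_eq_append_iff.1 hL₂ with ⟨L₅, h5, h6⟩ | ⟨L₅, h5, h6⟩
  · exact key L₅ h5 h6
  · cases L₅ with
    | nil => exact key [] (by simpa using h5.symm) (by simpa using h6.symm)
    | cons p L₅ =>
      obtain ⟨rfl, -⟩ := List.cons.inj h6
      rw [← h₃, h5] at hsd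
      simp only [List.map_append, List.map_cons, List.mem_append, List.mem_cons, not_or] at hsd
      exact aux _ hsd.1 (Ne.symm hsd.2.1)

end Tight

end Skeleton

end Positions


/-! ### Facets and brick vectors in terms of marked words -/

section MarkedWord

variable {B W V : Type*} [Group W] {M : CoxeterMatrix B} {cs : CoxeterSystem M W}
  [NormedAddCommGroup V] [InnerProductSpace ℝ V] {R : SimpleRoots cs V}

/-- The word `Q` with the letters at the positions outside of `I` marked. -/
def markedWord (Q : List B) (I : Finset (Fin Q.length)) : List (B × Bool) :=
  (List.finRange Q.length).map fun k => (Q.get k, decide (k ∉ I))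

theorem length_markedWord (Q : List B) (I : Finset (Fin Q.length)) :
    (markedWord Q I).length = Q.length := by
  simp [markedWord]

theorem map_fst_markedWord (Q : List B) (I : Finset (Fin Q.length)) :
    (markedWord Q I).map Prod.fst = Q := by
  rw [markedWord, List.map_map]
  exact List.map_get_finRange Q

theorem taken_map (Q : List B) (I : Finset (Fin Q.length)) (l : List (Fin Q.length)) :
    taken (l.map fun k => (Q.get k, decide (k ∉ I))) = (l.filter (· ∉ I)).map Q.get := by
  rw [taken, List.filter_map, List.map_map]
  rfl

theorem taken_markedWord (Q : List B) (I : Finset (Fin Q.length)) :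
    taken (markedWord Q I) = subword Q Iᶜ := by
  rw [markedWord, taken_map, subword]
  simp

theorem length_subword (Q : List B) (J : Finset (Fin Q.length)) :
    (subword Q J).length = J.card := by
  rw [subword, List.length_map, ← List.toFinset_card_of_nodup ((List.nodup_finRange _).filter _)]
  congr 1
  ext k
  simp

theorem take_finRange (n : ℕ) (k : Fin n) :
    (List.finRange n).take k = (List.finRange n).filter (· < k) := by
  conv_rhs => rw [← List.take_append_drop k (List.finRange n), List.filter_append]
  rw [List.filter_eq_self.2, List.filter_eq_nil_iff.2, List.append_nil]
  · intro i hi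
    obtain ⟨j, hj, rfl⟩ := List.mem_drop_iff_getElem.1 hi
    simp [Fin.lt_def]
  · intro i hi
    obtain ⟨j, hj, rfl⟩ := List.mem_take_iff_getElem.1 hi
    simp [Fin.lt_def] at hj ⊢
    omega

theorem taken_take_markedWord (Q : List B) (I : Finset (Fin Q.length)) (k : Fin Q.length) :
    taken ((markedWord Q I).take k) = subword Q (Finset.univ.filter fun z => z < k ∧ z ∉ I) := by
  rw [markedWord, ← List.map_take, taken_map, subword, take_finRange, List.filter_filter]
  congr 2
  ext z
  simp [Bool.and_comm]

theorem exists_markedWord_eq {Q : List B} {L : List (B × Bool)} (h : L.map Prod.fst = Q) :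
    ∃ I, markedWord Q I = L := by
  subst h
  refine ⟨Finset.univ.filter fun k => (L[k]'(by simpa using k.2)).2 = false, ?_⟩
  apply List.ext_getElem
  · simp [length_markedWord]
  · intro i h1 h2
    simp [markedWord]

theorem markedWord_eq_append_cons (Q : List B) {I : Finset (Fin Q.length)} {i : Fin Q.length}
    (hi : i ∈ I) : markedWord Q I =
      (markedWord Q I).take i ++ (Q.get i, false) :: (markedWord Q I).drop (i + 1) := by
  have h : (i : ℕ) < (markedWord Q I).length := by
    rw [length_markedWord]
    exact i.2
  conv_lhs => rw [← List.take_append_drop i (markedWord Q I), List.drop_eq_getElem_cons h]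
  simp [markedWord, hi]

/-- All reduced words of the longest element have the same length, so the complement of a maximal
face is exactly one of them. -/
theorem isFacet_iff [Finite W] {Q : List B} {I : Finset (Fin Q.length)} :
    IsFacet cs Q I ↔ cs.IsReduced (taken (markedWord Q I)) ∧
      cs.wordProd (taken (markedWord Q I)) = longestElement cs := by
  rw [taken_markedWord]
  constructor
  · rintro ⟨⟨J, hJ, h1, h2⟩, hmax⟩
    have h3 : I ⊆ Jᶜ := fun i hi => Finset.mem_compl.2 fun hi' => Finset.mem_compl.1 (hJ hi') hi
    have h4 := hmax (y := Jᶜ) ⟨J, by simp, h1, h2⟩ h3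
    have h5 : J = Iᶜ := by rw [h3.antisymm h4, compl_compl]
    exact h5 ▸ ⟨h1, h2⟩
  · rintro ⟨h1, h2⟩
    refine ⟨⟨Iᶜ, subset_rfl, h1, h2⟩, ?_⟩
    rintro I' ⟨J, hJ, h3, h4⟩ hI
    have h5 : J.card = Iᶜ.card := by
      rw [← length_subword, ← length_subword, ← h3.eq, ← h1.eq, h2, h4]
    have h6 : J ⊆ Iᶜ := hJ.trans (Finset.compl_subset_compl.2 hI)
    have h7 := Finset.eq_of_subset_of_card_le h6 h5.ge
    rw [h7] at hJ
    exact Finset.compl_subset_compl.1 hJ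

theorem brickSum_eq_sum [Fintype B] (g : W) (L : List (B × Bool)) :
    brickSum R g L = ∑ k : Fin L.length,
      R.act (g * cs.wordProd (taken (L.take k))) (weight R (L.get k).1) := by
  induction L generalizing g with
  | nil => rfl
  | cons p L ih =>
    rw [brickSum, ih]
    simp only [List.length_cons, Fin.sum_univ_succ, Fin.val_zero, List.take_zero, taken_nil,
      cs.wordProd_nil, mul_one, List.get_cons_zero, Fin.val_succ, List.take_succ_cons]
    congr 1
    refine Finset.sum_congr rfl fun k _ => ?_
    rw [taken_cons p (L.take k), cs.wordProd_append, mul_assoc]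
    rfl

theorem brickVector_eq [Fintype B] (Q : List B) (I : Finset (Fin Q.length)) :
    brickVector R Q I = brickSum R 1 (markedWord Q I) := by
  rw [brickSum_eq_sum, brickVector]
  refine Fintype.sum_equiv (finCongr (length_markedWord Q I).symm) _ _ fun k => ?_
  rw [weightFunction, ← taken_take_markedWord, one_mul]
  simp [markedWord]
  rfl

theorem translationVector_eq [Fintype B] [Finite W] (c : CoxeterWord B) : translationVector R c =
    brickSum R 1 (allTaken (sortingWord cs c (longestElement cs))) := by
  rw [brickSum_eq_sum, translationVector]
  refine Fintype.sum_equiv (finCongr (by simp [allTaken])) _ _ fun k => ?_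
  have h : ∀ n, taken ((allTaken (sortingWord cs c (longestElement cs))).take n) =
      (sortingWord cs c (longestElement cs)).take n := fun n => by
    rw [allTaken, ← List.map_take]
    exact taken_allTaken _
  rw [one_mul, h]
  simp [allTaken]
  rfl

theorem weightListSum_eq [Fintype B] (c : CoxeterWord B) :
    weightListSum R c.letters = weightSum R := by
  classical
  rw [weightListSum, weightSum, ← List.sum_toFinset _ c.nodup]
  congr 1
  ext s
  simp [c.complete s]

end MarkedWord

/-! ### Flips move brick vectors along roots -/

section Flips

variable {B W V : Type*} [Group W] {M : CoxeterMatrix B} {cs : CoxeterSystem M W}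
  [NormedAddCommGroup V] [InnerProductSpace ℝ V] {R : SimpleRoots cs V}

theorem act_simple_sub (s : B) (v : V) : R.act (cs.simple s) v - v =
    -((2 * ⟪R.root s, v⟫ / ⟪R.root s, R.root s⟫) • R.root s) := by
  rw [act_simple_apply]
  abel

/-- If a root is moved to a simple root by a word, then the reflections correspond. -/
theorem simple_mul_wordProd_eq {s t : B} {x : W} {k : ℝ} (h : R.act x (R.root s) = k • R.root t) :
    x * cs.simple s = cs.simple t * x := by
  have h1 : R.act x (R.root s) = k • R.act 1 (R.root t) := by rw [h, act_one_apply]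
  have h2 := conj_simple_eq R h1
  rw [inv_one, mul_one, one_mul] at h2
  rw [← h2, inv_mul_cancel_right]

theorem exists_taken_eq_append_cons {L : List (B × Bool)} {u₁ u₂ : List B} {t : B}
    (h : taken L = u₁ ++ t :: u₂) :
    ∃ M₁ M₂, L = M₁ ++ (t, true) :: M₂ ∧ taken M₁ = u₁ ∧ taken M₂ = u₂ := by
  induction L generalizing u₁ with
  | nil => simp at h
  | cons p L ih =>
    obtain ⟨r, e⟩ := p
    cases e with
    | true =>
      rw [taken_cons_true] at h
      cases u₁ with
      | nil =>
        obtain ⟨rfl, rfl⟩ := List.cons.inj h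
        exact ⟨[], L, rfl, rfl, rfl⟩
      | cons r' u₁ =>
        obtain ⟨rfl, h'⟩ := List.cons.inj h
        obtain ⟨M₁, M₂, rfl, h1, h2⟩ := ih (u₁ := u₁) h'
        exact ⟨(r, true) :: M₁, M₂, rfl, by simp [h1], h2⟩
    | false =>
      obtain ⟨M₁, M₂, rfl, h1, h2⟩ := ih (by simpa using h)
      exact ⟨(r, false) :: M₁, M₂, rfl, by simpa using h1, h2⟩

variable [Fintype B]

theorem inner_brickSum_nonneg {L : List (B × Bool)} {v : V}
    (h : ∀ u₁ u₂, taken L = u₁ ++ u₂ → IsNonneg R (R.act (cs.wordProd u₁)⁻¹ v)) :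
    0 ≤ ⟪v, brickSum R 1 L⟫ := by
  have key : ∀ (u : List B) (L : List (B × Bool)),
      (∀ u₁ u₂, taken L = u₁ ++ u₂ → IsNonneg R (R.act (cs.wordProd (u ++ u₁))⁻¹ v)) →
      0 ≤ ⟪v, brickSum R (cs.wordProd u) L⟫ := by
    intro u L
    induction L generalizing u with
    | nil => simp [brickSum]
    | cons p L ih =>
      intro h
      rw [brickSum, inner_add_right, ← cs.wordProd_append]
      refine add_nonneg ?_ (ih _ fun u₁ u₂ hu => ?_)
      · rw [inner_act_right, real_inner_comm]
        refine (isDominant_weight R _).inner_nonneg ?_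
        simpa using h [] _ rfl
      · rw [List.append_assoc]
        exact h _ u₂ (by rw [taken_cons, hu, List.append_assoc])
  simpa using key [] L (by simpa using h)

/-- Moving the mark between `t` and `s` reflects exactly the weights after `s`, up to and including
that of `t`. Their sum `S` pairs positively with `α_s`: this root stays positive along `M₁` and ends
as a positive multiple of `α_t`. -/
theorem exists_flip_right {L₁ M₁ M₂ : List (B × Bool)} {s t : B} {k : ℝ} (hk : 0 < k)
    (hr : cs.IsReduced (taken M₁ ++ [t]))
    (h : R.act (cs.wordProd (taken M₁)) (R.root t) = k • R.root s) :
    cs.wordProd (taken (L₁ ++ (s, true) :: M₁ ++ (t, false) :: M₂)) =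
      cs.wordProd (taken (L₁ ++ (s, false) :: M₁ ++ (t, true) :: M₂)) ∧
    ∃ x : ℝ, 0 < x ∧ brickSum R 1 (L₁ ++ (s, true) :: M₁ ++ (t, false) :: M₂) =
      brickSum R 1 (L₁ ++ (s, false) :: M₁ ++ (t, true) :: M₂) -
        x • R.act (cs.wordProd (taken L₁)) (R.root s) := by
  have hc : cs.simple s * cs.wordProd (taken M₁) = cs.wordProd (taken M₁) * cs.simple t :=
    (simple_mul_wordProd_eq h).symm
  refine ⟨?_, ?_⟩
  · simp only [taken_append, taken_cons_true, taken_cons_false, cs.wordProd_append,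
      cs.wordProd_cons]
    rw [hc]
    simp [mul_assoc]
  set S := brickSum R 1 (M₁ ++ [(t, true)]) with hS
  have hpos : 0 < ⟪R.root s, S⟫ := by
    have h1 : ∀ u₁ u₂, taken M₁ = u₁ ++ u₂ →
        IsNonneg R (R.act (cs.wordProd u₁)⁻¹ (R.root s)) := by
      intro u₁ u₂ hu
      have h2 : R.root s = k⁻¹ • R.act (cs.wordProd (taken M₁)) (R.root t) := by
        rw [h, smul_smul, inv_mul_cancel₀ hk.ne', one_smul]
      rw [h2, map_smul, hu, cs.wordProd_append, act_mul_apply, act_inv_apply_apply]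
      rw [hu, List.append_assoc] at hr
      exact (isNonneg_of_isReduced_concat R (isReduced_append_right hr)).smul (inv_nonneg.2 hk.le)
    rw [hS, brickSum_append, inner_add_right]
    refine add_pos_of_nonneg_of_pos (inner_brickSum_nonneg h1) ?_
    rw [brickSum, brickSum, add_zero, one_mul, inner_act_right]
    have h2 : R.act (cs.wordProd (taken M₁))⁻¹ (R.root s) = k⁻¹ • R.root t := by
      rw [← act_inv_apply_apply R (cs.wordProd (taken M₁)) (R.root t), h, map_smul, smul_smul,
        inv_mul_cancel₀ hk.ne', one_smul]
    rw [h2, real_inner_smul_left]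
    exact mul_pos (inv_pos.2 hk) (inner_root_weight_self_pos R t)
  refine ⟨2 * ⟪R.root s, S⟫ / ⟪R.root s, R.root s⟫,
    div_pos (by linarith) (inner_root_self_pos R s), ?_⟩
  rw [← map_smul, eq_sub_iff_add_eq, ← neg_neg (_ • R.root s), ← act_simple_sub, map_neg,
    ← sub_eq_add_neg, sub_eq_iff_eq_add]
  have e1 : ∀ e e' : Bool, brickSum R 1 (L₁ ++ (s, e) :: M₁ ++ (t, e') :: M₂) =
      brickSum R 1 L₁ + R.act (cs.wordProd (taken L₁)) (weight R s) +
        R.act (cs.wordProd (taken L₁) * cs.wordProd (taken [(s, e)])) S +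
        brickSum R (cs.wordProd (taken L₁) * cs.wordProd (taken [(s, e)]) *
          cs.wordProd (taken M₁) * cs.wordProd (taken [(t, e')])) M₂ := by
    intro e e'
    rw [hS, ← brickSum_mul, mul_one]
    simp only [brickSum_append, brickSum, one_mul, taken_append, taken_cons (s, e) M₁,
      cs.wordProd_append, mul_assoc]
    abel
  rw [e1, e1]
  simp only [taken_cons_true, taken_cons_false, taken_nil, cs.wordProd_nil, mul_one,
    cs.wordProd_singleton, map_sub, act_mul_apply, mul_assoc, hc]
  abel

/-- The preceding flip read in the other direction; the two sign changes, of the displacement and of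
the root, cancel. -/
theorem exists_flip_left {M₁ M₂ L₂ : List (B × Bool)} {s t : B} {k : ℝ} (hk : 0 < k)
    (hr : cs.IsReduced (t :: taken M₂))
    (h : R.act (cs.wordProd (taken M₂)) (R.root s) = k • R.root t) :
    cs.wordProd (taken (M₁ ++ (t, false) :: M₂ ++ (s, true) :: L₂)) =
      cs.wordProd (taken (M₁ ++ (t, true) :: M₂ ++ (s, false) :: L₂)) ∧
    ∃ x : ℝ, 0 < x ∧ brickSum R 1 (M₁ ++ (t, false) :: M₂ ++ (s, true) :: L₂) =
      brickSum R 1 (M₁ ++ (t, true) :: M₂ ++ (s, false) :: L₂) -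
        x • R.act (cs.wordProd (taken (M₁ ++ (t, true) :: M₂))) (R.root s) := by
  have hr' : cs.IsReduced (taken M₂ ++ [s]) := by
    refine (isReduced_concat_iff R (u := taken M₂) (isReduced_append_right (u := [t]) hr)).2 ?_
    rw [h]
    exact (isNonneg_root R t).smul hk.le
  obtain ⟨h1, x, hx, h2⟩ := exists_flip_right (L₁ := M₁) (M₂ := L₂) hk hr' h
  refine ⟨h1.symm, x * k⁻¹, mul_pos hx (inv_pos.2 hk), ?_⟩
  rw [h2, taken_append, taken_cons_true, cs.wordProd_append, cs.wordProd_cons, act_mul_apply,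
    act_mul_apply, h, map_smul, act_simple_root_self, smul_neg, map_neg, map_smul, smul_neg,
    smul_smul, mul_assoc, inv_mul_cancel₀ hk.ne', mul_one]
  abel

/-- Every position outside of a reduced subword for the longest element can be flipped. -/
theorem exists_flip [Finite W] {L₁ L₂ : List (B × Bool)} {s : B}
    (hr : cs.IsReduced (taken (L₁ ++ (s, false) :: L₂)))
    (hw : cs.wordProd (taken (L₁ ++ (s, false) :: L₂)) = longestElement cs) :
    ∃ L' : List (B × Bool), L'.map Prod.fst = (L₁ ++ (s, false) :: L₂).map Prod.fst ∧
      cs.IsReduced (taken L') ∧ cs.wordProd (taken L') = longestElement cs ∧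
      ∃ x : ℝ, 0 < x ∧ brickSum R 1 L' = brickSum R 1 (L₁ ++ (s, false) :: L₂) -
        x • R.act (cs.wordProd (taken L₁)) (R.root s) := by
  have hred : ∀ L' : List (B × Bool), cs.wordProd (taken L') = longestElement cs →
      (taken L').length = (taken (L₁ ++ (s, false) :: L₂)).length → cs.IsReduced (taken L') := by
    intro L' h1 h2
    rw [CoxeterSystem.IsReduced, h1, h2, ← hw]
    exact hr.eq
  rcases (isRootRay_act_root R (cs.wordProd (taken L₁)) s).isNonneg_or with hn | hn
  -- As `L₁ α_s` is positive and `w₀` makes it negative, the sign change happens to the right of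
  -- `s`. In the other case it has already happened to the left.
  · have h1 : IsNonneg R (-R.act (cs.wordProd (taken L₂).reverse) (R.root s)) := by
      have h2 : cs.wordProd (taken L₂).reverse =
          (longestElement cs)⁻¹ * cs.wordProd (taken L₁) := by
        rw [cs.wordProd_reverse, ← hw]
        simp [cs.wordProd_append]
      have h3 : (longestElement cs)⁻¹ = longestElement cs :=
        inv_eq_of_mul_eq_one_left (longestElement_mul_self R)
      rw [h2, act_mul_apply, h3]
      exact isNonneg_neg_act_of_forall R (isNonneg_neg_act_longestElement_root R) hn
    obtain ⟨u₁, t, u₂, k, hk, h2, h3⟩ :=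
      exists_sign_change (isRootRay_root R s) (isNonneg_root R s) h1
    have h4 : taken L₂ = u₂.reverse ++ t :: u₁.reverse := by
      rw [← List.reverse_reverse (taken L₂), h2]
      simp
    obtain ⟨M₁, M₂, rfl, h5, h6⟩ := exists_taken_eq_append_cons h4
    have h7 : R.act (cs.wordProd (taken M₁)) (R.root t) = k⁻¹ • R.root s := by
      rw [h5, cs.wordProd_reverse, ← act_inv_apply_apply R (cs.wordProd u₂) (R.root s), h3,
        map_smul, smul_smul, inv_mul_cancel₀ hk.ne', one_smul]
    have h8 : cs.IsReduced (taken M₁ ++ [t]) := by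
      have h9 : taken (L₁ ++ (s, false) :: (M₁ ++ (t, true) :: M₂)) =
          taken L₁ ++ ((taken M₁ ++ [t]) ++ taken M₂) := by simp
      rw [h9] at hr
      exact isReduced_append_left (isReduced_append_right hr)
    obtain ⟨h9, x, hx, h10⟩ := exists_flip_right (L₁ := L₁) (M₂ := M₂) (inv_pos.2 hk) h8 h7
    have e : L₁ ++ (s, false) :: (M₁ ++ (t, true) :: M₂) =
        L₁ ++ (s, false) :: M₁ ++ (t, true) :: M₂ := by simp
    rw [e] at hw hred ⊢
    exact ⟨_, by simp, hred _ (h9.trans hw) (by simp; omega), h9.trans hw, x, hx, h10⟩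
  · obtain ⟨u₁, t, u₂, k, hk, h2, h3⟩ :=
      exists_sign_change (isRootRay_root R s) (isNonneg_root R s) hn
    obtain ⟨M₁, M₂, rfl, h5, rfl⟩ := exists_taken_eq_append_cons h2
    have h8 : cs.IsReduced (t :: taken M₂) := by
      have h9 : taken (M₁ ++ (t, true) :: M₂ ++ (s, false) :: L₂) =
          taken M₁ ++ ((t :: taken M₂) ++ taken L₂) := by simp
      rw [h9] at hr
      exact isReduced_append_left (isReduced_append_right hr)
    obtain ⟨h9, x, hx, h10⟩ := exists_flip_left (M₁ := M₁) (L₂ := L₂) hk h8 h3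
    exact ⟨_, by simp, hred _ (h9.trans hw) (by simp; omega), h9.trans hw, x, hx, h10⟩

end Flips


/-! ### Simplicial cones from biorthogonal families -/

section Biorthogonal

variable {ι V : Type*} [Fintype ι] [NormedAddCommGroup V] [InnerProductSpace ℝ V]

theorem exists_eq_sum_of_biorthogonal [FiniteDimensional ℝ V]
    (hι : Fintype.card ι = Module.finrank ℝ V) {r ρ : ι → V} (h₀ : ∀ i j, j ≠ i → ⟪ρ i, r j⟫ = 0)
    (h₁ : ∀ i, 0 < ⟪ρ i, r i⟫) (v : V) : ∃ a : ι → ℝ, v = ∑ i, a i • r i ∧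
      ∀ i, ⟪ρ i, v⟫ = a i * ⟪ρ i, r i⟫ := by
  have key : ∀ (a : ι → ℝ) i, ⟪ρ i, ∑ j, a j • r j⟫ = a i * ⟪ρ i, r i⟫ := by
    intro a i
    rw [inner_sum, Finset.sum_eq_single i, real_inner_smul_right]
    · intro j _ hj
      rw [real_inner_smul_right, h₀ i j hj, mul_zero]
    · simp
  have hli : LinearIndependent ℝ r := by
    rw [Fintype.linearIndependent_iff]
    intro a ha i
    have h := key a i
    rw [ha, inner_zero_right, eq_comm, mul_eq_zero] at h
    exact h.resolve_right (h₁ i).ne'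
  have hspan := hli.span_eq_top_of_card_eq_finrank' hι
  have hv : v ∈ Submodule.span ℝ (Set.range r) := hspan ▸ Submodule.mem_top
  obtain ⟨a, ha⟩ := (Submodule.mem_span_range_iff_exists_fun ℝ).1 hv
  exact ⟨a, ha.symm, fun i => ha ▸ key a i⟩

end Biorthogonal

/-! ### Locating facets and singletons in `Q` -/

section Positions

theorem markedWord_eq_of_lt {B : Type*} (Q : List B) {I : Finset (Fin Q.length)} {i j : Fin Q.length}
    (hi : i ∈ I) (hj : j ∈ I) (hij : i < j) : ∃ L,
      (markedWord Q I).take j = (markedWord Q I).take i ++ (Q.get i, false) :: L ∧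
      (markedWord Q I).drop (i + 1) = L ++ (Q.get j, false) :: (markedWord Q I).drop (j + 1) := by
  have h1 := markedWord_eq_append_cons Q hi
  have h2 := markedWord_eq_append_cons Q hj
  have hlen := length_markedWord Q I
  have hi' := i.2
  have hj' := j.2
  have hij' : (i : ℕ) < j := hij
  refine ⟨((markedWord Q I).drop (i + 1)).take (j - (i + 1)), ?_, ?_⟩
  · conv_lhs => rw [h1]
    rw [List.take_append, List.take_of_length_le (by simp; omega)]
    congr 1
    rw [List.length_take, hlen, min_eq_left (by omega)]
    obtain ⟨k, hk⟩ : ∃ k, (j : ℕ) - i = k + 1 := ⟨j - i - 1, by omega⟩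
    rw [hk, List.take_succ_cons]
    congr 2
    omega
  · conv_lhs => rw [h2]
    rw [List.drop_append_of_le_length (by simp; omega), List.drop_take]

variable {B W V : Type*} [Fintype B] [Group W] {M : CoxeterMatrix B} {cs : CoxeterSystem M W}
  [NormedAddCommGroup V] [InnerProductSpace ℝ V] {R : SimpleRoots cs V} {c : CoxeterWord B}

/-- After the last `s` of the matching prefix, the next `s` read in `Q` is a suitable position: the
letters taken in between are not `s`, so they fix `ω_s`. -/
theorem IsSingleton.exists_position {x : W} (hx : IsSingleton cs c x) {q : List B}
    {l : List (B × Bool)} (hl : Run c.letters l []) (h : Greedy R 1 c.letters q (taken l)) (s : B) :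
    ∃ l₁ e l₂, l = l₁ ++ (s, e) :: l₂ ∧
      R.act x (weight R s) = R.act (cs.wordProd (taken l₁)) (weight R s) := by
  rcases hx.exists_prefix h s with h1 | ⟨w₁, w₂, h1, h2⟩
  · obtain ⟨l₁, e, l₂, h3, h4⟩ := hl.exists_next (c.complete s)
    exact ⟨l₁, e, l₂, h3, by rw [h1, act_wordProd_weight_of_notMem R h4]⟩
  · obtain ⟨l₁, l', d, rfl, h3, h4, h5⟩ := hl.exists_of_taken_eq h1
    obtain ⟨l₂, e, l₃, rfl, h6⟩ := h5.exists_next h4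
    refine ⟨l₁ ++ l₂, e, l₃, by simp, ?_⟩
    rw [h2, taken_append, h3, cs.wordProd_append (w₁ ++ [s]), act_mul_apply,
      act_wordProd_weight_of_notMem R h6]

end Positions

/-! ### The brick polytope is the translated associahedron -/

section Main

variable {B W V : Type*} [Fintype B] [Group W] [Finite W] {M : CoxeterMatrix B}
  {cs : CoxeterSystem M W} [NormedAddCommGroup V] [InnerProductSpace ℝ V] {R : SimpleRoots cs V}

theorem Skeleton.tight {c : List B} {l L L₁ L₂ : List (B × Bool)} {s : B} (S : Skeleton R c l)
    (hL : L.map Prod.fst = l.map Prod.fst) (hw : cs.wordProd (taken L) = longestElement cs)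
    (hs : L = L₁ ++ (s, false) :: L₂) :
    ∃ w₁ w₂, taken l = w₁ ++ w₂ ∧
      R.act (cs.wordProd (taken L₁)) (weight R s) = R.act (cs.wordProd w₁) (weight R s) ∧
      ⟪R.act (cs.wordProd w₁) (weight R s), brickSum R 1 L⟫ =
        ⟪R.act (cs.wordProd w₁) (weight R s), brickSum R 1 (allTaken (taken l))⟫ +
          ⟪weight R s, weightListSum R c⟫ ∧
      (∀ L₃ t L₄, L₁ = L₃ ++ (t, false) :: L₄ →
        ⟪R.root t, R.act (cs.wordProd (taken L₄)) (weight R s)⟫ = 0) ∧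
      ∀ L₃ t L₄, L₂ = L₃ ++ (t, false) :: L₄ →
        ⟪R.act (cs.wordProd (taken L₃)) (R.root t), weight R s⟫ = 0 := by
  subst hs
  rw [List.map_append, List.map_cons] at hL
  obtain ⟨l₁, l', hl, h1, h2⟩ := List.map_eq_append_iff.1 hL.symm
  obtain ⟨⟨s', e⟩, l₂, rfl, h3, h4⟩ := List.map_eq_cons_iff.1 h2
  obtain rfl : s' = s := h3
  obtain ⟨d, hd, hsd, h5⟩ := S.exists_active hl
  rw [h5] at h4
  obtain ⟨Ld, Lr, rfl, h6, h7⟩ := List.map_eq_append_iff.1 h4.symm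
  have h8 : L₁ ++ (s', false) :: (Ld ++ Lr) = L₁ ++ (s', false) :: Ld ++ Lr := by simp
  rw [h8] at hw ⊢
  have h9 := S.inner_brickSum_eq hl h1.symm hd hsd h6 h7 hw
  rw [inner_add_right, ← mul_one (cs.wordProd (taken l₁))⁻¹, brickSum_mul, brickSum_mul,
    inner_act_right, inner_act_right, inv_inv] at h9
  refine ⟨taken l₁, taken ((s', e) :: l₂), by rw [hl, taken_append],
    S.act_weight_eq hl h1.symm hd hsd h6 h7 hw, h9, fun L₃ t L₄ h => ?_, fun L₃ t L₄ h => ?_⟩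
  · exact S.inner_root_left hl h1.symm hd hsd h6 h7 hw h
  · exact S.inner_root_right hl h1.symm hd hsd h6 h7 hw h

variable {c : CoxeterWord B}

theorem exists_skeleton (R : SimpleRoots cs V) (c : CoxeterWord B) :
    ∃ l, Skeleton R c.letters l ∧ l.map Prod.fst = cw₀ cs c ∧
      taken l = sortingWord cs c (longestElement cs) ∧
      Greedy R 1 c.letters (cw₀ cs c) (sortingWord cs c (longestElement cs)) := by
  obtain ⟨q, w, h⟩ := exists_greedy R 1 c.letters
  have hnil : cs.IsReduced ([] : List B) := by simp [CoxeterSystem.IsReduced]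
  have hr : cs.IsReduced w := by simpa using h.isReduced hnil cs.wordProd_nil
  have hw := h.wordProd_eq c.nodup c.complete
  have hs : sortingWord cs c (longestElement cs) = w := by
    rw [← hw]
    exact sortingWord_eq c R h.steps hr
  have hq : cw₀ cs c = q := by
    rw [cw₀, hs]
    simpa using h.steps.append_eq.symm
  obtain ⟨l, h1, h2, h3, h4⟩ := Greedy.exists_run (u := []) c.nodup (.refl _) hnil
    (by rwa [cs.wordProd_nil])
  rw [hs, hq]
  exact ⟨l, ⟨c.nodup, h3, h4, h2 ▸ hr, h2 ▸ hw⟩, h1, h2, h⟩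

theorem brickVector_sub_mem_associahedron {I : Finset (Fin (cw₀ cs c).length)}
    (hI : IsFacet cs (cw₀ cs c) I) : brickVector R (cw₀ cs c) I - translationVector R c ∈
      associahedron R c (weightSum R) := by
  obtain ⟨l, S, h1, h2, h3⟩ := exists_skeleton R c
  rw [associahedron]
  simp only [Set.mem_iInter]
  intro x hx s
  rw [← h2] at h3
  obtain ⟨l₁, e, l₂, h4, h5⟩ := hx.exists_position S.run h3 s
  have h6 := S.inner_brickSum_le h4 ((map_fst_markedWord _ I).trans h1.symm)
    (isFacet_iff.1 hI).2 (isDominant_weight R s)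
  rw [inner_add_right, ← mul_one (cs.wordProd (taken l₁))⁻¹, brickSum_mul, brickSum_mul,
    inner_act_right, inner_act_right, inv_inv] at h6
  rw [halfSpace, Set.mem_ofPred_eq, inner_sub_right, brickVector_eq, translationVector_eq, ← h2, h5,
    ← weightListSum_eq c]
  linarith

/-- The complement of a facet spells a reduced word of the longest element, as long as `w₀(c)`, so a
facet has as many positions as `c` has letters. -/
theorem card_facet (R : SimpleRoots cs V) {I : Finset (Fin (cw₀ cs c).length)}
    (hI : IsFacet cs (cw₀ cs c) I) : I.card = Module.finrank ℝ V := by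
  classical
  obtain ⟨l, S, h1, h2, h3⟩ := exists_skeleton R c
  have h4 := isFacet_iff.1 hI
  have h5 : Iᶜ.card = (taken l).length := by
    rw [← length_subword, ← taken_markedWord, ← h4.1.eq, ← S.isReduced.eq, h4.2, S.wordProd_eq]
  have h6 : (cw₀ cs c).length = c.letters.length + (taken l).length := by
    rw [cw₀, h2, List.length_append]
  have h7 := Finset.card_add_card_compl I
  have h8 : c.letters.length = Fintype.card B := by
    rw [← List.toFinset_card_of_nodup c.nodup, ← Finset.card_univ]
    congr 1
    ext s
    simp [c.complete s]
  rw [Fintype.card_fin] at h7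
  rw [Module.finrank_eq_card_basis R.root]
  omega

/-- The facet `I` of the subword complex yields a simplicial cone. -/
theorem exists_biorthogonal {I : Finset (Fin (cw₀ cs c).length)}
    (hI : IsFacet cs (cw₀ cs c) I) : ∃ r ρ : I → V, (∀ i j, j ≠ i → ⟪ρ i, r j⟫ = 0) ∧
      (∀ i, 0 < ⟪ρ i, r i⟫) ∧
      (∀ i, ∀ v ∈ associahedron R c (weightSum R),
        ⟪ρ i, v⟫ ≤ ⟪ρ i, brickVector R (cw₀ cs c) I - translationVector R c⟫) ∧
      ∀ i, ∃ I', IsFacet cs (cw₀ cs c) I' ∧ ∃ x : ℝ, 0 < x ∧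
        brickVector R (cw₀ cs c) I' = brickVector R (cw₀ cs c) I - x • r i := by
  obtain ⟨l, S, h1, h2, h3⟩ := exists_skeleton R c
  have hF := isFacet_iff.1 hI
  have hmap := (map_fst_markedWord _ I).trans h1.symm
  let g : I → W := fun i => cs.wordProd (taken ((markedWord (cw₀ cs c) I).take i))
  refine ⟨fun i => R.act (g i) (R.root ((cw₀ cs c).get i)),
    fun i => R.act (g i) (weight R ((cw₀ cs c).get i)), ?_, ?_, ?_, ?_⟩
  · intro i j hji
    beta_reduce
    obtain ⟨w₁, w₂, -, -, -, h5, h6⟩ := S.tight hmap hF.2 (markedWord_eq_append_cons _ i.2)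
    rcases lt_or_gt_of_ne (Subtype.coe_injective.ne hji) with hlt | hlt
    · obtain ⟨L, h7, -⟩ := markedWord_eq_of_lt _ j.2 i.2 hlt
      have h8 : g i = g j * cs.wordProd (taken L) := by
        simp only [g]
        rw [h7, taken_append, taken_cons_false, cs.wordProd_append]
      rw [h8, act_mul_apply, LinearIsometryEquiv.inner_map_map, real_inner_comm]
      exact h5 _ _ _ h7
    · obtain ⟨L, h7, h8⟩ := markedWord_eq_of_lt _ i.2 j.2 hlt
      have h9 : g j = g i * cs.wordProd (taken L) := by
        simp only [g]
        rw [h7, taken_append, taken_cons_false, cs.wordProd_append]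
      rw [h9, act_mul_apply, LinearIsometryEquiv.inner_map_map, real_inner_comm]
      exact h6 _ _ _ h8
  · intro i
    beta_reduce
    rw [LinearIsometryEquiv.inner_map_map, real_inner_comm]
    exact inner_root_weight_self_pos R _
  · intro i v hv
    obtain ⟨w₁, w₂, h4, h5, h6, -⟩ := S.tight hmap hF.2 (markedWord_eq_append_cons _ i.2)
    rw [h4] at h2
    rw [← h2] at h3
    rw [associahedron] at hv
    simp only [Set.mem_iInter] at hv
    have h7 := hv _ h3.isSingleton_of_append ((cw₀ cs c).get i)
    rw [halfSpace, Set.mem_ofPred_eq] at h7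
    simp only [g]
    rw [h5, inner_sub_right, brickVector_eq, translationVector_eq, ← h2, ← h4, h6,
      weightListSum_eq c, add_sub_cancel_left]
    exact h7
  · intro i
    have hs := markedWord_eq_append_cons (cw₀ cs c) i.2
    obtain ⟨L', h4, h5, h6, x, hx, h7⟩ := exists_flip (R := R) (hs ▸ hF.1) (hs ▸ hF.2)
    rw [← hs] at h4 h7
    obtain ⟨I', rfl⟩ := exists_markedWord_eq (h4.trans (map_fst_markedWord _ I))
    exact ⟨I', isFacet_iff.2 ⟨h5, h6⟩, x, hx, by rw [brickVector_eq, brickVector_eq, h7]⟩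

theorem exists_facet (R : SimpleRoots cs V) (c : CoxeterWord B) :
    ∃ I, IsFacet cs (cw₀ cs c) I := by
  obtain ⟨l, S, h1, h2, h3⟩ := exists_skeleton R c
  have h4 : ∀ u : List B, (u.map fun s => (s, false)).map Prod.fst = u ∧
      taken (u.map fun s => (s, false)) = [] := by
    intro u
    induction u with
    | nil => exact ⟨rfl, rfl⟩
    | cons s u ih => simp_all
  have h5 : (allTaken (taken l)).map Prod.fst = taken l := by
    rw [allTaken, List.map_map]
    exact List.map_id _
  obtain ⟨I, hI⟩ := exists_markedWord_eq (Q := cw₀ cs c)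
    (L := c.letters.map (fun s => (s, false)) ++ allTaken (taken l))
    (by rw [List.map_append, (h4 _).1, h5, cw₀, h2])
  refine ⟨I, isFacet_iff.2 ?_⟩
  rw [hI, taken_append, (h4 _).2, taken_allTaken, List.nil_append]
  exact ⟨S.isReduced, S.wordProd_eq⟩

theorem brickPolytope_eq_image (R : SimpleRoots cs V) (c : CoxeterWord B) :
    brickPolytope R (cw₀ cs c) =
      (fun v => translationVector R c + v) '' associahedron R c (weightSum R) := by
  have : FiniteDimensional ℝ V := Module.Finite.of_basis R.root
  have : CompleteSpace V := FiniteDimensional.complete ℝ V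
  refine Set.Subset.antisymm ?_ ?_
  · refine convexHull_min ?_ ?_
    · rintro _ ⟨I, hI, rfl⟩
      exact ⟨_, brickVector_sub_mem_associahedron hI, add_sub_cancel _ _⟩
    · refine Convex.translate ?_ _
      refine convex_iInter fun x => convex_iInter fun _ => convex_iInter fun s => ?_
      exact convex_halfSpace_le (𝕜 := ℝ) (innerₗ V (R.act x (weight R s))).isLinear _
  · rintro _ ⟨v, hv, rfl⟩
    by_contra hmem
    have hfin : {v | ∃ I, IsFacet cs (cw₀ cs c) I ∧ brickVector R (cw₀ cs c) I = v}.Finite :=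
      (Set.finite_range (brickVector R (cw₀ cs c))).subset fun _ ⟨I, _, h⟩ => ⟨I, h⟩
    obtain ⟨f, u, h1, h2⟩ := geometric_hahn_banach_closed_point (convex_convexHull ℝ _)
      (hfin.isCompact_convexHull ℝ).isClosed hmem
    -- Choose a facet maximizing the separating functional. Its flips show that `f` is nonnegative
    -- on every `r i`, and the tight inequalities make the coefficients of `v - (B(I) - Ω)`
    -- nonpositive.
    obtain ⟨I, hI, hmax⟩ := Set.exists_max_image {I | IsFacet cs (cw₀ cs c) I}
      (fun I => f (brickVector R (cw₀ cs c) I)) (Set.toFinite _) (exists_facet R c)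
    obtain ⟨r, ρ, hb₀, hb₁, hle, hflip⟩ := exists_biorthogonal (R := R) hI
    obtain ⟨a, ha, ha'⟩ := exists_eq_sum_of_biorthogonal
      (by rw [Fintype.card_coe]; exact card_facet R hI) hb₀ hb₁
      (v - (brickVector R (cw₀ cs c) I - translationVector R c))
    have h3 : f (v - (brickVector R (cw₀ cs c) I - translationVector R c)) ≤ 0 := by
      rw [ha, map_sum]
      refine Finset.sum_nonpos fun i _ => ?_
      rw [map_smul, smul_eq_mul]
      refine mul_nonpos_of_nonpos_of_nonneg ?_ ?_
      · have h4 := hle i v hv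
        have h5 := ha' i
        rw [inner_sub_right] at h5
        by_contra! h6
        have := mul_pos h6 (hb₁ i)
        linarith
      · obtain ⟨I', hI', x, hx, h4⟩ := hflip i
        have h5 := hmax I' hI'
        simp only [h4, map_sub, map_smul, smul_eq_mul] at h5
        by_contra! h6
        have := mul_neg_of_pos_of_neg hx h6
        linarith
    have h4 := h1 _ (subset_convexHull ℝ _ ⟨I, hI, rfl⟩)
    simp only [map_sub, map_add] at h2 h3
    linarith

/-- In a convex combination equal to this point, every tight inequality is tight at both ends;
biorthogonality leaves no freedom for the difference. -/
theorem brickVector_sub_mem_extremePoints {I : Finset (Fin (cw₀ cs c).length)}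
    (hI : IsFacet cs (cw₀ cs c) I) : brickVector R (cw₀ cs c) I - translationVector R c ∈
      (associahedron R c (weightSum R)).extremePoints ℝ := by
  have : FiniteDimensional ℝ V := Module.Finite.of_basis R.root
  obtain ⟨r, ρ, hb₀, hb₁, hle, -⟩ := exists_biorthogonal (R := R) hI
  refine ⟨brickVector_sub_mem_associahedron hI, ?_⟩
  rintro v₁ h₁ v₂ h₂ ⟨x, y, hx, hy, hxy, h⟩
  obtain ⟨a, ha, ha'⟩ := exists_eq_sum_of_biorthogonal
    (by rw [Fintype.card_coe]; exact card_facet R hI) hb₀ hb₁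
    (v₁ - (brickVector R (cw₀ cs c) I - translationVector R c))
  rw [← sub_eq_zero, ha]
  refine Finset.sum_eq_zero fun i _ => ?_
  have h3 := hle i v₁ h₁
  have h4 := hle i v₂ h₂
  have h5 := congrArg (fun v => ⟪ρ i, v⟫) h
  simp only [inner_add_right, real_inner_smul_right] at h5
  have h6 := ha' i
  rw [inner_sub_right] at h6
  set z := ⟪ρ i, brickVector R (cw₀ cs c) I - translationVector R c⟫
  have h7 : ⟪ρ i, v₁⟫ = z := by
    obtain rfl : y = 1 - x := by linarith
    refine le_antisymm h3 (not_lt.1 fun h8 => ?_)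
    nlinarith [mul_lt_mul_of_pos_left h8 hx, mul_le_mul_of_nonneg_left h4 hy.le]
  rw [h7, sub_self, eq_comm, mul_eq_zero] at h6
  rw [h6.resolve_right (hb₁ i).ne', zero_smul]

theorem extremePoints_associahedron (R : SimpleRoots cs V) (c : CoxeterWord B) :
    (associahedron R c (weightSum R)).extremePoints ℝ =
      {v | ∃ I, IsFacet cs (cw₀ cs c) I ∧
        v = brickVector R (cw₀ cs c) I - translationVector R c} := by
  refine Set.Subset.antisymm ?_ ?_
  · intro v hv
    -- Extreme points of a convex hull belong to the generating set, so a translated vertex is a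
    -- brick vector.
    have h1 : translationVector R c + v ∈ (brickPolytope R (cw₀ cs c)).extremePoints ℝ := by
      rw [brickPolytope_eq_image]
      refine ⟨⟨v, hv.1, rfl⟩, ?_⟩
      rintro _ ⟨v₁, h₁, rfl⟩ _ ⟨v₂, h₂, rfl⟩ ⟨x, y, hx, hy, hxy, h⟩
      have h2 : x • v₁ + y • v₂ = v := by
        have h3 : x • (translationVector R c + v₁) + y • (translationVector R c + v₂) =
            (x + y) • translationVector R c + (x • v₁ + y • v₂) := by module
        rw [hxy, one_smul] at h3
        exact add_left_cancel (h3.symm.trans h)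
      rw [hv.2 h₁ h₂ ⟨x, y, hx, hy, hxy, h2⟩]
    obtain ⟨I, hI, h2⟩ := extremePoints_convexHull_subset h1
    exact ⟨I, hI, by rw [h2, add_sub_cancel_left]⟩
  · rintro _ ⟨I, hI, rfl⟩
    exact brickVector_sub_mem_extremePoints hI

end Main

end BrickPolytope

theorem mainTheorem8 {B W V : Type*} [Fintype B] [Group W] [Finite W] {M : CoxeterMatrix B}
    (cs : CoxeterSystem M W) [NormedAddCommGroup V] [InnerProductSpace ℝ V]
    (R : BrickPolytope.SimpleRoots cs V) (c : BrickPolytope.CoxeterWord B) :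
    BrickPolytope.brickPolytope R (BrickPolytope.cw₀ cs c) =
        (fun v => BrickPolytope.translationVector R c + v) ''
          BrickPolytope.associahedron R c (BrickPolytope.weightSum R) ∧
      (BrickPolytope.associahedron R c (BrickPolytope.weightSum R)).extremePoints ℝ =
        {v | ∃ I, BrickPolytope.IsFacet cs (BrickPolytope.cw₀ cs c) I ∧
          v = BrickPolytope.brickVector R (BrickPolytope.cw₀ cs c) I -
            BrickPolytope.translationVector R c} := by
  exact ⟨BrickPolytope.brickPolytope_eq_image R c, BrickPolytope.extremePoints_associahedron R c⟩
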